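/- **Theorem 3.10.** The following are equivalent for every $X\in\{0,1\}^\omega$. 1. $X$ is Martin-Löf BPS random. 2. $X$ is Kolmogorov BPS random. 3. $X$ is quick process BPS random. The notions are as follows. A function is in FPSPACE if it is computed by a deterministic Turing machine with a read-only input tape, finitely many work tapes and a write-only output tape that halts on every input, such that both the space used on the work tapes and the length of the output are bounded by a polynomial in the length of the input; a function $f:\{1\}^*\to\{1\}^*$ is PTIME if it is computed by such a machine in time polynomial in the length of the input. A pair $(1^n,\tau)$ is given to a machine as the string $1^n0\tau$. For $X\in\{0,1\}^\omega$, $X\restriction m$ is the initial segment of $X$ of length $m$; for a set $G$ of strings, $[G]$ is the set of all $X\in\{0,1\}^\omega$ with an initial segment in $G$; and $\mu$ is the uniform (fair coin) measure on $\{0,1\}^\omega$. * A PSPACE test $(U_n)_{n\ge 0}$ is specified by an FPSPACE function $G:\{1\}^*\times\{0,1\}^*\to\{0,1\}$ and a strictly length-increasing PTIME function $f:\{1\}^*\to\{1\}^*$ such that, for every $n$, the set $U_n=[G_n]$, where $G_n=\{\tau\in\{0,1\}^{*} : |\tau|\le |f(1^n)|,\ G(1^n,\tau)=1\}$, satisfies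 $\mu(U_n)\le 2^{-n}$. $X$ is *Martin-Löf BPS random* if for every PSPACE test $(U_n)_{n\ge0}$ there is an $n$ with $X\notin U_n$. * For $M:\{0,1\}^*\to\{0,1\}^*$, $C_M(\tau)$ is the length of a shortest $\sigma$ with $M(\sigma)=\tau$ ($\infty$ if there is none). $X$ is *Kolmogorov BPS random* if there do not exist an FPSPACE function $M:\{0,1\}^*\to\{0,1\}^*$ and a PTIME function $f:\{1\}^*\to\{1\}^*$ such that $C_M(X\restriction |f(1^n)|)\le |f(1^n)|-n$ for every $n\in\mathbb N$. * A total function $M:\{0,1\}^*\to\{0,1\}^*$ is an FPSPACE BPS quick process machine if $M$ is in FPSPACE, $M(\tau)$ is an initial segment of $M(\tau')$ whenever $\tau$ is an initial segment of $\tau'$, and there is a nondecreasing function $h:\mathbb N\to\mathbb N$ with $\lim_n h(n)=\infty$ such that $1^n\mapsto 1^{h(n)}$ is PTIME and $|M(\tau)|\ge h(|\tau|)$ for all $\tau$. $X$ is *quick process BPS random* if there do not exist an FPSPACE BPS quick process machine $M$ and a PTIME function $f:\{1\}^*\to\{1\}^*$ such that $C_M(X\restriction |f(1^n)|)\le |f(1^n)|-n$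 for every $n\in\mathbb N$. -/

import Mathlib

open MeasureTheory Filter

namespace BPS

/-! ### Turing machines with a read-only input tape and a write-only output tape -/

/-- What the input head sees: the left end marker, a bit of the input, or the right end marker. -/
inductive InSym where
  | leftEnd
  | bit (b : Bool)
  | rightEnd

/-- Head movements. -/
inductive Move where
  | left
  | stay
  | right

/-- New position of a head on a one-way infinite tape (a left move in cell `0` has no effect). -/
def Move.apply : Move → ℕ → ℕ
  | .left, p => p - 1
  | .stay, p => p
  | .right, p => p + 1

/-- A deterministic Turing machine with a two-way read-only input tape, finitely many read-write
work tapes and a one-way write-only output tape.  A work cell contains `none` (blank) or a symbol.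
Given the state, the scanned input symbol and the scanned work symbols, the machine either halts
(`none`), or enters a new state, moves its input head, writes and moves on every work tape, and
possibly writes one bit on the output tape. -/
structure Machine where
  State : Type
  Sym : Type
  Work : Type
  finite_state : Finite State
  finite_sym : Finite Sym
  finite_work : Finite Work
  start : State
  δ : State → InSym → (Work → Option Sym) →
    Option (State × Move × (Work → Option Sym × Move) × Option Bool)

/-- The symbol in cell `p` of the input tape: cell `0` holds the left end marker, cells
`1, …, |x|` hold the input `x`, then comes the right end marker. -/
def inputSym (x : List Bool) : ℕ → InSym
  | 0 => .leftEnd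
  | p + 1 => match x[p]? with
    | some b => .bit b
    | none => .rightEnd

namespace Machine

/-- Configurations. -/
structure Cfg (M : Machine) where
  state : M.State
  inPos : ℕ
  tape : M.Work → ℕ → Option M.Sym
  head : M.Work → ℕ
  out : List Bool

variable (M : Machine)

/-- The initial configuration: empty work tapes and output tape, every work head on cell `0`,
the input head on the first input bit. -/
def init : M.Cfg where
  state := M.start
  inPos := 1
  tape := fun _ _ => none
  head := fun _ => 0
  out := []

/-- One step on input `x`; `none` if the machine has halted.  The input head cannot go beyond the
end markers. -/
def next (x : List Bool) (c : M.Cfg) : Option M.Cfg :=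
  (M.δ c.state (inputSym x c.inPos) (fun i => c.tape i (c.head i))).map fun r =>
    { state := r.1
      inPos := min (r.2.1.apply c.inPos) (x.length + 1)
      tape := fun i => Function.update (c.tape i) (c.head i) (r.2.2.1 i).1
      head := fun i => (r.2.2.1 i).2.apply (c.head i)
      out := c.out ++ r.2.2.2.toList }

/-- The configuration after `t` steps on input `x` (a halted machine stays as it is). -/
def cfgAt (x : List Bool) (t : ℕ) : M.Cfg :=
  (fun c => (M.next x c).getD c)^[t] M.init

/-- On input `x`, the machine has halted after at most `t` steps, with output `y`. -/
def HaltsWith (x : List Bool) (t : ℕ) (y : List Bool) : Prop :=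
  M.next x (M.cfgAt x t) = none ∧ (M.cfgAt x t).out = y

/-- On input `x`, the machine uses only the first `s` cells of each of its work tapes. -/
def UsesSpaceLE (x : List Bool) (s : ℕ) : Prop :=
  ∀ t i, (M.cfgAt x t).head i < s

end Machine

/-- `f` is computed by a Turing machine in time polynomial in the length of the input, where the
argument `a` is presented as the string `enc a`. -/
def IsPTIME {α : Type} (enc : α → List Bool) (f : α → List Bool) : Prop :=
  ∃ (M : Machine) (p : Polynomial ℕ), ∀ a, M.HaltsWith (enc a) (p.eval (enc a).length) (f a)

/-- `f` is in FPSPACE: it is computed by a Turing machine that halts on every argument, and both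
the space used on the work tapes and the length of the output are polynomially bounded in the
length of the input, where the argument `a` is presented as the string `enc a`. -/
def IsFPSPACE {α : Type} (enc : α → List Bool) (f : α → List Bool) : Prop :=
  ∃ (M : Machine) (p : Polynomial ℕ), ∀ a,
    (∃ t, M.HaltsWith (enc a) t (f a)) ∧
    M.UsesSpaceLE (enc a) (p.eval (enc a).length) ∧
    (f a).length ≤ p.eval (enc a).length

/-- The unary string `1ⁿ`. -/
def unary (n : ℕ) : List Bool := List.replicate n true

/-- The string `1ⁿ0τ` that presents the pair `(1ⁿ, τ)`. -/
def pairCode (a : ℕ × List Bool) : List Bool := unary a.1 ++ false :: a.2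

/-- The function `{1}* → {1}*`, `1ⁿ ↦ 1^(f n)`, is in PTIME. -/
def IsUnaryPTIME (f : ℕ → ℕ) : Prop := IsPTIME unary fun n => unary (f n)

/-! ### Cantor space -/

/-- The initial segment of `X` of length `m`. -/
def initSeg (X : ℕ → Bool) (m : ℕ) : List Bool := (List.range m).map X

/-- The open set `[G]` of the sequences that have an initial segment in `G`. -/
def openSet (G : Set (List Bool)) : Set (ℕ → Bool) :=
  {X | ∃ σ ∈ G, initSeg X σ.length = σ}

/-- The uniform (fair coin) measure on Cantor space. -/
noncomputable def coinMeasure : Measure (ℕ → Bool) :=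
  Measure.infinitePi fun _ : ℕ => (PMF.uniformOfFintype Bool).toMeasure

/-! ### Martin-Löf randomness -/

/-- The set `G_n` of strings given by the pair `(G, f)`. -/
def testStrings (G : ℕ → List Bool → Bool) (f : ℕ → ℕ) (n : ℕ) : Set (List Bool) :=
  {τ | τ.length ≤ f n ∧ G n τ = true}

/-- `(G, f)` specifies a PSPACE test `U_n = [G_n]`. -/
structure IsPSPACETest (G : ℕ → List Bool → Bool) (f : ℕ → ℕ) : Prop where
  fpspace : IsFPSPACE pairCode fun a => [G a.1 a.2]
  ptime : IsUnaryPTIME f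
  strictMono : StrictMono f
  measure_le : ∀ n, coinMeasure (openSet (testStrings G f n)) ≤ (2⁻¹ : ENNReal) ^ n

/-- `X` passes every PSPACE test. -/
def MartinLofRandom (X : ℕ → Bool) : Prop :=
  ∀ G f, IsPSPACETest G f → ∃ n, X ∉ openSet (testStrings G f n)

/-! ### Kolmogorov randomness and quick process randomness -/

/-- The plain complexity `C_M(τ)`: the length of a shortest `σ` with `M(σ) = τ`, and `∞` if there
is none. -/
noncomputable def complexity (M : List Bool → List Bool) (τ : List Bool) : ℕ∞ :=
  ⨅ (σ : List Bool) (_ : M σ = τ), (σ.length : ℕ∞)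

/-- `C_M(X ↾ f(n)) ≤ f(n) - n` for every `n`, where the right side is an integer difference. -/
def Compresses (M : List Bool → List Bool) (f : ℕ → ℕ) (X : ℕ → Bool) : Prop :=
  ∀ n, complexity M (initSeg X (f n)) + n ≤ f n

/-- No FPSPACE function compresses `X` along a PTIME function. -/
def KolmogorovRandom (X : ℕ → Bool) : Prop :=
  ¬ ∃ (M : List Bool → List Bool) (f : ℕ → ℕ),
    IsFPSPACE id M ∧ IsUnaryPTIME f ∧ Compresses M f X

/-- An order function: nondecreasing and unbounded. -/
def IsOrderFunction (h : ℕ → ℕ) : Prop := Monotone h ∧ Tendsto h atTop atTop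

/-- The (total) function `M` is a quick process machine with order function `h`. -/
structure IsQuickProcessMachine (M : List Bool → List Bool) (h : ℕ → ℕ) : Prop where
  extends_of_extends : ∀ τ τ', τ <+: τ' → M τ <+: M τ'
  order : IsOrderFunction h
  le_length : ∀ τ, h τ.length ≤ (M τ).length

/-- `M` is an FPSPACE BPS quick process machine. -/
def IsBPSQuickProcessMachine (M : List Bool → List Bool) : Prop :=
  IsFPSPACE id M ∧ ∃ h, IsQuickProcessMachine M h ∧ IsUnaryPTIME h

/-- No FPSPACE BPS quick process machine compresses `X` along a PTIME function. -/
def QuickProcessRandom (X : ℕ → Bool) : Prop :=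
  ¬ ∃ (M : List Bool → List Bool) (f : ℕ → ℕ),
    IsBPSQuickProcessMachine M ∧ IsUnaryPTIME f ∧ Compresses M f X

end BPS

/-! Kolmogorov randomness implies quick process randomness because a quick process machine is in
particular an FPSPACE function. The other two implications are counting arguments. In both of them
an exhaustive search takes exponential time but only polynomial space.

Martin-Löf to Kolmogorov (`MartinLofRandom.kolmogorovRandom`): suppose `M` compresses `X` along `f`.
Level `n` of a test consists of the strings of length `f (n + 1)` with an `M`-description that is
shorter by at least `n + 1`. There are fewer than `2 ^ (f (n + 1) - n)` such descriptions, so the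
level has measure at most `2⁻ⁿ`, and it captures `X`.

Quick process to Martin-Löf (`QuickProcessRandom.martinLofRandom`): suppose `X` lies in every `U_n`.
Let the polynomial `p` bound `f` and let `Q a = p (2a + 1) + 4a + 2`. Strings of length `Q a` are
long enough to exhibit membership in `U_(2a+1)`, and by the measure bound at most `2 ^ (Q a - (2a +
1))` of them do (`IsPSPACETest.count_le`). Given `X ↾ a`, the string `X ↾ Q a` is therefore
determined by a rank of `Q a - (2a + 1)` bits (`exists_select`). The machine `extendAll` reads such
fixed-length codes one after the other and passes through the lengths `0, Q 0, Q (Q 0), …`; an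
incomplete last code is ignored, which makes it monotone. Reaching length `a` costs at most `a`
bits, so `X ↾ Q a` is described with a gain of more than `a` bits (`exists_codes`). Along the orbit
of `Q` the gain is unbounded, and `floorOrbit`, which is PTIME, provides both the order function and
the lengths at which `X` is compressed.

The rest is complexity theory. The notions refer to Turing machines, whereas the functions above
arise by composition, loops, searches and calls of given machines. `Cx` is the class of functions
computed by a while language on stacks, in polynomial space and, if its parameter `tm` holds,
polynomial time. Closure properties are proved for `Cx`, and `Cx.exists_machine` and `Cx.of_machine`
translate to and from machines. -/

namespace BPS

/-! ### A while language on registers that hold stacks -/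

/-- Programs over registers `0, 1, 2, …`, each of which holds a stack of symbols. -/
inductive Prog (Γ : Type) where
  | skip : Prog Γ
  | push (i : ℕ) (a : Γ) : Prog Γ
  | pop (i : ℕ) : Prog Γ
  | seq (P Q : Prog Γ) : Prog Γ
  | case (i : ℕ) (f : Option Γ → Prog Γ) : Prog Γ
  | loop (i : ℕ) (P : Prog Γ) : Prog Γ

/-- `Exec B P s t s'`: run on the store `s`, the program `P` terminates with the store `s'` in `t`
steps, and no push makes a register longer than `B`. -/
inductive Exec {Γ : Type} (B : ℕ) : Prog Γ → (ℕ → List Γ) → ℕ → (ℕ → List Γ) → Prop where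
  | skip (s) : Exec B .skip s 1 s
  | push (i a s) (h : (s i).length + 1 ≤ B) :
      Exec B (.push i a) s 1 (Function.update s i (a :: s i))
  | pop (i s) : Exec B (.pop i) s 1 (Function.update s i (s i).tail)
  | seq {P Q s t s' t' s''} (h : Exec B P s t s') (h' : Exec B Q s' t' s'') :
      Exec B (.seq P Q) s (t + t' + 1) s''
  | case {i f s t s'} (h : Exec B (f (s i).head?) s t s') : Exec B (.case i f) s (t + 1) s'
  | loop_nil {i P s} (h : s i = []) : Exec B (.loop i P) s 1 s
  | loop_cons {i P s t s' t' s''} (h : s i ≠ []) (hP : Exec B P s t s')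
      (h' : Exec B (.loop i P) s' t' s'') : Exec B (.loop i P) s (t + t' + 1) s''

/-- `Exec` with an upper bound on the time. -/
def Runs {Γ : Type} (B : ℕ) (P : Prog Γ) (s : ℕ → List Γ) (T : ℕ) (s' : ℕ → List Γ) : Prop :=
  ∃ t ≤ T, Exec B P s t s'

variable {Γ : Type} {B B' T T' i j : ℕ} {P Q : Prog Γ} {s s' s'' : ℕ → List Γ}

theorem Exec.mono {t : ℕ} (h : Exec B P s t s') (hB : B ≤ B') : Exec B' P s t s' := by
  induction h with
  | skip s => exact .skip s
  | push i a s h => exact .push i a s (h.trans hB)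
  | pop i s => exact .pop i s
  | seq _ _ ih ih' => exact .seq ih ih'
  | case _ ih => exact .case ih
  | loop_nil h => exact .loop_nil h
  | loop_cons h _ _ ih ih' => exact .loop_cons h ih ih'

namespace Runs

theorem mono (h : Runs B P s T s') (hB : B ≤ B') (hT : T ≤ T') : Runs B' P s T' s' := by
  obtain ⟨t, ht, h⟩ := h
  exact ⟨t, ht.trans hT, h.mono hB⟩

theorem congr (h : Runs B P s T s') (hT : T ≤ T') (he : ∀ r, s' r = s'' r) :
    Runs B P s T' s'' := by
  obtain rfl : s' = s'' := funext he
  exact h.mono le_rfl hT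

theorem skip : Runs B .skip s 1 s := ⟨1, le_rfl, .skip s⟩

theorem push {a : Γ} (h : (s i).length + 1 ≤ B) :
    Runs B (.push i a) s 1 (Function.update s i (a :: s i)) := ⟨1, le_rfl, .push i a s h⟩

theorem pop : Runs B (.pop i) s 1 (Function.update s i (s i).tail) := ⟨1, le_rfl, .pop i s⟩

theorem seq (h : Runs B P s T s') (h' : Runs B Q s' T' s'') :
    Runs B (.seq P Q) s (T + T' + 1) s'' := by
  obtain ⟨t, ht, h⟩ := h
  obtain ⟨t', ht', h'⟩ := h'
  exact ⟨t + t' + 1, by omega, .seq h h'⟩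

theorem case {f : Option Γ → Prog Γ} (h : Runs B (f (s i).head?) s T s') :
    Runs B (.case i f) s (T + 1) s' := by
  obtain ⟨t, ht, h⟩ := h
  exact ⟨t + 1, by omega, .case h⟩

theorem loop_nil (h : s i = []) : Runs B (.loop i P) s 1 s := ⟨1, le_rfl, .loop_nil h⟩

theorem loop_cons (h : s i ≠ []) (hP : Runs B P s T s') (h' : Runs B (.loop i P) s' T' s'') :
    Runs B (.loop i P) s (T + T' + 1) s'' := by
  obtain ⟨t, ht, hP⟩ := hP
  obtain ⟨t', ht', h'⟩ := h'
  exact ⟨t + t' + 1, by omega, .loop_cons h hP h'⟩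

end Runs

/-- Renaming of the registers. -/
def Prog.rename (ρ : ℕ → ℕ) : Prog Γ → Prog Γ
  | .skip => .skip
  | .push i a => .push (ρ i) a
  | .pop i => .pop (ρ i)
  | .seq P Q => .seq (P.rename ρ) (Q.rename ρ)
  | .case i f => .case (ρ i) fun o => (f o).rename ρ
  | .loop i P => .loop (ρ i) (P.rename ρ)

/-- A renamed program acts on the renamed registers and leaves the others alone. -/
theorem Exec.rename {t : ℕ} {ρ : ℕ → ℕ} (hρ : Function.Injective ρ) (h : Exec B P s t s')
    (u : ℕ → List Γ) (hu : ∀ i, u (ρ i) = s i) :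
    ∃ u', Exec B (P.rename ρ) u t u' ∧ (∀ i, u' (ρ i) = s' i) ∧
      ∀ j, (∀ i, ρ i ≠ j) → u' j = u j := by
  induction h generalizing u with
  | skip s => exact ⟨u, .skip u, hu, fun _ _ => rfl⟩
  | push i a s h =>
    refine ⟨_, .push (ρ i) a u (by rwa [hu]), fun k => ?_, fun j hj => ?_⟩
    · by_cases hk : k = i
      · subst hk; simp [hu]
      · simp [hk, hρ.eq_iff, hu]
    · exact Function.update_of_ne (hj i).symm _ _
  | pop i s =>
    refine ⟨_, .pop (ρ i) u, fun k => ?_, fun j hj => ?_⟩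
    · by_cases hk : k = i
      · subst hk; simp [hu]
      · simp [hk, hρ.eq_iff, hu]
    · exact Function.update_of_ne (hj i).symm _ _
  | seq _ _ ih ih' =>
    obtain ⟨u', h1, h2, h3⟩ := ih u hu
    obtain ⟨u'', k1, k2, k3⟩ := ih' u' h2
    exact ⟨u'', .seq h1 k1, k2, fun j hj => (k3 j hj).trans (h3 j hj)⟩
  | case _ ih =>
    obtain ⟨u', h1, h2, h3⟩ := ih u hu
    exact ⟨u', .case (by rwa [hu]), h2, h3⟩
  | loop_nil h => exact ⟨u, .loop_nil (by rwa [hu]), hu, fun _ _ => rfl⟩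
  | loop_cons h _ _ ih ih' =>
    obtain ⟨u', h1, h2, h3⟩ := ih u hu
    obtain ⟨u'', k1, k2, k3⟩ := ih' u' h2
    exact ⟨u'', .loop_cons (by rwa [hu]) h1 k1, k2, fun j hj => (k3 j hj).trans (h3 j hj)⟩

/-! ### Copying and clearing registers -/

/-- Push `a` on all registers of a list. -/
def pushAll (a : Γ) : List ℕ → Prog Γ
  | [] => .skip
  | j :: js => .seq (.push j a) (pushAll a js)

theorem runs_pushAll {a : Γ} {js : List ℕ} (hn : js.Nodup)
    (hB : ∀ j ∈ js, (s j).length + 1 ≤ B) :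
    Runs B (pushAll a js) s (2 * js.length + 1) fun r => if r ∈ js then a :: s r else s r := by
  induction js generalizing s with
  | nil => simpa [pushAll] using Runs.skip (s := s) (B := B)
  | cons j js ih =>
    rw [List.nodup_cons] at hn
    have h := (Runs.push (a := a) (hB j (by simp))).seq (ih hn.2 (s := Function.update s j (a :: s j))
      fun k hk => by
        rw [Function.update_of_ne (by rintro rfl; exact hn.1 hk)]
        exact hB k (by simp [hk]))
    refine h.congr (by simp; omega) fun r => ?_
    by_cases hr : r = j
    · subst hr; simp [hn.1]
    · simp [hr]

/-- Move the contents of register `i` (in reversed order) to all registers of a list. -/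
def spill (i : ℕ) (js : List ℕ) : Prog Γ :=
  .loop i (.case i fun o => o.elim .skip fun a => .seq (.pop i) (pushAll a js))

theorem runs_spill {js : List ℕ} (hn : js.Nodup) (hi : i ∉ js)
    (hB : ∀ j ∈ js, (s i).length + (s j).length ≤ B) :
    Runs B (spill i js) s ((s i).length * (2 * js.length + 5) + 1)
      fun r => if r = i then [] else if r ∈ js then (s i).reverse ++ s r else s r := by
  generalize hl : s i = l at hB ⊢
  induction l generalizing s with
  | nil =>
    refine (Runs.loop_nil hl).congr (by simp) fun r => ?_
    by_cases hr : r = i <;> simp [hr, hl]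
  | cons a l ih =>
    have h1 : Runs B (.case i fun o => o.elim .skip fun a => .seq (.pop i) (pushAll a js)) s
        (1 + (2 * js.length + 1) + 1 + 1)
        (fun r => if r ∈ js then a :: (Function.update s i l) r else (Function.update s i l) r) := by
      refine Runs.case ?_
      rw [hl]
      refine Runs.seq Runs.pop ?_
      rw [hl]
      refine runs_pushAll hn fun j hj => ?_
      have := hB j hj
      rw [Function.update_of_ne (by rintro rfl; exact hi hj)]
      simp at this; omega
    have h2 := Runs.loop_cons (by simp [hl]) h1 (ih (by simp [hi]) fun j hj => by
      have := hB j hj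
      rw [if_pos hj, Function.update_of_ne (by rintro rfl; exact hi hj)]
      simp at this ⊢; omega)
    refine h2.congr (by simp; ring_nf; omega) fun r => ?_
    by_cases hr : r = i
    · simp [hr]
    · by_cases hj : r ∈ js <;> simp [hr, hj]

/-- Put the contents of register `i` in front of register `j`, using the empty register `k`. -/
def copy (i j k : ℕ) : Prog Γ := .seq (spill i [k]) (spill k [i, j])

/-- Spilling reverses a stack, so two spills restore the order; the second one refills `i` while it
fills `j`. -/
theorem runs_copy {k : ℕ} (hij : i ≠ j) (hik : i ≠ k) (hjk : j ≠ k) (hk : s k = [])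
    (hB : (s i).length + (s j).length ≤ B) :
    Runs B (copy i j k) s ((s i).length * 20 + 5) (Function.update s j (s i ++ s j)) := by
  have h1 : Runs B (spill i [k]) s _ _ := runs_spill (by simp) (by simpa using hik)
    (by simp [hk]; omega)
  have h2 := h1.seq (Q := spill k [i, j]) (runs_spill (by simpa using hij)
    (by simp [hik.symm, hjk.symm]) (by
      simp [hk, hik.symm, hij.symm, hjk]; omega))
  refine h2.congr (by simp [hk, hik.symm]; omega) fun r => ?_
  by_cases hr : r = k
  · subst hr; simp [hjk.symm, hk]
  · by_cases hr1 : r = i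
    · subst hr1; simp [hij, hk, hik, hik.symm]
    · by_cases hr2 : r = j
      · subst hr2; simp [hij.symm, hk, hik.symm, hr]
      · simp [hr, hr1, hr2]

theorem runs_clear : Runs B (spill i []) s ((s i).length * 5 + 1) (Function.update s i []) :=
  (runs_spill (B := B) (s := s) (i := i) (js := []) (by simp) (by simp) (by simp)).congr
    (by simp) fun r => by by_cases hr : r = i <;> simp [hr]

/-- Run `P 0, …, P (n - 1)` one after the other. -/
def forN (P : ℕ → Prog Γ) : ℕ → Prog Γ
  | 0 => .skip
  | n + 1 => .seq (forN P n) (P n)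

theorem runs_forN {P : ℕ → Prog Γ} (S : ℕ → ℕ → List Γ) {n : ℕ}
    (h : ∀ k < n, Runs B (P k) (S k) T (S (k + 1))) :
    Runs B (forN P n) (S 0) (n * (T + 1) + 1) (S n) := by
  induction n with
  | zero => simpa using! Runs.skip
  | succ n ih =>
    exact ((ih fun k hk => h k (by omega)).seq (h n (by omega))).mono le_rfl (by ring_nf; omega)

theorem runs_forN' {P : ℕ → Prog Γ} (S : ℕ → ℕ → List Γ) {n : ℕ} (h0 : ∀ r, S 0 r = s r)
    (hn : ∀ r, S n r = s' r) (h : ∀ k < n, Runs B (P k) (S k) T (S (k + 1)))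
    (hT : n * (T + 1) + 1 ≤ T') : Runs B (forN P n) s T' s' := by
  obtain rfl : S 0 = s := funext h0
  exact (runs_forN S h).congr hT hn

/-- Replace the contents of register `r` by those of register `ρ r` for all `r < K`, using the
registers from `K` to `2 * K`; registers without a source become empty. -/
def rewire (ρ : ℕ → Option ℕ) (K : ℕ) : Prog Γ :=
  .seq (forN (fun r => (ρ r).elim .skip fun i => copy i (K + 1 + r) K) K)
    (.seq (forN (fun r => spill r []) K)
      (forN (fun r => .seq (copy (K + 1 + r) r K) (spill (K + 1 + r) [])) K))

/-- The new contents are staged in the registers `K + 1 + r` before anything is overwritten, since a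
source may be needed for several targets. Then the low registers are cleared and the staged copies
are moved back; register `K` is the scratch register of the copies. -/
theorem runs_rewire {ρ : ℕ → Option ℕ} {K n : ℕ} (hρ : ∀ r i, ρ r = some i → i < K)
    (hs : ∀ r, K ≤ r → s r = []) (hn : ∀ r, (s r).length ≤ n) :
    Runs n (rewire ρ K) s ((K + 1) * (100 * n + 100)) fun r =>
      if r < K then (ρ r).elim [] s else [] := by
  set g : ℕ → List Γ := fun r => (ρ r).elim [] s with hg
  have hgn : ∀ r, (g r).length ≤ n := fun r => by
    simp only [hg]; rcases ρ r with _ | i <;> simp [hn]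
  have h1 : Runs n (forN (fun r => (ρ r).elim .skip fun i => copy i (K + 1 + r) K) K) s
      (K * (20 * n + 5 + 1) + 1)
      fun r => if K + 1 ≤ r ∧ r < K + 1 + K then g (r - (K + 1)) else s r := by
    refine runs_forN' (T := 20 * n + 5)
      (fun k r => if K + 1 ≤ r ∧ r < K + 1 + k then g (r - (K + 1)) else s r)
      (fun r => if_neg (by omega)) (fun r => rfl) (fun k hk => ?_) le_rfl
    have hgk : (K + 1 + k - (K + 1)) = k := by omega
    have step : ∀ r, r ≠ K + 1 + k →
        (if K + 1 ≤ r ∧ r < K + 1 + k then g (r - (K + 1)) else s r) =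
        if K + 1 ≤ r ∧ r < K + 1 + (k + 1) then g (r - (K + 1)) else s r := fun r hr => by
      by_cases hr' : K + 1 ≤ r ∧ r < K + 1 + k
      · rw [if_pos hr', if_pos (by omega)]
      · rw [if_neg hr', if_neg (by omega)]
    have hsk : s (K + 1 + k) = [] := hs _ (by omega)
    rcases hk' : ρ k with _ | i
    · refine Runs.skip.congr (by omega) fun r => ?_
      by_cases hr : r = K + 1 + k
      · subst hr
        rw [if_neg (by omega), if_pos (by omega), hgk, hsk]
        simp [hg, hk']
      · exact step r hr
    · have hi := hρ _ _ hk'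
      have e1 : (if K + 1 ≤ i ∧ i < K + 1 + k then g (i - (K + 1)) else s i) = s i :=
        if_neg (by omega)
      have e2 : (if K + 1 ≤ K + 1 + k ∧ K + 1 + k < K + 1 + k then g (K + 1 + k - (K + 1))
          else s (K + 1 + k)) = [] := by rw [if_neg (by omega), hsk]
      have := runs_copy (B := n) (i := i) (j := K + 1 + k) (k := K)
        (s := fun r => if K + 1 ≤ r ∧ r < K + 1 + k then g (r - (K + 1)) else s r)
        (by omega) (by omega) (by omega) ((if_neg (by omega)).trans (hs _ le_rfl)) (by
          rw [e1, e2]; simpa using hn i)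
      beta_reduce at this
      rw [e1, e2] at this
      refine this.congr (by have := hn i; omega) fun r => ?_
      by_cases hr : r = K + 1 + k
      · subst hr
        rw [Function.update_self, if_pos (by omega), hgk]
        simp [hg, hk']
      · rw [Function.update_of_ne hr]
        exact step r hr
  have h2 : Runs n (forN (fun r => spill r []) K)
      (fun r => if K + 1 ≤ r ∧ r < K + 1 + K then g (r - (K + 1)) else s r)
      (K * (5 * n + 1 + 1) + 1)
      (fun r => if K + 1 ≤ r ∧ r < K + 1 + K then g (r - (K + 1)) else []) := by
    refine runs_forN' (T := 5 * n + 1)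
      (fun k r => if K + 1 ≤ r ∧ r < K + 1 + K then g (r - (K + 1)) else
        if r < k then [] else s r) (fun r => by simp) (fun r => ?_) (fun k hk => ?_) le_rfl
    · by_cases hr : K + 1 ≤ r ∧ r < K + 1 + K
      · simp [hr]
      · rw [if_neg hr, if_neg hr]
        split_ifs with h
        · rfl
        · exact hs r (by omega)
    · refine runs_clear.congr ?_ fun r => ?_
      · rw [if_neg (by omega), if_neg (by omega)]
        have := hn k; omega
      · by_cases hr : r = k
        · subst hr
          rw [Function.update_self, if_neg (by omega), if_pos (by omega)]
        · rw [Function.update_of_ne hr]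
          have : r < k + 1 ↔ r < k := by omega
          simp [this]
  have h3 : Runs n (forN (fun r => .seq (copy (K + 1 + r) r K) (spill (K + 1 + r) [])) K)
      (fun r => if K + 1 ≤ r ∧ r < K + 1 + K then g (r - (K + 1)) else [])
      (K * (25 * n + 10 + 1) + 1) (fun r => if r < K then g r else []) := by
    refine runs_forN' (T := 25 * n + 10)
      (fun k r => if K + 1 + k ≤ r ∧ r < K + 1 + K then g (r - (K + 1)) else
        if r < k then g r else []) (fun r => by simp) (fun r => if_neg (by omega))
        (fun k hk => ?_) le_rfl
    have e1 : (if K + 1 + k ≤ K + 1 + k ∧ K + 1 + k < K + 1 + K then g (K + 1 + k - (K + 1)) else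
        if K + 1 + k < k then g (K + 1 + k) else []) = g k := by
      rw [if_pos (by omega)]; congr 1; omega
    have e2 : (if K + 1 + k ≤ k ∧ k < K + 1 + K then g (k - (K + 1)) else
        if k < k then g k else []) = [] := by
      rw [if_neg (by omega), if_neg (by omega)]
    have := runs_copy (B := n) (i := K + 1 + k) (j := k) (k := K)
        (s := fun r => if K + 1 + k ≤ r ∧ r < K + 1 + K then g (r - (K + 1)) else
          if r < k then g r else [])
        (by omega) (by omega) (by omega) (by
          rw [if_neg (by omega), if_neg (by omega)]) (by
          rw [e1, e2]; simpa using hgn k)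
    beta_reduce at this
    rw [e1, e2] at this
    refine (this.seq (runs_clear (i := K + 1 + k))).congr ?_ fun r => ?_
    · rw [Function.update_of_ne (by omega)]
      rw [e1]
      have := hgn k; omega
    · by_cases hr : r = K + 1 + k
      · subst hr
        rw [Function.update_self, if_neg (by omega), if_neg (by omega)]
      · rw [Function.update_of_ne hr]
        by_cases hr2 : r = k
        · subst hr2
          rw [Function.update_self, if_neg (by omega), if_pos (by omega)]
          simp
        · rw [Function.update_of_ne hr2]
          by_cases hr' : K + 1 + k ≤ r ∧ r < K + 1 + K
          · rw [if_pos hr', if_pos (by omega)]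
          · rw [if_neg hr', if_neg (c := K + 1 + (k + 1) ≤ r ∧ r < K + 1 + K) (by omega)]
            by_cases hr3 : r < k
            · rw [if_pos hr3, if_pos (by omega)]
            · rw [if_neg hr3, if_neg (by omega)]
  refine (h1.seq (h2.seq h3)).mono le_rfl ?_
  ring_nf; nlinarith

end BPS

namespace BPS

theorem eval_mono (q : Polynomial ℕ) {m n : ℕ} (h : m ≤ n) : q.eval m ≤ q.eval n := by
  rw [Polynomial.eval_eq_sum, Polynomial.eval_eq_sum]
  exact Finset.sum_le_sum fun i _ => Nat.mul_le_mul_left _ (Nat.pow_le_pow_left h i)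

/-! ### Functions computed by programs -/

/-- The alphabet: bits and auxiliary symbols. -/
abbrev Sy (Θ : Type) := Bool ⊕ Θ

/-- A type whose elements are presented by the contents of finitely many registers. -/
class Data (Θ : Type) (α : Type) where
  enc : α → ℕ → List (Sy Θ)
  width : ℕ
  enc_eq_nil : ∀ a i, width ≤ i → enc a i = []

variable {Θ : Type}

/-- The store that contains the string `l` in register `0`. -/
def single (l : List Bool) : ℕ → List (Sy Θ) := fun i => if i = 0 then l.map Sum.inl else []

instance : Data Θ (List Bool) where
  enc := single
  width := 1
  enc_eq_nil _ i hi := if_neg (by omega)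

instance : Data Θ ℕ where
  enc n := single (unary n)
  width := 1
  enc_eq_nil _ i hi := if_neg (by omega)

instance : Data Θ Bool where
  enc b := single (if b then [true] else [])
  width := 1
  enc_eq_nil _ i hi := if_neg (by omega)

/-- Interleaving lets a program act on one component through an injective renaming of registers,
without any knowledge of the other component. -/
instance {α β : Type} [Data Θ α] [Data Θ β] : Data Θ (α × β) where
  enc x i := if i % 2 = 0 then Data.enc x.1 (i / 2) else Data.enc x.2 (i / 2)
  width := 2 * (Data.width Θ α + Data.width Θ β)
  enc_eq_nil x i hi := by
    split_ifs <;> exact Data.enc_eq_nil _ _ (by omega)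

variable {α β γ δ σ : Type} [Data Θ α] [Data Θ β] [Data Θ γ] [Data Θ δ] [Data Θ σ]

variable (Θ) in
/-- All registers of the presentation of `a` have length at most `n`. -/
def Bdd (a : α) (n : ℕ) : Prop := ∀ i, (Data.enc (Θ := Θ) a i).length ≤ n

theorem Bdd.mono {a : α} {m n : ℕ} (h : Bdd Θ a m) (hmn : m ≤ n) : Bdd Θ a n :=
  fun i => (h i).trans hmn

theorem single_le {l : List Bool} {n : ℕ} :
    (∀ i, (single (Θ := Θ) l i).length ≤ n) ↔ l.length ≤ n := by
  refine ⟨fun h => by simpa [single] using h 0, fun h i => ?_⟩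
  by_cases hi : i = 0 <;> simp [single, hi, h]

@[simp] theorem bdd_list {l : List Bool} {n : ℕ} : Bdd Θ l n ↔ l.length ≤ n := single_le

@[simp] theorem bdd_nat {m n : ℕ} : Bdd Θ m n ↔ m ≤ n := by
  refine single_le.trans ?_
  simp [unary]

@[simp] theorem bdd_bool {b : Bool} {n : ℕ} : Bdd Θ b n ↔ (b = true → 1 ≤ n) := by
  refine single_le.trans ?_
  cases b <;> simp

@[simp] theorem enc_prod_even (x : α × β) (i : ℕ) :
    Data.enc (Θ := Θ) x (2 * i) = Data.enc x.1 i := by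
  change (if _ then _ else _) = _
  rw [if_pos (by omega)]; congr 1; omega

@[simp] theorem enc_prod_odd (x : α × β) (i : ℕ) :
    Data.enc (Θ := Θ) x (2 * i + 1) = Data.enc x.2 i := by
  change (if _ then _ else _) = _
  rw [if_neg (by omega)]; congr 1; omega

@[simp] theorem bdd_prod {x : α × β} {n : ℕ} : Bdd Θ x n ↔ Bdd Θ x.1 n ∧ Bdd Θ x.2 n := by
  refine ⟨fun h => ⟨fun i => ?_, fun i => ?_⟩, fun h i => ?_⟩
  · simpa using h (2 * i)
  · simpa using h (2 * i + 1)
  · obtain hi | hi := Nat.even_or_odd' i |>.choose_spec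
    · rw [hi, enc_prod_even]; exact h.1 _
    · rw [hi, enc_prod_odd]; exact h.2 _

variable (Θ) in
/-- `f` is computed by a program in polynomial space and, if `tm` holds, in polynomial time. -/
def Cx (tm : Prop) (f : α → β) : Prop :=
  ∃ (P : Prog (Sy Θ)) (q : Polynomial ℕ), ∀ a n, Bdd Θ a n → Bdd Θ (f a) (q.eval n) ∧
    ∃ t, Runs (q.eval n) P (Data.enc a) t (Data.enc (f a)) ∧ (tm → t ≤ q.eval n)

namespace Cx

variable {tm : Prop}

theorem bdd {f : α → β} (hf : Cx Θ tm f) :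
    ∃ q : Polynomial ℕ, ∀ a n, Bdd Θ a n → Bdd Θ (f a) (q.eval n) := by
  obtain ⟨P, q, h⟩ := hf
  exact ⟨q, fun a n hn => (h a n hn).1⟩

theorem congr {f g : α → β} (hf : Cx Θ tm f) (h : ∀ a, f a = g a) : Cx Θ tm g := by
  obtain rfl : f = g := funext h
  exact hf

/-- Sequential execution suffices because a program for `Cx` has to end in exactly the store that
presents its value, with no garbage in any other register. -/
theorem comp {g : β → γ} {f : α → β} (hg : Cx Θ tm g) (hf : Cx Θ tm f) :
    Cx Θ tm fun a => g (f a) := by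
  obtain ⟨P, p, hP⟩ := hf
  obtain ⟨Q, q, hQ⟩ := hg
  refine ⟨.seq P Q, p + q.comp p + 1, fun a n hn => ?_⟩
  obtain ⟨h1, t, h2, h3⟩ := hP a n hn
  obtain ⟨k1, t', k2, k3⟩ := hQ (f a) _ h1
  have e : (p + q.comp p + 1).eval n = p.eval n + q.eval (p.eval n) + 1 := by
    simp [Polynomial.eval_comp]
  rw [e]
  refine ⟨k1.mono (by omega), t + t' + 1, (h2.mono (by omega) le_rfl).seq
    (k2.mono (by omega) le_rfl), fun h => ?_⟩
  have := h3 h; have := k3 h; omega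

/-- A function that only copies registers. -/
theorem of_rewire {f : α → β} (ρ : ℕ → Option ℕ)
    (h : ∀ a r, Data.enc (Θ := Θ) (f a) r = (ρ r).elim [] (Data.enc a)) : Cx Θ tm f := by
  set K := Data.width Θ α + Data.width Θ β with hK
  have h' : ∀ a r, Data.enc (Θ := Θ) (f a) r =
      if r < K then ((ρ r).filter (· < K)).elim [] (Data.enc a) else [] := fun a r => by
    split_ifs with hr
    · rw [h]
      rcases ρ r with _ | i
      · rfl
      · by_cases hi : i < K
        · simp [Option.filter, hi]
        · simp [Option.filter, hi, Data.enc_eq_nil (Θ := Θ) a i (by omega)]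
    · exact Data.enc_eq_nil _ _ (by omega)
  refine ⟨rewire (fun r => (ρ r).filter (· < K)) K,
    Polynomial.C (K + 1) * (Polynomial.C 100 * Polynomial.X + Polynomial.C 100) + Polynomial.X,
    fun a n hn => ?_⟩
  have e : (Polynomial.C (K + 1) * (Polynomial.C 100 * Polynomial.X + Polynomial.C 100) +
      Polynomial.X).eval n = (K + 1) * (100 * n + 100) + n := by simp
  rw [e]
  refine ⟨fun r => ?_, (K + 1) * (100 * n + 100), ?_, fun _ => by omega⟩
  · rw [h]
    rcases ρ r with _ | i
    · simp
    · exact (hn i).trans (by omega)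
  · refine ((runs_rewire (fun r i hr => ?_) (fun r hr => Data.enc_eq_nil _ _ (by omega)) hn).congr
      le_rfl fun r => (h' a r).symm).mono (by omega) le_rfl
    simpa using (Option.filter_eq_some_iff.1 hr).2

theorem id : Cx Θ tm fun a : α => a := of_rewire some fun _ _ => rfl

theorem fst : Cx Θ tm (Prod.fst : α × β → α) :=
  of_rewire (fun r => some (2 * r)) fun x r => by simp

theorem snd : Cx Θ tm (Prod.snd : α × β → β) :=
  of_rewire (fun r => some (2 * r + 1)) fun x r => by simp

theorem dup : Cx Θ tm fun a : α => (a, a) :=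
  of_rewire (fun r => some (r / 2)) fun x r => by
    change (if _ then _ else _) = _
    simp

/-- The program is renamed to the even registers, so all its scratch space is even too and the odd
registers stay untouched. -/
theorem first {f : α → β} (hf : Cx Θ tm f) : Cx Θ tm fun x : α × γ => (f x.1, x.2) := by
  obtain ⟨P, q, hP⟩ := hf
  refine ⟨P.rename (2 * ·), q + Polynomial.X, fun x n hn => ?_⟩
  rw [bdd_prod] at hn
  obtain ⟨h1, t, ⟨t', ht, h2⟩, h3⟩ := hP x.1 n hn.1
  obtain ⟨u, k1, k2, k3⟩ := h2.rename (ρ := (2 * ·)) (fun a b h => by simpa using h)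
    (Data.enc x) (by simp)
  have hu : u = Data.enc (f x.1, x.2) := by
    funext i
    obtain hi | hi := Nat.even_or_odd' i |>.choose_spec
    · rw [hi, enc_prod_even]; exact k2 _
    · rw [hi, enc_prod_odd, k3 _ fun j => by omega, enc_prod_odd]
  rw [Polynomial.eval_add, Polynomial.eval_X]
  refine ⟨bdd_prod.2 ⟨h1.mono (by omega), hn.2.mono (by omega)⟩, t,
    Runs.mono ⟨t', ht, hu ▸ k1⟩ (by omega) le_rfl, fun h => ?_⟩
  have := h3 h; omega

theorem second {f : α → β} (hf : Cx Θ tm f) : Cx Θ tm fun x : γ × α => (x.1, f x.2) := by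
  have swap : ∀ {α β : Type} [Data Θ α] [Data Θ β], Cx Θ tm fun x : α × β => (x.2, x.1) :=
    @fun α β _ _ => of_rewire (fun r => some (if r % 2 = 0 then r + 1 else r - 1)) fun x r => by
      obtain hi | hi := Nat.even_or_odd' r |>.choose_spec
      · generalize (Nat.even_or_odd' r).choose = k at hi
        subst hi
        simp
      · generalize (Nat.even_or_odd' r).choose = k at hi
        subst hi
        rw [enc_prod_odd]
        simp [Nat.add_mod]
  exact (swap.comp ((first hf).comp swap))

theorem pair {f : α → β} {g : α → γ} (hf : Cx Θ tm f) (hg : Cx Θ tm g) :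
    Cx Θ tm fun a => (f a, g a) :=
  (second hg).comp ((first hf).comp dup)

/-- The truth value is stored in front of the argument, where it occupies register `0`; each branch
is precomposed with `snd` to discard it. -/
theorem cond {c : α → Bool} {f g : α → β} (hc : Cx Θ tm c) (hf : Cx Θ tm f) (hg : Cx Θ tm g) :
    Cx Θ tm fun a => if c a then f a else g a := by
  suffices Cx Θ tm fun x : Bool × α => if x.1 then f x.2 else g x.2 from this.comp (hc.pair id)
  obtain ⟨P, p, hP⟩ := hf.comp (snd (Θ := Θ) (tm := tm) (α := Bool))
  obtain ⟨Q, q, hQ⟩ := hg.comp (snd (Θ := Θ) (tm := tm) (α := Bool))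
  refine ⟨.case 0 fun o => if o.isSome then P else Q, p + q + 1, fun x n hn => ?_⟩
  have e : (p + q + 1).eval n = p.eval n + q.eval n + 1 := by simp
  have e0 : Data.enc (Θ := Θ) x 0 = (if x.1 then [true] else []).map Sum.inl :=
    enc_prod_even x 0
  rw [e]
  have ef : ∀ h : β, (if x.1 = true then f x.2 else g x.2) = h →
      Data.enc (Θ := Θ) ((fun x : Bool × α => if x.1 then f x.2 else g x.2) x) = Data.enc h :=
    fun h hh => congrArg _ hh
  rcases hx : x.1 with _ | _
  · obtain ⟨h1, t, h2, h3⟩ := hQ x n hn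
    have e1 := ef (g x.2) (by simp [hx])
    simp only [Bdd, e1]
    refine ⟨h1.mono (by omega), t + 1, (Runs.case ?_).mono (show q.eval n ≤ _ by omega) le_rfl,
      fun h => by have := h3 h; omega⟩
    rw [e0, hx]
    exact h2
  · obtain ⟨h1, t, h2, h3⟩ := hP x n hn
    have e1 := ef (f x.2) (by simp [hx])
    simp only [Bdd, e1]
    refine ⟨h1.mono (by omega), t + 1, (Runs.case ?_).mono (show p.eval n ≤ _ by omega) le_rfl,
      fun h => by have := h3 h; omega⟩
    rw [e0, hx]
    exact h2

/-! #### Lists and numbers -/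

theorem nil : Cx Θ tm fun _ : α => ([] : List Bool) :=
  of_rewire (fun _ => none) fun _ r => by
    change single _ _ = _
    simp [single]

theorem enc_update_single (l l' : List Bool) :
    Function.update (single (Θ := Θ) l) 0 (l'.map Sum.inl) = single l' := by
  funext i
  by_cases hi : i = 0
  · subst hi; simp [single]
  · simp [single, hi]

theorem cons_const (b : Bool) : Cx Θ tm fun l : List Bool => b :: l := by
  refine ⟨.push 0 (Sum.inl b), Polynomial.X + 1, fun l n hn => ?_⟩
  rw [bdd_list] at hn
  refine ⟨by simpa using hn, 1, (Runs.push (i := 0) (s := single l) ?_).congr le_rfl fun r => ?_,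
    fun _ => by simp⟩
  · simpa [single] using hn
  · exact congrFun (enc_update_single l (b :: l)) r

theorem tail : Cx Θ tm fun l : List Bool => l.tail := by
  refine ⟨.pop 0, Polynomial.X + 1, fun l n hn => ?_⟩
  rw [bdd_list] at hn
  refine ⟨by simp; omega, 1, (Runs.pop (i := 0) (s := single l)).congr le_rfl fun r => ?_,
    fun _ => by simp⟩
  have := congrFun (enc_update_single (Θ := Θ) l l.tail) r
  rw [List.map_tail] at this
  exact this

theorem peek (φ : Option Bool → Bool) : Cx Θ tm fun l : List Bool => φ l.head? := by
  -- The branch remembers the top symbol, so the register can be cleared before the answer is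
  -- written into it.
  refine ⟨.case 0 fun o => .seq (spill 0 [])
    (if φ (o.bind Sum.getLeft?) then .push 0 (Sum.inl true) else .skip),
    Polynomial.C 5 * Polynomial.X + Polynomial.C 5, fun l n hn => ?_⟩
  rw [bdd_list] at hn
  refine ⟨by simp, (l.length * 5 + 1) + 1 + 1 + 1, Runs.case ?_, fun _ => by simp; omega⟩
  have e : (((Data.enc (Θ := Θ) l 0).head?).bind Sum.getLeft?) = l.head? := by
    change ((single l 0).head?).bind _ = _
    cases l <;> simp [single]
  have h1 : Runs (Γ := Sy Θ) _ (spill 0 []) (Data.enc l) (l.length * 5 + 1) (single []) :=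
    (runs_clear (B := (Polynomial.C 5 * Polynomial.X + Polynomial.C 5).eval n)).congr
      (by simp [Data.enc, single]) fun r => by
      rw [← enc_update_single l]; rfl
  have e3 : Data.enc (Θ := Θ) ((fun l : List Bool => φ l.head?) l) =
    single (if φ l.head? = true then [true] else []) := rfl
  rw [e, e3]
  refine h1.seq (T' := 1) ?_
  rcases hφ : φ l.head? with _ | _
  · exact Runs.skip
  · refine (Runs.push (by simp [single])).congr le_rfl fun r => ?_
    have := enc_update_single (Θ := Θ) [] [true]
    exact congrFun this r

theorem isEmpty : Cx Θ tm fun l : List Bool => l.isEmpty :=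
  (peek (Θ := Θ) (tm := tm) fun o => o.isNone).congr fun l => by cases l <;> rfl

theorem head : Cx Θ tm fun l : List Bool => l.headD false :=
  (peek (Θ := Θ) (tm := tm) fun o => o.getD false).congr fun l => by cases l <;> rfl

theorem cons {b : α → Bool} {l : α → List Bool} (hb : Cx Θ tm b) (hl : Cx Θ tm l) :
    Cx Θ tm fun a => b a :: l a :=
  (cond hb ((cons_const true).comp hl) ((cons_const false).comp hl)).congr fun a => by
    cases b a <;> rfl

/-- Two presentations that coincide can be exchanged. -/
theorem of_enc_eq {f : α → β} (h : ∀ a, Data.enc (Θ := Θ) (f a) = Data.enc a) : Cx Θ tm f :=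
  of_rewire some fun a r => by rw [h]; rfl

theorem unary : Cx Θ tm unary := of_enc_eq fun _ => rfl

theorem bool_const (b : Bool) : Cx Θ tm fun _ : α => b :=
  ((peek (Θ := Θ) (tm := tm) fun _ => b).comp nil).congr fun _ => rfl

theorem not {b : α → Bool} (hb : Cx Θ tm b) : Cx Θ tm fun a => !b a :=
  (cond hb (bool_const false) (bool_const true)).congr fun a => by cases b a <;> rfl

theorem and {b c : α → Bool} (hb : Cx Θ tm b) (hc : Cx Θ tm c) : Cx Θ tm fun a => b a && c a :=
  (cond hb hc (bool_const false)).congr fun a => by cases b a <;> rfl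

theorem or {b c : α → Bool} (hb : Cx Θ tm b) (hc : Cx Θ tm c) : Cx Θ tm fun a => b a || c a :=
  (cond hb (bool_const true) hc).congr fun a => by cases b a <;> rfl

theorem pred : Cx Θ tm fun n : ℕ => n - 1 := by
  obtain ⟨P, q, h⟩ := tail (Θ := Θ) (tm := tm)
  refine ⟨P, q, fun n m hm => ?_⟩
  have e : Data.enc (Θ := Θ) (n - 1) = Data.enc (BPS.unary n).tail :=
    congrArg single (by simp [BPS.unary])
  have := h (BPS.unary n) m hm
  simpa only [Bdd, e] using! this

theorem succ : Cx Θ tm fun n : ℕ => n + 1 := by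
  obtain ⟨P, q, h⟩ := cons_const (Θ := Θ) (tm := tm) true
  exact ⟨P, q, fun n m hm => h (BPS.unary n) m hm⟩

theorem nat_const (n : ℕ) : Cx Θ tm fun _ : α => n := by
  induction n with
  | zero =>
    refine of_rewire (fun _ => none) fun _ r => ?_
    change single _ _ = _
    simp [single, BPS.unary]
  | succ n ih => exact succ.comp ih

theorem isZero : Cx Θ tm fun n : ℕ => decide (n = 0) :=
  (isEmpty.comp unary).congr fun n => by cases n <;> simp [BPS.unary]

/-! #### Loops -/

/-- Register `0` holds the loop condition of the current state, and the body recomputes it together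
with the next state. The bound is `m + 1` because the flag takes one symbol even if `m = 0`. -/
theorem runs_while {c : σ → Bool} {S : σ → σ} {P : Prog (Sy Θ)} {q : Polynomial ℕ}
    (hP : ∀ a n, Bdd Θ a n → Bdd Θ ((fun x : Bool × σ => (c (S x.2), S x.2)) a) (q.eval n) ∧
      ∃ t, Runs (q.eval n) P (Data.enc a) t
        (Data.enc ((fun x : Bool × σ => (c (S x.2), S x.2)) a)) ∧ (tm → t ≤ q.eval n))
    {m : ℕ} (k : ℕ) (s : σ) (hk : c (S^[k] s) = false) (hlt : ∀ j < k, c (S^[j] s) = true)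
    (hb : ∀ j ≤ k, Bdd Θ (S^[j] s) (m + 1)) :
    ∃ t, Runs (q.eval (m + 1)) (.loop 0 P) (Data.enc (c s, s)) t (Data.enc (false, S^[k] s)) ∧
      (tm → t ≤ k * (q.eval (m + 1) + 1) + 1) := by
  have e0 : ∀ x : Bool × σ, Data.enc (Θ := Θ) x 0 = (if x.1 then [true] else []).map Sum.inl :=
    fun x => enc_prod_even x 0
  induction k generalizing s with
  | zero =>
    simp only [Function.iterate_zero, id_eq] at hk ⊢
    rw [hk]
    exact ⟨1, Runs.loop_nil (by rw [e0]; rfl), fun _ => by omega⟩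
  | succ k ih =>
    have hc : c s = true := hlt 0 (by omega)
    obtain ⟨-, t, h2, h3⟩ := hP (c s, s) (m + 1) (by simpa using hb 0 (by omega))
    obtain ⟨t', k2, k3⟩ := ih (S s) (by simpa using hk)
      (fun j hj => by simpa using hlt (j + 1) (by omega))
      (fun j hj => by simpa using hb (j + 1) (by omega))
    refine ⟨t + t' + 1, Runs.loop_cons (by rw [e0, hc]; simp) h2 (by simpa using k2), fun h => ?_⟩
    have := h3 h; have := k3 h
    ring_nf at *; omega

/-- All intermediate states must obey one polynomial bound, while the number of rounds is restricted
only under `tm`. Exponentially long loops are thus admitted in the space-bounded case. -/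
theorem while_loop {c : σ → Bool} {S : σ → σ} {init res : α → σ} (hc : Cx Θ tm c)
    (hS : Cx Θ tm S) (hi : Cx Θ tm init) (r : Polynomial ℕ)
    (H : ∀ a n, Bdd Θ a n → ∃ k, res a = S^[k] (init a) ∧ c (res a) = false ∧
      (∀ j < k, c (S^[j] (init a)) = true) ∧ (∀ j ≤ k, Bdd Θ (S^[j] (init a)) (r.eval n)) ∧
      (tm → k ≤ r.eval n)) : Cx Θ tm res := by
  obtain ⟨P, q, hP⟩ := (hc.comp (hS.comp (snd (α := Bool)))).pair (hS.comp (snd (α := Bool)))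
  suffices Cx Θ tm fun a => (false, res a) from snd.comp this
  obtain ⟨I, p, hI⟩ := (hc.comp hi).pair hi
  refine ⟨.seq I (.loop 0 P), p + (r + 1) * (q.comp (r + 1) + 1) + 2 + q.comp (r + 1) + r,
    fun a n hn => ?_⟩
  obtain ⟨k, h1, h2, h3, h4, h5⟩ := H a n hn
  obtain ⟨-, t, i2, i3⟩ := hI a n hn
  obtain ⟨t', w2, w3⟩ := runs_while (m := r.eval n) hP k (init a) (by rwa [← h1]) h3
    fun j hj => (h4 j hj).mono (by omega)
  have e : (p + (r + 1) * (q.comp (r + 1) + 1) + 2 + q.comp (r + 1) + r).eval n =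
      p.eval n + (r.eval n + 1) * (q.eval (r.eval n + 1) + 1) + 2 + q.eval (r.eval n + 1)
        + r.eval n := by simp [Polynomial.eval_comp]
  rw [e]
  refine ⟨bdd_prod.2 ⟨by simp, (h1 ▸ h4 k le_rfl : Bdd Θ (res a) _).mono (by omega)⟩, t + t' + 1,
    (i2.mono (by omega) le_rfl).seq ((h1 ▸ w2).mono (by omega) le_rfl), fun h => ?_⟩
  have := i3 h; have := w3 h; have := h5 h
  have : k * (q.eval (r.eval n + 1) + 1) ≤ r.eval n * (q.eval (r.eval n + 1) + 1) := by gcongr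
  have e2 : (r.eval n + 1) * (q.eval (r.eval n + 1) + 1) =
    r.eval n * (q.eval (r.eval n + 1) + 1) + q.eval (r.eval n + 1) + 1 := by ring
  omega

/-- Recursion along a list, with a parameter. -/
theorem foldl {l : α → List Bool} {init : α → σ} {S : α × (σ × Bool) → σ} (hl : Cx Θ tm l)
    (hi : Cx Θ tm init) (hS : Cx Θ tm S) (r : Polynomial ℕ)
    (H : ∀ a n, Bdd Θ a n → ∀ j ≤ (l a).length,
      Bdd Θ (((l a).take j).foldl (fun s b => S (a, (s, b))) (init a)) (r.eval n)) :
    Cx Θ tm fun a => (l a).foldl (fun s b => S (a, (s, b))) (init a) := by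
  suffices Cx Θ tm fun a =>
      (a, (([] : List Bool), (l a).foldl (fun s b => S (a, (s, b))) (init a))) from
    (snd.comp snd).comp this
  obtain ⟨p, hp⟩ := hl.bdd
  -- The loop state consists of the parameter, the unread part of the list and the accumulator.
  have step : ∀ a (s : σ) (l : List Bool) j, j ≤ l.length →
      (fun x : α × (List Bool × σ) => (x.1, (x.2.1.tail, S (x.1, (x.2.2, x.2.1.headD false)))))^[j]
        (a, (l, s)) = (a, (l.drop j, (l.take j).foldl (fun s b => S (a, (s, b))) s)) := by
    intro a s l j
    induction j generalizing s l with
    | zero => intro _; simp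
    | succ j ih =>
      intro hj
      rcases l with _ | ⟨b, l⟩
      · simp at hj
      · rw [Function.iterate_succ_apply, ih _ _ (by simpa using hj)]
        simp
  refine while_loop (c := fun x : α × (List Bool × σ) => !x.2.1.isEmpty)
    (S := fun x => (x.1, (x.2.1.tail, S (x.1, (x.2.2, x.2.1.headD false)))))
    (init := fun a => (a, (l a, init a)))
    (isEmpty.comp (fst.comp snd)).not
    (fst.pair ((tail.comp (fst.comp snd)).pair
      (hS.comp (fst.pair ((snd.comp snd).pair (head.comp (fst.comp snd)))))))
    (id.pair (hl.pair hi)) (Polynomial.X + p + r) fun a n hn => ⟨(l a).length, ?_⟩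
  have hla : (l a).length ≤ p.eval n := bdd_list.1 (hp a n hn)
  have e : (Polynomial.X + p + r).eval n = n + p.eval n + r.eval n := by simp
  rw [e]
  refine ⟨?_, by simp, fun j hj => ?_, fun j hj => ?_, fun _ => by omega⟩
  · rw [step _ _ _ _ le_rfl]; simp
  · rw [step _ _ _ _ hj.le]; simpa using hj
  · rw [step _ _ _ _ hj]
    simp only [bdd_prod, bdd_list, List.length_drop]
    exact ⟨hn.mono (by omega), by omega, (H a n hn j hj).mono (by omega)⟩

/-- Iteration, with a parameter. -/
theorem iterate {m : α → ℕ} {init : α → σ} {S : α × σ → σ} (hm : Cx Θ tm m)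
    (hi : Cx Θ tm init) (hS : Cx Θ tm S) (r : Polynomial ℕ)
    (H : ∀ a n, Bdd Θ a n → ∀ j ≤ m a,
      Bdd Θ ((fun s => S (a, s))^[j] (init a)) (r.eval n)) :
    Cx Θ tm fun a => (fun s => S (a, s))^[m a] (init a) := by
  have key : ∀ a j (s : σ), (List.replicate j true).foldl (fun s _ => S (a, s)) s =
      (fun s => S (a, s))^[j] s := fun a j => by
    induction j with
    | zero => simp
    | succ j ih => intro s; simp [List.replicate_succ, ih]
  refine (foldl (l := fun a => BPS.unary (m a)) (init := init)
    (S := fun x : α × (σ × Bool) => S (x.1, x.2.1)) (unary.comp hm) hi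
    (hS.comp (fst.pair (fst.comp snd))) r fun a n hn j hj => ?_).congr fun a => key _ _ _
  simp only [BPS.unary, List.length_replicate] at hj
  simp only [BPS.unary, List.take_replicate, min_eq_left hj, key]
  exact H a n hn j hj

end Cx

end BPS

namespace BPS

/-! ### From programs to Turing machines -/

namespace Machine

variable (M : Machine) (x : List Bool) (B : ℕ)

/-- One step; a halted machine stays as it is. -/
def stepD (c : M.Cfg) : M.Cfg := (M.next x c).getD c

/-- `c'` is reached from `c` in `t` steps, and no work head leaves the cells `0, …, B`. -/
def Reach (t : ℕ) (c c' : M.Cfg) : Prop :=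
  (M.stepD x)^[t] c = c' ∧ ∀ j ≤ t, ∀ i, ((M.stepD x)^[j] c).head i ≤ B

variable {M x B}

theorem Reach.refl {c : M.Cfg} (h : ∀ i, c.head i ≤ B) : M.Reach x B 0 c c :=
  ⟨rfl, fun j hj i => by obtain rfl : j = 0 := by omega
                         exact h i⟩

theorem Reach.trans {t t' : ℕ} {c c' c'' : M.Cfg} (h : M.Reach x B t c c')
    (h' : M.Reach x B t' c' c'') : M.Reach x B (t + t') c c'' := by
  refine ⟨by rw [add_comm, Function.iterate_add_apply, h.1, h'.1], fun j hj i => ?_⟩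
  by_cases hjt : j ≤ t
  · exact h.2 j hjt i
  · obtain ⟨k, rfl⟩ := Nat.exists_eq_add_of_le (not_le.1 hjt).le
    rw [add_comm, Function.iterate_add_apply, h.1]
    exact h'.2 k (by omega) i

theorem Reach.single {c c' : M.Cfg} (h : M.next x c = some c') (hc : ∀ i, c.head i ≤ B)
    (hc' : ∀ i, c'.head i ≤ B) : M.Reach x B 1 c c' := by
  have e : M.stepD x c = c' := by simp [stepD, h]
  refine ⟨e, fun j hj i => ?_⟩
  interval_cases j
  · exact hc i
  · simpa [e] using hc' i

end Machine

variable {Γ : Type}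

/-- The list of programs that remain to be executed after one step. -/
def cont : List (Prog Γ) → Option Γ → List (Prog Γ)
  | [], _ => []
  | .skip :: K, _ => K
  | .push _ _ :: K, _ => K
  | .pop _ :: K, _ => K
  | .seq P Q :: K, _ => P :: Q :: K
  | .case _ f :: K, o => f o :: K
  | .loop i P :: K, o => if o.isSome then P :: .loop i P :: K else K

/-- The lists of programs that occur while `P` is executed before `K`. -/
def conts : Prog Γ → List (Prog Γ) → Set (List (Prog Γ))
  | .skip, K => {.skip :: K}
  | .push i a, K => {.push i a :: K}
  | .pop i, K => {.pop i :: K}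
  | .seq P Q, K => insert (.seq P Q :: K) (conts P (Q :: K) ∪ conts Q K)
  | .case i f, K => insert (.case i f :: K) (⋃ o, conts (f o) K)
  | .loop i P, K => insert (.loop i P :: K) (conts P (.loop i P :: K))

theorem mem_conts (P : Prog Γ) (K : List (Prog Γ)) : P :: K ∈ conts P K := by
  cases P <;> simp [conts]

/-- The continuations serve as control states of the compiled machine. A loop contributes only
finitely many because its body always returns to the same continuation; a case distinction does
because the alphabet is finite. -/
theorem finite_conts [Finite Γ] (P : Prog Γ) (K : List (Prog Γ)) : (conts P K).Finite := by
  induction P generalizing K with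
  | skip => exact Set.finite_singleton _
  | push => exact Set.finite_singleton _
  | pop => exact Set.finite_singleton _
  | seq P Q ih ih' => exact ((ih _).union (ih' _)).insert _
  | case i f ih => exact (Set.finite_iUnion fun o => ih o K).insert _
  | loop i P ih => exact (ih _).insert _

/-- All registers that are tested have index less than `K`. -/
def Prog.RegsLt (K : ℕ) : Prog Γ → Prop
  | .skip => True
  | .push _ _ => True
  | .pop _ => True
  | .seq P Q => P.RegsLt K ∧ Q.RegsLt K
  | .case i f => i < K ∧ ∀ o, (f o).RegsLt K
  | .loop i P => i < K ∧ P.RegsLt K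

theorem Prog.RegsLt.mono {P : Prog Γ} {K K' : ℕ} (h : P.RegsLt K) (hK : K ≤ K') :
    P.RegsLt K' := by
  induction P with
  | skip => trivial
  | push => trivial
  | pop => trivial
  | seq P Q ih ih' => exact ⟨ih h.1, ih' h.2⟩
  | case i f ih => exact ⟨h.1.trans_le hK, fun o => ih o (h.2 o)⟩
  | loop i P ih => exact ⟨h.1.trans_le hK, ih h.2⟩

/-- Only tested registers need a tape: the contents of a register that is never tested cannot
influence the control flow, so pushes and pops on it may be dropped. -/
theorem Prog.exists_regsLt [Finite Γ] (P : Prog Γ) : ∃ K, P.RegsLt K := by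
  induction P with
  | skip => exact ⟨0, trivial⟩
  | push => exact ⟨0, trivial⟩
  | pop => exact ⟨0, trivial⟩
  | seq P Q ih ih' =>
    obtain ⟨K, h⟩ := ih
    obtain ⟨K', h'⟩ := ih'
    exact ⟨max K K', h.mono (le_max_left _ _), h'.mono (le_max_right _ _)⟩
  | case i f ih =>
    choose K hK using ih
    obtain ⟨b, hb⟩ := (Set.finite_range K).bddAbove
    exact ⟨max b (i + 1), by omega, fun o => (hK o).mono
      ((hb ⟨o, rfl⟩).trans (le_max_left _ _))⟩
  | loop i P ih =>
    obtain ⟨K, h⟩ := ih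
    exact ⟨max K (i + 1), by omega, h.mono (le_max_left _ _)⟩

/-- States of the machine that executes a program. -/
inductive CState (S : Set (List (Prog Γ))) where
  | seek
  | load
  | run (L : S)
  | mid (L : S)
  | out

instance {S : Set (List (Prog Γ))} [Finite S] : Finite (CState S) := by
  refine Finite.of_injective (β := Fin 3 ⊕ (Bool × S)) (fun c => match c with
    | .seek => .inl 0
    | .load => .inl 1
    | .out => .inl 2
    | .run L => .inr (true, L)
    | .mid L => .inr (false, L)) ?_
  rintro (_ | _ | _ | _ | _) (_ | _ | _ | _ | _) h <;> simp_all

section compile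

variable {Θ : Type} [Finite Θ] (P : Prog (Sy Θ)) (K : ℕ)

/-- The finitely many lists of programs that occur in the execution of `P`. -/
def allConts : Set (List (Prog (Sy Θ))) := insert [] (conts P [])

/-- A list of programs as an element of `allConts P`. -/
noncomputable def toConts (L : List (Prog (Sy Θ))) : allConts P :=
  open Classical in if h : L ∈ allConts P then ⟨L, h⟩ else ⟨[], Set.mem_insert _ _⟩

variable {K} in
/-- Write and move on tape `i` only. -/
def act (scan : Fin K → Option (Sy Θ)) (i : ℕ) (a : Option (Sy Θ) × Move) (j : Fin K) :
    Option (Sy Θ) × Move := if j.val = i then a else (scan j, .stay)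

variable {K} in
/-- The symbol scanned on tape `i`. -/
def look (scan : Fin K → Option (Sy Θ)) (i : ℕ) : Option (Sy Θ) :=
  if h : i < K then scan ⟨i, h⟩ else none

/-- The transition function of the machine that executes `P`. -/
noncomputable def compileStep (q : CState (allConts P)) (b : InSym) (scan : Fin K → Option (Sy Θ)) :
    Option (CState (allConts P) × Move × (Fin K → Option (Sy Θ) × Move) × Option Bool) :=
  match q with
  | .seek => match b with
    | .rightEnd => some (.load, .left, fun j => (scan j, .stay), none)
    | _ => some (.seek, .right, fun j => (scan j, .stay), none)
  | .load => match b with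
    | .bit b => some (.load, .left, act scan 0 (some (.inl b), .right), none)
    | _ => some (.run (toConts P [P]), .stay, fun j => (scan j, .stay), none)
  | .run L => match L.1 with
    | [] => some (.out, .stay, act scan 0 (look scan 0, .left), none)
    | .push i a :: K => some (.run (toConts P K), .stay, act scan i (some a, .right), none)
    | .skip :: K => some (.run (toConts P K), .stay, fun j => (scan j, .stay), none)
    | .seq Q R :: K => some (.run (toConts P (Q :: R :: K)), .stay, fun j => (scan j, .stay), none)
    | .pop i :: _ => some (.mid L, .stay, act scan i (look scan i, .left), none)
    | .case i _ :: _ => some (.mid L, .stay, act scan i (look scan i, .left), none)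
    | .loop i _ :: _ => some (.mid L, .stay, act scan i (look scan i, .left), none)
  | .mid L => match L.1 with
    | .pop i :: K => some (.run (toConts P K), .stay, act scan i (none, .stay), none)
    | .case i f :: K => some (.run (toConts P (cont (.case i f :: K) (look scan i))), .stay,
        act scan i (look scan i, if (look scan i).isSome then .right else .stay), none)
    | .loop i Q :: K => some (.run (toConts P (cont (.loop i Q :: K) (look scan i))), .stay,
        act scan i (look scan i, if (look scan i).isSome then .right else .stay), none)
    | _ => none
  | .out => match look scan 0 with
    | some (.inl b) => some (.out, .stay, act scan 0 (none, .left), some b)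
    | _ => none

/-- The machine that executes `P`, with a tape for each of the first `K` registers. -/
noncomputable def compile : Machine where
  State := CState (allConts P)
  Sym := Sy Θ
  Work := Fin K
  finite_state := by
    have : Finite (allConts P) := ((finite_conts P []).insert []).to_subtype
    infer_instance
  finite_sym := inferInstance
  finite_work := inferInstance
  start := .seek
  δ := compileStep P K

/-- The tape that holds a stack, with the bottom in cell `0`. -/
def tapeOf {Γ : Type} (l : List Γ) (p : ℕ) : Option Γ := l.reverse[p]?

/-- The configuration with the registers `s`, where the head of register `i` is on the top symbol
and the other heads are behind the top symbol of their register. -/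
def topCfg (q : CState (allConts P)) (p : ℕ) (s : ℕ → List (Sy Θ)) (i : ℕ) (y : List Bool) :
    (compile P K).Cfg where
  state := q
  inPos := p
  tape j := tapeOf (s j.val)
  head j := if j.val = i then (s j.val).length - 1 else (s j.val).length
  out := y

/-- The configuration with the registers `s`, all heads behind the top symbols. -/
def regCfg (q : CState (allConts P)) (p : ℕ) (s : ℕ → List (Sy Θ)) (y : List Bool) :
    (compile P K).Cfg where
  state := q
  inPos := p
  tape j := tapeOf (s j.val)
  head j := (s j.val).length
  out := y

end compile

theorem tapeOf_length (l : List Γ) : tapeOf l l.length = none := by simp [tapeOf]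

theorem tapeOf_pred (l : List Γ) : tapeOf l (l.length - 1) = l.head? := by
  rcases l with _ | ⟨a, l⟩ <;> simp [tapeOf]

theorem update_tapeOf_cons (l : List Γ) (a : Γ) :
    Function.update (tapeOf l) l.length (some a) = tapeOf (a :: l) := by
  funext p
  by_cases hp : p = l.length
  · subst hp; simp [tapeOf]
  · rw [Function.update_of_ne hp]
    simp only [tapeOf, List.reverse_cons]
    rcases lt_or_gt_of_ne hp with h | h
    · rw [List.getElem?_append_left (by simpa using h)]
    · rw [List.getElem?_eq_none (by simp; omega), List.getElem?_eq_none (by simp; omega)]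

/-- For the empty stack the truncated `l.length - 1` is cell `0`, and erasing that blank cell
changes nothing. -/
theorem update_tapeOf_tail (l : List Γ) :
    Function.update (tapeOf l) (l.length - 1) none = tapeOf l.tail := by
  rcases l with _ | ⟨a, l⟩
  · funext p
    by_cases hp : p = 0
    · subst hp; simp [tapeOf]
    · simp [tapeOf, hp]
  · rw [← update_tapeOf_cons]
    simp only [List.length_cons, Nat.add_sub_cancel, List.tail_cons, Function.update_idem]
    rw [← tapeOf_length l, Function.update_eq_self]

theorem Machine.next_eq_some {M : Machine} {x : List Bool} {c c' : M.Cfg}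
    {r : M.State × Move × (M.Work → Option M.Sym × Move) × Option Bool}
    (h : M.δ c.state (inputSym x c.inPos) (fun i => c.tape i (c.head i)) = some r)
    (h1 : r.1 = c'.state) (h2 : min (r.2.1.apply c.inPos) (x.length + 1) = c'.inPos)
    (h3 : ∀ i, Function.update (c.tape i) (c.head i) (r.2.2.1 i).1 = c'.tape i)
    (h4 : ∀ i, (r.2.2.1 i).2.apply (c.head i) = c'.head i)
    (h5 : c.out ++ r.2.2.2.toList = c'.out) : M.next x c = some c' := by
  rw [Machine.next, h, Option.map_some]
  cases c'
  simp only [Option.some.injEq, Machine.Cfg.mk.injEq]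
  exact ⟨h1, h2, funext h3, funext h4, h5⟩

/-! ### Single steps of the compiled machine -/

section steps

variable {Θ : Type} {P : Prog (Sy Θ)} {K : ℕ} {x : List Bool}
  {q q' : CState (allConts P)} {s : ℕ → List (Sy Θ)} {y : List Bool} {p i : ℕ} {m : Move}

theorem toConts_val {L : List (Prog (Sy Θ))} (h : L ∈ allConts P) : (toConts P L).1 = L := by
  rw [toConts, dif_pos h]

variable (K s) in
/-- What the heads scan when they are behind the top symbols. -/
def regScan (j : Fin K) : Option (Sy Θ) := tapeOf (s j.val) (s j.val).length

variable (K s) in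
/-- What the heads scan when head `i` is on the top symbol. -/
def topScan (i : ℕ) (j : Fin K) : Option (Sy Θ) :=
  tapeOf (s j.val) (if j.val = i then (s j.val).length - 1 else (s j.val).length)

theorem look_topScan (hi : i < K) : look (topScan K s i) i = (s i).head? := by
  rw [look, dif_pos hi, topScan, if_pos rfl, tapeOf_pred]

variable [Finite Θ]

theorem next_keep
    (h : compileStep P K q (inputSym x p) (regScan K s) =
      some (q', m, fun j => (regScan K s j, .stay), none)) :
    (compile P K).next x (regCfg P K q p s y) =
      some (regCfg P K q' (min (m.apply p) (x.length + 1)) s y) :=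
  Machine.next_eq_some (c := regCfg P K q p s y) h rfl rfl
    (fun _ => Function.update_eq_self _ _) (fun _ => rfl) (List.append_nil _)

theorem next_push {a : Sy Θ}
    (h : compileStep P K q (inputSym x p) (regScan K s) =
      some (q', m, act (regScan K s) i (some a, .right), none)) :
    (compile P K).next x (regCfg P K q p s y) =
      some (regCfg P K q' (min (m.apply p) (x.length + 1))
        (Function.update s i (a :: s i)) y) := by
  refine Machine.next_eq_some (c := regCfg P K q p s y) h rfl rfl
    (fun (j : Fin K) => ?_) (fun (j : Fin K) => ?_) (List.append_nil _)
  · change Function.update (tapeOf (s j.val)) (s j.val).length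
      (act (regScan K s) i (some a, .right) j).1 = tapeOf (Function.update s i (a :: s i) j.val)
    by_cases hj : j.val = i
    · subst hj
      simp only [act, if_true, Function.update_self]
      exact update_tapeOf_cons _ _
    · simp only [act, if_neg hj, Function.update_of_ne hj]
      exact Function.update_eq_self _ _
  · change (act (regScan K s) i (some a, .right) j).2.apply (s j.val).length =
      (Function.update s i (a :: s i) j.val).length
    by_cases hj : j.val = i
    · subst hj
      simp [act, Move.apply]
    · simp [act, hj, Move.apply]

theorem next_left
    (h : compileStep P K q (inputSym x p) (regScan K s) =
      some (q', m, act (regScan K s) i (look (regScan K s) i, .left), none)) :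
    (compile P K).next x (regCfg P K q p s y) =
      some (topCfg P K q' (min (m.apply p) (x.length + 1)) s i y) := by
  refine Machine.next_eq_some (c := regCfg P K q p s y) h rfl rfl
    (fun (j : Fin K) => ?_) (fun (j : Fin K) => ?_) (List.append_nil _)
  · change Function.update (tapeOf (s j.val)) (s j.val).length
      (act (regScan K s) i (look (regScan K s) i, .left) j).1 = tapeOf (s j.val)
    by_cases hj : j.val = i
    · subst hj
      simp only [act, if_true, look, dif_pos j.2]
      exact Function.update_eq_self _ _
    · simp only [act, if_neg hj]
      exact Function.update_eq_self _ _
  · change (act (regScan K s) i (look (regScan K s) i, .left) j).2.apply (s j.val).length =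
      if j.val = i then (s j.val).length - 1 else (s j.val).length
    by_cases hj : j.val = i
    · subst hj
      simp [act, Move.apply]
    · simp [act, hj, Move.apply]

/-- This undoes the left move of `next_left`. On an empty stack that move had no effect in cell `0`,
so the head must stay exactly when a blank is read. -/
theorem next_peek (hi : i < K)
    (h : compileStep P K q (inputSym x p) (topScan K s i) =
      some (q', m, act (topScan K s i) i
        (look (topScan K s i) i,
          if (look (topScan K s i) i).isSome then .right else .stay), none)) :
    (compile P K).next x (topCfg P K q p s i y) =
      some (regCfg P K q' (min (m.apply p) (x.length + 1)) s y) := by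
  rw [look_topScan hi] at h
  refine Machine.next_eq_some (c := topCfg P K q p s i y) h rfl rfl
    (fun (j : Fin K) => ?_) (fun (j : Fin K) => ?_) (List.append_nil _)
  · change Function.update (tapeOf (s j.val))
      (if j.val = i then (s j.val).length - 1 else (s j.val).length)
      (act (topScan K s i) i ((s i).head?, _) j).1 = tapeOf (s j.val)
    by_cases hj : j.val = i
    · subst hj
      simp only [act, if_true]
      rw [← tapeOf_pred]
      exact Function.update_eq_self _ _
    · simp only [act, if_neg hj, topScan]
      exact Function.update_eq_self _ _
  · change (act (topScan K s i) i
      ((s i).head?, if ((s i).head?).isSome then .right else .stay) j).2.apply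
      (if j.val = i then (s j.val).length - 1 else (s j.val).length) = (s j.val).length
    by_cases hj : j.val = i
    · subst hj
      simp only [act, if_true]
      rcases s j.val with _ | ⟨a, l⟩ <;> simp [Move.apply]
    · simp [act, hj, Move.apply]

theorem next_pop
    (h : compileStep P K q (inputSym x p) (topScan K s i) =
      some (q', m, act (topScan K s i) i (none, .stay), none)) :
    (compile P K).next x (topCfg P K q p s i y) =
      some (regCfg P K q' (min (m.apply p) (x.length + 1))
        (Function.update s i (s i).tail) y) := by
  refine Machine.next_eq_some (c := topCfg P K q p s i y) h rfl rfl
    (fun (j : Fin K) => ?_) (fun (j : Fin K) => ?_) (List.append_nil _)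
  · change Function.update (tapeOf (s j.val))
      (if j.val = i then (s j.val).length - 1 else (s j.val).length)
      (act (topScan K s i) i (none, .stay) j).1 = tapeOf (Function.update s i (s i).tail j.val)
    by_cases hj : j.val = i
    · subst hj
      simp only [act, if_true, Function.update_self]
      exact update_tapeOf_tail _
    · simp only [act, if_neg hj, topScan, Function.update_of_ne hj]
      exact Function.update_eq_self _ _
  · change (act (topScan K s i) i (none, .stay) j).2.apply
      (if j.val = i then (s j.val).length - 1 else (s j.val).length) =
      (Function.update s i (s i).tail j.val).length
    by_cases hj : j.val = i
    · subst hj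
      simp [act, Move.apply]
    · simp [act, hj, Move.apply]

theorem next_out {b : Bool}
    (h : compileStep P K q (inputSym x p) (topScan K s i) =
      some (q', m, act (topScan K s i) i (none, .left), some b)) :
    (compile P K).next x (topCfg P K q p s i y) =
      some (topCfg P K q' (min (m.apply p) (x.length + 1))
        (Function.update s i (s i).tail) i (y ++ [b])) := by
  refine Machine.next_eq_some (c := topCfg P K q p s i y) h rfl rfl
    (fun (j : Fin K) => ?_) (fun (j : Fin K) => ?_) rfl
  · change Function.update (tapeOf (s j.val))
      (if j.val = i then (s j.val).length - 1 else (s j.val).length)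
      (act (topScan K s i) i (none, .left) j).1 = tapeOf (Function.update s i (s i).tail j.val)
    by_cases hj : j.val = i
    · subst hj
      simp only [act, if_true, Function.update_self]
      exact update_tapeOf_tail _
    · simp only [act, if_neg hj, topScan, Function.update_of_ne hj]
      exact Function.update_eq_self _ _
  · change (act (topScan K s i) i (none, .left) j).2.apply
      (if j.val = i then (s j.val).length - 1 else (s j.val).length) =
      if j.val = i then (Function.update s i (s i).tail j.val).length - 1
        else (Function.update s i (s i).tail j.val).length
    by_cases hj : j.val = i
    · subst hj
      simp [act, Move.apply]
    · simp [act, hj, Move.apply]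

end steps

end BPS

/-! ### Complete runs of the compiled machine -/

namespace BPS

section run

variable {Θ : Type} [Finite Θ] {P Q : Prog (Sy Θ)} {K : ℕ} {x : List Bool} {B : ℕ}
  {s s' : ℕ → List (Sy Θ)} {y : List Bool}

/-- The control state is the list of programs still to be executed, and the induction is over all
continuations `L`. The factor `2` arises because a pop or a test first moves the head back onto the
top symbol. -/
theorem Exec.reach {t : ℕ} (h : Exec B Q s t s') (hs : ∀ j, (s j).length ≤ B)
    (L : List (Prog (Sy Θ))) (hQ : conts Q L ⊆ allConts P) (hL : L ∈ allConts P)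
    (hr : Q.RegsLt K) :
    (∀ j, (s' j).length ≤ B) ∧ ∃ t' ≤ 2 * t, (compile P K).Reach x B t'
      (regCfg P K (.run (toConts P (Q :: L))) 0 s y)
      (regCfg P K (.run (toConts P L)) 0 s' y) := by
  have top : ∀ {s : ℕ → List (Sy Θ)} {i : ℕ}, (∀ j, (s j).length ≤ B) →
      ∀ j : Fin K, (if j.val = i then (s j.val).length - 1 else (s j.val).length) ≤ B :=
    fun {s i} hs j => by
      have := hs j.val
      split_ifs <;> omega
  induction h generalizing L with
  | skip s =>
    have h0 := toConts_val (hQ (mem_conts _ _))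
    refine ⟨hs, 1, by omega, .single (next_keep (m := .stay) ?_) (fun j => hs _) fun j => hs _⟩
    simp only [compileStep, h0]
  | push i a s h =>
    have h0 := toConts_val (hQ (mem_conts _ _))
    have hs' : ∀ j, (Function.update s i (a :: s i) j).length ≤ B := fun j => by
      by_cases hj : j = i
      · subst hj; simpa using h
      · simp [hj, hs]
    refine ⟨hs', 1, by omega, .single (next_push (m := .stay) ?_) (fun j => hs _) fun j => hs' _⟩
    simp only [compileStep, h0]
  | pop i s =>
    have h0 := toConts_val (hQ (mem_conts _ _))
    have hs' : ∀ j, (Function.update s i (s i).tail j).length ≤ B := fun j => by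
      have := hs j
      by_cases hj : j = i
      · subst hj; simp; omega
      · simp [hj, hs]
    refine ⟨hs', 1 + 1, by omega, (Machine.Reach.single (next_left (i := i) (m := .stay)
      (q' := .mid (toConts P (.pop i :: L))) ?_) (fun j => hs _)
      (top hs)).trans
      (.single (next_pop (q := .mid (toConts P (.pop i :: L))) (m := .stay) ?_)
        (top hs) fun j => hs' _)⟩
    · simp only [compileStep, h0]
    · simp only [compileStep, h0]
  | @seq Q R s t s' t' s'' _ _ ih ih' =>
    have h0 := toConts_val (hQ (mem_conts _ _))
    have hR : conts R L ⊆ allConts P :=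
      fun _ h => hQ (Set.mem_insert_of_mem _ (Or.inr h))
    obtain ⟨h1, t1, ht1, h2⟩ := ih hs (R :: L)
      (fun _ h => hQ (Set.mem_insert_of_mem _ (Or.inl h))) (hR (mem_conts _ _)) hr.1
    obtain ⟨k1, t2, ht2, k2⟩ := ih' h1 L hR hL hr.2
    refine ⟨k1, 1 + (t1 + t2), by omega, (Machine.Reach.single
      (next_keep (m := .stay) ?_) (fun j => hs _) fun j => hs _).trans (h2.trans k2)⟩
    simp only [compileStep, h0]
  | @case i f s t s' _ ih =>
    have h0 := toConts_val (hQ (mem_conts _ _))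
    obtain ⟨h1, t1, ht1, h2⟩ := ih hs L
      (fun _ h => hQ (Set.mem_insert_of_mem _ (Set.mem_iUnion.2 ⟨_, h⟩))) hL (hr.2 _)
    refine ⟨h1, 1 + 1 + t1, by omega, ((Machine.Reach.single (next_left (i := i) (m := .stay)
      (q' := .mid (toConts P (.case i f :: L))) ?_) (fun j => hs _) (top hs)).trans
      (.single (next_peek (m := .stay) hr.1 ?_) (top hs) fun j => hs _)).trans h2⟩
    · simp only [compileStep, h0]
    · simp only [compileStep, h0, look_topScan hr.1, cont]
  | @loop_nil i Q s hi =>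
    have h0 := toConts_val (hQ (mem_conts _ _))
    refine ⟨hs, 1 + 1, by omega, (Machine.Reach.single (next_left (i := i) (m := .stay)
      (q' := .mid (toConts P (.loop i Q :: L))) ?_) (fun j => hs _) (top hs)).trans
      (.single (next_peek (m := .stay) hr.1 ?_) (top hs) fun j => hs _)⟩
    · simp only [compileStep, h0]
    · simp only [compileStep, h0, look_topScan hr.1, cont, hi]
      rfl
  | @loop_cons i Q s t s' t' s'' hi _ _ ih ih' =>
    have h0 := toConts_val (hQ (mem_conts _ _))
    obtain ⟨h1, t1, ht1, h2⟩ := ih hs (.loop i Q :: L)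
      (fun _ h => hQ (Set.mem_insert_of_mem _ h)) (hQ (mem_conts _ _)) hr.2
    obtain ⟨k1, t2, ht2, k2⟩ := ih' h1 L hQ hL hr
    refine ⟨k1, 1 + 1 + (t1 + t2), by omega, ((Machine.Reach.single
      (next_left (i := i) (m := .stay)
      (q' := .mid (toConts P (.loop i Q :: L))) ?_) (fun j => hs _) (top hs)).trans
      (.single (next_peek (m := .stay) hr.1 ?_) (top hs) fun j => hs _)).trans (h2.trans k2)⟩
    · simp only [compileStep, h0]
    · have : ((s i).head?).isSome = true := by
        rcases h : s i with _ | ⟨a, l⟩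
        · exact absurd h hi
        · rfl
      simp only [compileStep, h0, look_topScan hr.1, cont, this, if_true]

theorem inputSym_succ (p : ℕ) (hp : p < x.length) : inputSym x (p + 1) = .bit x[p] := by
  simp [inputSym, hp]

/-- The input is pushed from right to left, so that its first bit ends up on top of register `0`.
One pass to the right end and one back, plus one step for each change of phase, give `2 * x.length +
2`. -/
theorem reach_load (hxB : x.length ≤ B) :
    (compile P K).Reach x B (2 * x.length + 2) (compile P K).init
      (regCfg P K (.run (toConts P [P])) 0 (single x) []) := by
  have e0 : (compile P K).init = regCfg P K .seek 1 (single []) [] := by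
    simp only [Machine.init, regCfg]
    congr 1
    · funext j p; simp [single, tapeOf]; exact Nat.zero_le p
    · funext j; simp [single]
  have hB : ∀ (q : CState (allConts P)) p k j,
      (regCfg P K q p (single (x.drop k)) []).head j ≤ B :=
    fun q p k j => (single_le.2 (by simp; omega) j.val)
  have hB' : ∀ (q : CState (allConts P)) p j,
      (regCfg P K q p (single []) []).head j ≤ B :=
    fun q p j => (single_le.2 (by simp) j.val)
  have seek : ∀ k ≤ x.length, (compile P K).Reach x B k (regCfg P K .seek 1 (single []) [])
      (regCfg P K .seek (k + 1) (single []) []) := fun k hk => by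
    induction k with
    | zero => exact .refl (hB' _ _)
    | succ k ih =>
      refine (ih (by omega)).trans ?_
      have := next_keep (P := P) (K := K) (x := x) (s := single []) (y := [])
        (q := .seek) (q' := .seek) (p := k + 1) (m := .right)
        (by rw [inputSym_succ _ (by omega)]; rfl)
      have e : min (Move.right.apply (k + 1)) (x.length + 1) = k + 1 + 1 := by
        simp only [Move.apply]; omega
      rw [e] at this
      exact .single this (hB' _ _) (hB' _ _)
  have turn : (compile P K).Reach x B 1 (regCfg P K .seek (x.length + 1) (single []) [])
      (regCfg P K .load x.length (single []) []) := by
    have := next_keep (P := P) (K := K) (x := x) (s := single []) (y := [])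
        (q := .seek) (q' := .load) (p := x.length + 1) (m := .left)
        (by rw [show inputSym x (x.length + 1) = .rightEnd by simp [inputSym]]; rfl)
    have e : min (Move.left.apply (x.length + 1)) (x.length + 1) = x.length := by
      simp only [Move.apply]; omega
    rw [e] at this
    exact .single this (hB' _ _) (hB' _ _)
  have load : ∀ k ≤ x.length, (compile P K).Reach x B k
      (regCfg P K .load x.length (single []) [])
      (regCfg P K .load (x.length - k) (single (x.drop (x.length - k))) []) := fun k hk => by
    induction k with
    | zero => simpa using Machine.Reach.refl (hB' .load x.length)
    | succ k ih =>
      refine (ih (by omega)).trans ?_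
      obtain ⟨p, hp⟩ : ∃ p, x.length - k = p + 1 := ⟨x.length - k - 1, by omega⟩
      have hp' : x.length - (k + 1) = p := by omega
      rw [hp, hp']
      have hpx : p < x.length := by omega
      have := next_push (P := P) (K := K) (x := x) (s := single (x.drop (p + 1))) (y := [])
        (q := .load) (q' := .load) (p := p + 1) (i := 0) (m := .left) (a := .inl x[p])
        (by rw [inputSym_succ _ hpx]; rfl)
      have e : min (Move.left.apply (p + 1)) (x.length + 1) = p := by
        simp only [Move.apply]; omega
      have e2 : Function.update (single (Θ := Θ) (x.drop (p + 1))) 0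
          (.inl x[p] :: single (x.drop (p + 1)) 0) = single (x.drop p) := by
        rw [List.drop_eq_getElem_cons hpx]
        exact Cx.enc_update_single _ (x[p] :: x.drop (p + 1))
      rw [e, e2] at this
      exact .single this (hB _ _ _) (hB _ _ _)
  have start : (compile P K).Reach x B 1 (regCfg P K .load 0 (single x) [])
      (regCfg P K (.run (toConts P [P])) 0 (single x) []) := by
    have := next_keep (P := P) (K := K) (x := x) (s := single x) (y := [])
        (q := .load) (q' := .run (toConts P [P])) (p := 0) (m := .stay) rfl
    refine .single this (fun j => ?_) fun j => ?_
    · exact hB .load 0 0 j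
    · exact hB .load 0 0 j
  have hl := load x.length le_rfl
  rw [Nat.sub_self, List.drop_zero] at hl
  rw [e0]
  have := (((seek x.length le_rfl).trans turn).trans hl).trans start
  rwa [show x.length + 1 + x.length + 1 = 2 * x.length + 2 by omega] at this

/-- Erasing register `0` from the top emits the bits in the order of the list; a blank, found when
the stack is empty, halts the machine. -/
theorem reach_out (hK : 0 < K) (l : List Bool) (hl : l.length ≤ B) :
    ∃ c, (compile P K).Reach x B (1 + l.length)
      (regCfg P K (.run (toConts P [])) 0 (single l) y) c ∧
      (compile P K).next x c = none ∧ c.out = y ++ l := by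
  have top : ∀ (l : List Bool) y (q : CState (allConts P)), l.length ≤ B →
      ∀ j, (topCfg P K q 0 (single l) 0 y).head j ≤ B :=
    fun l y q hl (j : Fin K) => by
      change (if j.val = 0 then (single l j.val).length - 1 else (single l j.val).length) ≤ B
      have := (single_le (Θ := Θ)).2 hl j.val
      split_ifs <;> omega
  have h1 : (compile P K).Reach x B 1 (regCfg P K (.run (toConts P [])) 0 (single l) y)
      (topCfg P K .out 0 (single l) 0 y) := by
    have h0 := toConts_val (P := P) (L := []) (Set.mem_insert _ _)
    refine .single (next_left (m := .stay) ?_) (fun j => single_le.2 hl _) (top _ _ _ hl)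
    simp only [compileStep, h0]
  suffices ∀ (l : List Bool) y, l.length ≤ B → ∃ c, (compile P K).Reach x B l.length
      (topCfg P K .out 0 (single l) 0 y) c ∧
      (compile P K).next x c = none ∧ c.out = y ++ l by
    obtain ⟨c, h2, h3, h4⟩ := this l y hl
    exact ⟨c, h1.trans h2, h3, h4⟩
  intro l
  induction l with
  | nil =>
    intro y hl
    refine ⟨_, .refl (top _ _ _ hl), ?_, (List.append_nil y).symm⟩
    have : compileStep P K .out (inputSym x 0) (topScan K (single []) 0) = none := by
      simp only [compileStep, look_topScan hK]
      rfl
    exact congrArg (Option.map _) this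
  | cons b l ih =>
    intro y hl
    obtain ⟨c, h2, h3, h4⟩ := ih (y ++ [b]) (by simp at hl; omega)
    have := next_out (P := P) (K := K) (x := x) (s := single (b :: l)) (y := y) (q := .out)
      (q' := .out) (p := 0) (i := 0) (m := .stay) (b := b) (by
        simp only [compileStep, look_topScan hK]
        rfl)
    have e : Function.update (single (Θ := Θ) (b :: l)) 0 (single (b :: l) 0).tail =
      single l := Cx.enc_update_single _ l |>.symm ▸ rfl
    rw [e] at this
    refine ⟨c, ?_, h3, by rw [h4]; simp⟩
    rw [List.length_cons, add_comm]
    exact (Machine.Reach.single this (top _ _ _ hl) (top _ _ _ (by simp at hl; omega))).trans h2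

end run

/-- A function on strings that is computed by a program is computed by a machine. -/
theorem Cx.exists_machine {Θ : Type} [Finite Θ] {tm : Prop} {f : List Bool → List Bool}
    (hf : Cx Θ tm f) : ∃ (M : Machine) (p : Polynomial ℕ), ∀ x,
      (∃ t, M.HaltsWith x t (f x) ∧ (tm → t ≤ p.eval x.length)) ∧
      M.UsesSpaceLE x (p.eval x.length) ∧ (f x).length ≤ p.eval x.length := by
  obtain ⟨P, q, h⟩ := hf
  obtain ⟨K, hK⟩ := P.exists_regsLt
  -- `K + 1` guarantees a tape for register `0`, which carries input and output. Loading, two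
  -- machine steps per program step, and writing the output fit into `2 * X + 4 * q + 4`.
  refine ⟨compile P (K + 1), Polynomial.C 2 * Polynomial.X + 4 * q + 4, fun x => ?_⟩
  obtain ⟨h1, T, ⟨t, htT, h2⟩, h3⟩ := h x x.length (by simp)
  rw [bdd_list] at h1
  have e : (Polynomial.C 2 * Polynomial.X + 4 * q + 4 : Polynomial ℕ).eval x.length =
    2 * x.length + 4 * q.eval x.length + 4 := by simp
  rw [e]
  set B := x.length + q.eval x.length with hB
  have hx := reach_load (P := P) (K := K + 1) (x := x) (B := B) (by omega)
  obtain ⟨-, t', ht', hP⟩ := (h2.mono (show _ ≤ B by omega)).reach (P := P) (K := K + 1)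
    (x := x) (y := []) (single_le.2 (by omega)) [] (Set.subset_insert _ _) (Set.mem_insert _ _)
    (hK.mono (by omega))
  obtain ⟨c, hc, hc1, hc2⟩ := reach_out (P := P) (K := K + 1) (x := x) (y := []) (B := B)
    (by omega) (f x) (by omega)
  have H := (hx.trans hP).trans hc
  set N := 2 * x.length + 2 + t' + (1 + (f x).length) with hN
  refine ⟨⟨N, ⟨?_, ?_⟩, fun htm => ?_⟩, fun n i => ?_, by omega⟩
  · change (compile P (K + 1)).next x (((compile P (K + 1)).stepD x)^[N] _) = none
    rw [H.1]; exact hc1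
  · change (((compile P (K + 1)).stepD x)^[N] _).out = f x
    rw [H.1]; exact hc2
  · have := h3 htm; omega
  · change (((compile P (K + 1)).stepD x)^[n] _).head i < _
    by_cases hn : n ≤ N
    · have := H.2 n hn i; omega
    · obtain ⟨m, rfl⟩ := Nat.exists_eq_add_of_le (not_le.1 hn).le
      have hfix : ((compile P (K + 1)).stepD x)^[m] c = c := by
        refine Function.iterate_fixed ?_ m
        simp [Machine.stepD, hc1]
      have := H.2 N le_rfl i
      rw [H.1] at this
      rw [add_comm N m, Function.iterate_add_apply, H.1, hfix]
      omega

end BPS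

namespace BPS

/-! ### Arithmetic and string functions -/

/-- The successor in the length-lexicographic order, least significant bit first. -/
def inc : List Bool → List Bool
  | [] => [false]
  | false :: l => true :: l
  | true :: l => false :: inc l

/-- The position of a string in the length-lexicographic order. -/
def val : List Bool → ℕ
  | [] => 0
  | b :: l => 1 + b.toNat + 2 * val l

theorem val_inc (l : List Bool) : val (inc l) = val l + 1 := by
  induction l with
  | nil => rfl
  | cons b l ih => cases b <;> simp [inc, val, ih] <;> ring

theorem val_iterate (l : List Bool) (k : ℕ) : val (inc^[k] l) = val l + k := by
  induction k with
  | zero => rfl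
  | succ k ih => rw [Function.iterate_succ_apply', val_inc, ih]; ring

/-- `val` is base two notation with the digits `1` and `2` instead of `0` and `1`: parity determines
the first digit, and leading zeros do not exist. -/
theorem val_injective : Function.Injective val := by
  intro l
  induction l with
  | nil => intro l' h; rcases l' with _ | ⟨b, l'⟩ <;> simp only [val] at h ⊢; omega
  | cons b l ih =>
    intro l' h
    rcases l' with _ | ⟨b', l'⟩
    · simp only [val] at h; omega
    · simp only [val] at h
      have : b = b' ∧ val l = val l' := by
        rcases b with _ | _ <;> rcases b' with _ | _ <;> simp at h ⊢ <;> omega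
      rw [this.1, ih this.2]

theorem two_pow_le_val (l : List Bool) : 2 ^ l.length ≤ val l + 1 := by
  induction l with
  | nil => simp [val]
  | cons b l ih => simp only [val, List.length_cons, pow_succ]; omega

theorem val_lt_two_pow (l : List Bool) : val l + 1 < 2 ^ (l.length + 1) := by
  induction l with
  | nil => simp [val]
  | cons b l ih =>
    have := b.toNat_le
    simp only [val, List.length_cons, pow_succ] at ih ⊢; omega

/-- The strings of length `d` occupy the positions from `2 ^ d - 1` to `2 ^ (d + 1) - 2`. Through
this equivalence questions about lengths along `inc` become linear arithmetic. -/
theorem length_le_iff_val {l : List Bool} {m : ℕ} : l.length ≤ m ↔ val l + 1 < 2 ^ (m + 1) := by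
  refine ⟨fun h => (val_lt_two_pow l).trans_le (Nat.pow_le_pow_right two_pos (by omega)),
    fun h => ?_⟩
  have := (two_pow_le_val l).trans_lt h
  have := (Nat.pow_lt_pow_iff_right (by norm_num)).1 this
  omega

theorem val_replicate_false (d : ℕ) : val (List.replicate d false) + 1 = 2 ^ d := by
  induction d with
  | zero => rfl
  | succ d ih => simp only [List.replicate_succ, val, pow_succ, Bool.toNat_false]; omega

theorem iterate_inc_eq {u v : List Bool} {k : ℕ} (h : val u + k = val v) : inc^[k] u = v :=
  val_injective (by rw [val_iterate, h])

theorem length_inc_iterate_le (l : List Bool) (k : ℕ) : (inc^[k] l).length ≤ l.length + k := by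
  induction k with
  | zero => simp
  | succ k ih =>
    rw [Function.iterate_succ_apply']
    have : ∀ l, (inc l).length ≤ l.length + 1 := fun l => by
      induction l with
      | nil => simp [inc]
      | cons b l ih => cases b <;> simp [inc, ih]
    have := this (inc^[k] l)
    omega

namespace Cx

variable {Θ : Type} {tm : Prop} {α β γ σ : Type} [Data Θ α] [Data Θ β] [Data Θ γ] [Data Θ σ]

theorem reverse : Cx Θ tm fun l : List Bool => l.reverse := by
  have key : ∀ l acc : List Bool, l.foldl (fun s b => b :: s) acc = l.reverse ++ acc := fun l => by
    induction l with
    | nil => intro acc; rfl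
    | cons b l ih => intro acc; simp [ih]
  refine (foldl (l := fun l : List Bool => l) (init := fun _ => []) (S := fun x => x.2.2 :: x.2.1)
    id nil ((snd.comp snd).cons (fst.comp snd)) Polynomial.X fun l n hn j hj => ?_).congr
    fun l => by simp [key]
  simp only [key, bdd_list, Polynomial.eval_X] at hn ⊢
  simp; omega

theorem append {f g : α → List Bool} (hf : Cx Θ tm f) (hg : Cx Θ tm g) :
    Cx Θ tm fun a => f a ++ g a := by
  have key : ∀ l acc : List Bool, l.foldl (fun s b => b :: s) acc = l.reverse ++ acc := fun l => by
    induction l with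
    | nil => intro acc; rfl
    | cons b l ih => intro acc; simp [ih]
  suffices Cx Θ tm fun x : List Bool × List Bool => x.1 ++ x.2 from this.comp (hf.pair hg)
  refine (foldl (l := fun x : List Bool × List Bool => x.1.reverse) (init := fun x => x.2)
    (S := fun x => x.2.2 :: x.2.1)
    (reverse.comp fst) snd ((snd.comp snd).cons (fst.comp snd)) (Polynomial.X + Polynomial.X)
    fun l n hn j hj => ?_).congr
    fun l => by simp [key]
  simp only [key, bdd_prod, bdd_list, Polynomial.eval_add, Polynomial.eval_X] at hn ⊢
  simp; omega

theorem length {f : α → List Bool} (hf : Cx Θ tm f) : Cx Θ tm fun a => (f a).length := by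
  have key : ∀ (l : List Bool) m, l.foldl (fun s _ => s + 1) m = l.length + m := fun l => by
    induction l with
    | nil => intro m; simp
    | cons b l ih => intro m; simp [ih]; ring
  suffices Cx Θ tm fun l : List Bool => l.length from this.comp hf
  refine (foldl (l := fun l : List Bool => l) (init := fun _ => 0) (S := fun x => x.2.1 + 1)
    id (nat_const 0) (succ.comp (fst.comp snd)) Polynomial.X fun l n hn j hj => ?_).congr
    fun l => by simp [key]
  simp only [key, bdd_list, bdd_nat, Polynomial.eval_X] at hn ⊢
  simp; omega

theorem add {f g : α → ℕ} (hf : Cx Θ tm f) (hg : Cx Θ tm g) : Cx Θ tm fun a => f a + g a := by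
  have key : ∀ m n : ℕ, (fun s => s + 1)^[m] n = n + m := fun m => by
    induction m with
    | zero => intro n; rfl
    | succ m ih => intro n; rw [Function.iterate_succ_apply, ih]; ring
  suffices Cx Θ tm fun x : ℕ × ℕ => x.1 + x.2 from this.comp (hf.pair hg)
  refine (iterate (m := fun x : ℕ × ℕ => x.2) (init := fun x => x.1) (S := fun x => x.2 + 1)
    snd fst (succ.comp snd) (Polynomial.X + Polynomial.X) fun x n hn j hj => ?_).congr
    fun x => key _ _
  simp only [key, bdd_prod, bdd_nat, Polynomial.eval_add, Polynomial.eval_X] at hn ⊢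
  omega

theorem sub {f g : α → ℕ} (hf : Cx Θ tm f) (hg : Cx Θ tm g) : Cx Θ tm fun a => f a - g a := by
  have key : ∀ m n : ℕ, (fun s => s - 1)^[m] n = n - m := fun m => by
    induction m with
    | zero => intro n; rfl
    | succ m ih => intro n; rw [Function.iterate_succ_apply, ih]; omega
  suffices Cx Θ tm fun x : ℕ × ℕ => x.1 - x.2 from this.comp (hf.pair hg)
  refine (iterate (m := fun x : ℕ × ℕ => x.2) (init := fun x => x.1) (S := fun x => x.2 - 1)
    snd fst (pred.comp snd) Polynomial.X fun x n hn j hj => ?_).congr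
    fun x => key _ _
  simp only [key, bdd_prod, bdd_nat, Polynomial.eval_X] at hn ⊢
  omega

theorem mul {f g : α → ℕ} (hf : Cx Θ tm f) (hg : Cx Θ tm g) : Cx Θ tm fun a => f a * g a := by
  have key : ∀ c m n : ℕ, (fun s => s + c)^[m] n = n + c * m := fun c m => by
    induction m with
    | zero => intro n; rfl
    | succ m ih => intro n; rw [Function.iterate_succ_apply, ih]; ring
  suffices Cx Θ tm fun x : ℕ × ℕ => x.1 * x.2 from this.comp (hf.pair hg)
  refine (iterate (m := fun x : ℕ × ℕ => x.2) (init := fun _ => 0) (S := fun x => x.2 + x.1.1)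
    snd (nat_const 0) (add snd (fst.comp fst)) (Polynomial.X * Polynomial.X)
    fun x n hn j hj => ?_).congr
    fun x => (key x.1 x.2 0).trans (zero_add _)
  simp only [key, bdd_prod, bdd_nat, Polynomial.eval_mul, Polynomial.eval_X] at hn ⊢
  rw [zero_add]
  exact Nat.mul_le_mul hn.1 (hj.trans hn.2)

theorem eval {f : α → ℕ} (hf : Cx Θ tm f) (p : Polynomial ℕ) : Cx Θ tm fun a => p.eval (f a) := by
  induction p using Polynomial.induction_on' with
  | add p q hp hq => simpa using hp.add hq
  | monomial n c =>
    have : Cx Θ tm fun a => f a ^ n := by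
      induction n with
      | zero => simpa using nat_const 1
      | succ n ih => simpa [pow_succ] using ih.mul hf
    simpa using (nat_const c).mul this

theorem le {f g : α → ℕ} (hf : Cx Θ tm f) (hg : Cx Θ tm g) :
    Cx Θ tm fun a => decide (f a ≤ g a) :=
  (isZero.comp (hf.sub hg)).congr fun a => by simp [Nat.sub_eq_zero_iff_le]

theorem eq_nat {f g : α → ℕ} (hf : Cx Θ tm f) (hg : Cx Θ tm g) :
    Cx Θ tm fun a => decide (f a = g a) :=
  ((hf.le hg).and (hg.le hf)).congr fun a => by
    rw [← Bool.decide_and, decide_eq_decide]; omega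

theorem beq {b c : α → Bool} (hb : Cx Θ tm b) (hc : Cx Θ tm c) : Cx Θ tm fun a => b a == c a :=
  (cond hb hc hc.not).congr fun a => by cases b a <;> cases c a <;> rfl

theorem eq_list {f g : α → List Bool} (hf : Cx Θ tm f) (hg : Cx Θ tm g) :
    Cx Θ tm fun a => decide (f a = g a) := by
  -- The fold over one list consumes the other and records whether all bits agreed so far; equality
  -- also requires that nothing is left over.
  set S : Bool × List Bool → Bool → Bool × List Bool :=
    fun s b => (s.1 && (!s.2.isEmpty && (s.2.headD false == b)), s.2.tail) with hS
  have key2 : ∀ (l : List Bool) s, (l.foldl S s).2 = s.2.drop l.length := fun l => by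
    induction l with
    | nil => intro s; rfl
    | cons b l ih => intro s; rw [List.foldl_cons, ih]; simp [hS]
  have key : ∀ (l l' : List Bool) ok,
      ((l.foldl S (ok, l')).1 && (l.foldl S (ok, l')).2.isEmpty) = (ok && decide (l = l')) :=
    fun l => by
    induction l with
    | nil => intro l' ok; cases l' <;> simp
    | cons b l ih =>
      intro l' ok
      rw [List.foldl_cons, ih]
      rcases l' with _ | ⟨c, l'⟩
      · simp
      · cases ok <;> cases b <;> cases c <;> simp <;> exact decide_eq_decide.2 Iff.rfl
  suffices Cx Θ tm fun x : List Bool × List Bool => decide (x.1 = x.2) from this.comp (hf.pair hg)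
  have h := foldl (Θ := Θ) (tm := tm) (l := fun x : List Bool × List Bool => x.1)
    (init := fun x => (true, x.2)) (S := fun x => S x.2.1 x.2.2) fst ((bool_const true).pair snd)
    (((fst.comp (fst.comp snd)).and ((isEmpty.comp (snd.comp (fst.comp snd))).not.and
      ((head.comp (snd.comp (fst.comp snd))).beq (snd.comp snd)))).pair
      (tail.comp (snd.comp (fst.comp snd)))) (Polynomial.X + 1) fun x n hn j hj => by
    simp only [bdd_prod, bdd_list, bdd_bool, key2, Polynomial.eval_add, Polynomial.eval_X,
      Polynomial.eval_one] at hn ⊢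
    refine ⟨fun _ => by omega, ?_⟩
    simp; omega
  exact ((fst.comp h).and (isEmpty.comp (snd.comp h))).congr fun x => by
    simpa using key x.1 x.2 true

theorem drop {k : α → ℕ} {f : α → List Bool} (hk : Cx Θ tm k) (hf : Cx Θ tm f) :
    Cx Θ tm fun a => (f a).drop (k a) := by
  have key : ∀ (m : ℕ) (l : List Bool), (fun s => s.tail)^[m] l = l.drop m := fun m => by
    induction m with
    | zero => intro l; rfl
    | succ m ih => intro l; rw [Function.iterate_succ_apply, ih]; cases l <;> simp
  suffices Cx Θ tm fun x : ℕ × List Bool => x.2.drop x.1 from this.comp (hk.pair hf)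
  refine (iterate (m := fun x : ℕ × List Bool => x.1) (init := fun x => x.2)
    (S := fun x => x.2.tail) fst snd (tail.comp snd) Polynomial.X fun x n hn j hj => ?_).congr
    fun x => key _ _
  simp only [key, bdd_prod, bdd_list, Polynomial.eval_X] at hn ⊢
  simp; omega

theorem take {k : α → ℕ} {f : α → List Bool} (hk : Cx Θ tm k) (hf : Cx Θ tm f) :
    Cx Θ tm fun a => (f a).take (k a) :=
  (reverse.comp ((hf.length.sub hk).drop (reverse.comp hf))).congr fun a => by
    rw [List.drop_reverse, List.reverse_reverse]
    by_cases h : k a ≤ (f a).length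
    · congr 1; omega
    · rw [List.take_of_length_le (by omega), List.take_of_length_le (by omega)]

theorem replicate {k : α → ℕ} (b : Bool) (hk : Cx Θ tm k) :
    Cx Θ tm fun a => List.replicate (k a) b := by
  have key : ∀ (m : ℕ) (l : List Bool), (fun s => b :: s)^[m] l = List.replicate m b ++ l :=
    fun m => by
    induction m with
    | zero => intro l; rfl
    | succ m ih => intro l; rw [Function.iterate_succ_apply', ih]; rfl
  suffices Cx Θ tm fun n : ℕ => List.replicate n b from this.comp hk
  refine (iterate (m := fun n : ℕ => n) (init := fun _ => [])
    (S := fun x => b :: x.2) id nil ((cons_const b).comp snd) Polynomial.X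
    fun x n hn j hj => ?_).congr fun x => by simp [key]
  simp only [key, bdd_list, bdd_nat, Polynomial.eval_X] at hn ⊢
  simp; omega

theorem inc : Cx Θ tm inc := by
  -- The state is the carry and the reversed output. A carry that survives the whole string
  -- lengthens it by a `false`.
  set S : Bool × List Bool → Bool → Bool × List Bool :=
    fun s b => (s.1 && b, xor s.1 b :: s.2) with hS
  have key2 : ∀ (l : List Bool) s, (l.foldl S s).2.length = s.2.length + l.length := fun l => by
    induction l with
    | nil => intro s; rfl
    | cons b l ih => intro s; rw [List.foldl_cons, ih]; simp [hS]; ring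
  have key0 : ∀ (l acc : List Bool), l.foldl S (false, acc) = (false, l.reverse ++ acc) :=
    fun l => by
    induction l with
    | nil => intro acc; rfl
    | cons b l ih =>
      intro acc
      have : S (false, acc) b = (false, b :: acc) := by cases b <;> rfl
      rw [List.foldl_cons, this, ih]; simp
  have key : ∀ (l acc : List Bool), (if (l.foldl S (true, acc)).1 then
      false :: (l.foldl S (true, acc)).2 else (l.foldl S (true, acc)).2).reverse =
      acc.reverse ++ BPS.inc l := fun l => by
    induction l with
    | nil => intro acc; simp [BPS.inc]
    | cons b l ih =>
      intro acc
      rw [List.foldl_cons]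
      cases b
      · have : S (true, acc) false = (false, true :: acc) := rfl
        rw [this, key0]; simp [BPS.inc]
      · have : S (true, acc) true = (true, false :: acc) := rfl
        rw [this, ih]; simp [BPS.inc]
  have h := foldl (Θ := Θ) (tm := tm) (l := fun l : List Bool => l)
    (init := fun _ => (true, [])) (S := fun x => S x.2.1 x.2.2) id ((bool_const true).pair nil)
    (((fst.comp (fst.comp snd)).and (snd.comp snd)).pair
      ((cond (fst.comp (fst.comp snd)) (snd.comp snd).not (snd.comp snd)).congr (fun x => by
        cases x.2.1.1 <;> cases x.2.2 <;> rfl) |>.cons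
        (snd.comp (fst.comp snd)))) (Polynomial.X + 1) fun x n hn j hj => by
    simp only [bdd_prod, bdd_list, bdd_bool, key2, Polynomial.eval_add, Polynomial.eval_X,
      Polynomial.eval_one] at hn ⊢
    refine ⟨fun _ => by omega, ?_⟩
    simp; omega
  exact (reverse.comp (cond (fst.comp h) ((cons_const false).comp (snd.comp h))
    (snd.comp h))).congr fun l => by simpa using key l []

/-- A search through the tails of a string. -/
theorem any_tails {P : α × List Bool → Bool} {f : α → List Bool} (hP : Cx Θ tm P)
    (hf : Cx Θ tm f) : Cx Θ tm fun a => (f a).tails.any fun t => P (a, t) := by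
  have key : ∀ (a : α) (m : ℕ) (l : List Bool) b,
      (fun s : List Bool × Bool => (s.1.tail, s.2 || P (a, s.1)))^[m + 1] (l, b) =
      (l.drop (m + 1), b || ((List.range (m + 1)).any fun i => P (a, l.drop i))) := fun a m => by
    induction m with
    | zero => intro l b; simp
    | succ m ih =>
      intro l b
      rw [Function.iterate_succ_apply', ih, List.range_succ (n := m + 1)]
      simp [List.tail_drop, Bool.or_assoc]
  obtain ⟨p, hp⟩ := hf.bdd
  have h := iterate (Θ := Θ) (tm := tm) (m := fun a : α => (f a).length + 1)
    (init := fun a => (f a, false))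
    (S := fun x : α × (List Bool × Bool) => (x.2.1.tail, x.2.2 || P (x.1, x.2.1)))
    (succ.comp hf.length) (hf.pair (bool_const false))
    ((tail.comp (fst.comp snd)).pair ((snd.comp snd).or (hP.comp (fst.pair (fst.comp snd)))))
    (p + 1) fun x n hn j hj => by
    have hx := hp x n hn
    simp only [bdd_prod, bdd_list, bdd_bool, Polynomial.eval_add,
      Polynomial.eval_one] at hx ⊢
    refine ⟨?_, fun _ => by omega⟩
    rcases j with _ | j
    · simp; omega
    · rw [key]; simp; omega
  refine (snd.comp h).congr fun a => ?_
  rw [key, Bool.false_or]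
  rw [Bool.eq_iff_iff, List.any_eq_true, List.any_eq_true]
  constructor
  · rintro ⟨i, -, hi⟩
    exact ⟨_, (List.mem_tails _ _).2 (List.drop_suffix i _), hi⟩
  · rintro ⟨t, ht, hi⟩
    rw [List.mem_tails] at ht
    refine ⟨(f a).length - t.length, by simp, ?_⟩
    rwa [← List.suffix_iff_eq_drop.1 ht]

/-- A loop over the strings of length at most `m a`, in length-lexicographic order, from `u a`. -/
theorem scan {u : α → List Bool} {m : α → ℕ} {init : α → σ} {S : α × (σ × List Bool) → σ}
    (hu : Cx Θ False u) (hm : Cx Θ False m) (hi : Cx Θ False init) (hS : Cx Θ False S)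
    (hum : ∀ a, (u a).length ≤ m a + 1) (r : Polynomial ℕ)
    (H : ∀ a n, Bdd Θ a n → ∀ j ≤ 2 ^ (m a + 1) - 1 - val (u a),
      Bdd Θ ((fun s : σ × List Bool => (S (a, s), BPS.inc s.2))^[j] (init a, u a)).1 (r.eval n)) :
    Cx Θ False fun a => ((fun s : σ × List Bool => (S (a, s), BPS.inc s.2))^[
      2 ^ (m a + 1) - 1 - val (u a)] (init a, u a)).1 := by
  obtain ⟨p, hp⟩ := hm.bdd
  have e2 : ∀ a j, ((fun s : σ × List Bool => (S (a, s), BPS.inc s.2))^[j] (init a, u a)).2 =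
      BPS.inc^[j] (u a) := fun a j => by
    induction j with
    | zero => rfl
    | succ j ih => rw [Function.iterate_succ_apply', Function.iterate_succ_apply', ← ih]
  have e : ∀ a j, (fun x : α × (σ × List Bool) => (x.1, (S x, BPS.inc x.2.2)))^[j]
      (a, (init a, u a)) = (a, (fun s : σ × List Bool => (S (a, s), BPS.inc s.2))^[j]
        (init a, u a)) := fun a j => by
    induction j with
    | zero => rfl
    | succ j ih => rw [Function.iterate_succ_apply', ih, Function.iterate_succ_apply']
  suffices Cx Θ False fun a => (a, (fun s : σ × List Bool => (S (a, s), BPS.inc s.2))^[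
      2 ^ (m a + 1) - 1 - val (u a)] (init a, u a)) from (fst.comp snd).comp this
  -- The current string is itself the loop counter, so exponentially many rounds need only
  -- polynomial space; this is why `tm` is `False`. The loop stops at the first string of length `m
  -- a + 1`.
  refine while_loop (c := fun x : α × (σ × List Bool) => decide (x.2.2.length ≤ m x.1))
    (S := fun x => (x.1, (S x, BPS.inc x.2.2))) (init := fun a => (a, (init a, u a)))
    ((length (snd.comp snd)).le (hm.comp fst)) (fst.pair (hS.pair (inc.comp (snd.comp snd))))
    (id.pair (hi.pair hu)) (Polynomial.X + r + p + 1) fun a n hn =>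
      ⟨2 ^ (m a + 1) - 1 - val (u a), (e a _).symm, ?_, fun j hj => ?_, fun j hj => ?_,
        False.elim⟩
  · have := val_lt_two_pow (u a)
    rw [e2]
    simp only [decide_eq_false_iff_not, length_le_iff_val, val_iterate]
    omega
  · rw [e, e2]
    simp only [decide_eq_true_eq, length_le_iff_val, val_iterate]
    omega
  · have hma := hp a n hn
    have hj2 : (BPS.inc^[j] (u a)).length ≤ m a + 1 := by
      rw [length_le_iff_val, val_iterate]
      have h1 := length_le_iff_val.1 (hum a)
      have : 2 ^ (m a + 1) ≥ 1 := Nat.one_le_two_pow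
      rw [pow_succ] at h1 ⊢; omega
    have hH := H a n hn j hj
    rw [e]
    simp only [bdd_prod, bdd_list, bdd_nat, Polynomial.eval_add, Polynomial.eval_X,
      Polynomial.eval_one, e2] at hma ⊢
    exact ⟨hn.mono (by omega), hH.mono (by omega), by omega⟩

end Cx

end BPS

namespace BPS

/-! ### Simulation of Turing machines by programs -/

section atom

variable {Γ : Type} {B : ℕ} {s s' : ℕ → List Γ}

/-- Read the top symbols of the first `n` registers. -/
def peekAll : ℕ → ((ℕ → Option Γ) → Prog Γ) → Prog Γ
  | 0, k => k fun _ => none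
  | n + 1, k => peekAll n fun g => .case n fun o => k (Function.update g n o)

theorem runs_peekAll {n T : ℕ} {k : (ℕ → Option Γ) → Prog Γ}
    (h : Runs B (k fun r => if r < n then (s r).head? else none) s T s') :
    Runs B (peekAll n k) s (T + n) s' := by
  induction n generalizing k T with
  | zero => simpa using! h
  | succ n ih =>
    have : Runs B (.case n fun o =>
        k (Function.update (fun r => if r < n then (s r).head? else none) n o)) s (T + 1) s' := by
      refine Runs.case ?_
      convert h using 2
      funext r
      by_cases hr : r = n
      · subst hr; simp
      · have : r < n ↔ r < n + 1 := by omega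
        simp [hr, this]
    exact (ih (k := fun g => .case n fun o => k (Function.update g n o)) this).mono le_rfl
      (by omega)

/-- Push a string on register `r`. -/
def pushList (r : ℕ) : List Γ → Prog Γ
  | [] => .skip
  | a :: l => .seq (pushList r l) (.push r a)

theorem runs_pushList {r : ℕ} {l : List Γ} (h : (l ++ s r).length ≤ B) :
    Runs B (pushList r l) s (2 * l.length + 1) (Function.update s r (l ++ s r)) := by
  induction l with
  | nil => simpa using! Runs.skip
  | cons a l ih =>
    refine ((ih (by simp at h ⊢; omega)).seq (Runs.push (by simpa using h))).congr
      (by simp; omega) fun k => ?_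
    simp

/-- Replace the top symbols of the first `n` registers, depending on all of them. -/
def atom (n : ℕ) (φ : (ℕ → Option Γ) → ℕ → List Γ) : Prog Γ :=
  peekAll n fun g => forN (fun r => .seq (.pop r) (pushList r (φ g r))) n

theorem runs_atom {n : ℕ} {φ : (ℕ → Option Γ) → ℕ → List Γ} (h2 : ∀ g r, (φ g r).length ≤ 2)
    (hs : ∀ r, n ≤ r → s r = [])
    (hB : ∀ r, (φ (fun r => (s r).head?) r ++ (s r).tail).length ≤ B) :
    Runs B (atom n φ) s (10 * n + 10) fun r =>
      if r < n then φ (fun r => (s r).head?) r ++ (s r).tail else [] := by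
  have e : (fun r => if r < n then (s r).head? else none) = fun r => (s r).head? := by
    funext r
    split_ifs with h
    · rfl
    · rw [hs r (by omega)]; rfl
  refine (runs_peekAll (T := n * (8 + 1) + 1) ?_).mono le_rfl (by omega)
  rw [e]
  refine runs_forN' (T := 8)
    (fun k r => if r < k then φ (fun r => (s r).head?) r ++ (s r).tail else s r)
    (fun r => by simp) (fun r => ?_) (fun k hk => ?_) le_rfl
  · split_ifs with h
    · rfl
    · exact hs r (by omega)
  · have := hB k
    refine (Runs.pop.seq (runs_pushList (l := φ (fun r => (s r).head?) k) (by simpa using this))).congr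
      (by have := h2 (fun r => (s r).head?) k; omega) fun r => ?_
    by_cases hr : r = k
    · subst hr; simp
    · have : r < k ↔ r < k + 1 := by omega
      simp [hr, this]

end atom

variable {Θ : Type} {α β : Type} [Data Θ α] [Data Θ β] {tm : Prop}

/-- A function that only changes the top symbols of the registers. -/
theorem Cx.of_atom {f : α → β} (n : ℕ) (φ : (ℕ → Option (Sy Θ)) → ℕ → List (Sy Θ))
    (h2 : ∀ g r, (φ g r).length ≤ 2) (hn : Data.width Θ α ≤ n)
    (h : ∀ a r, Data.enc (Θ := Θ) (f a) r =
      if r < n then φ (fun r => (Data.enc a r).head?) r ++ (Data.enc a r).tail else []) :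
    Cx Θ tm f := by
  refine ⟨atom n φ, Polynomial.X + Polynomial.C (10 * n + 12), fun a m hm => ?_⟩
  have hb : ∀ r, (φ (fun r => (Data.enc a r).head?) r ++ (Data.enc (Θ := Θ) a r).tail).length ≤
      (Polynomial.X + Polynomial.C (10 * n + 12)).eval m := fun r => by
    have := h2 (fun r => (Data.enc a r).head?) r
    have := hm r
    simp; omega
  refine ⟨fun r => ?_, 10 * n + 10, (runs_atom h2 (fun r hr => Data.enc_eq_nil _ _
    (hn.trans hr)) hb).congr le_rfl fun r => (h a r).symm, fun _ => by simp; omega⟩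
  rw [h]
  split_ifs
  · exact hb r
  · simp

/-- A string that is held by register `3` of a store with `n + 4` registers. -/
structure Shifted (n : ℕ) where
  val : List Bool

instance {n : ℕ} : Data Θ (Shifted n) where
  enc a r := if r = 3 then a.val.map Sum.inl else []
  width := n + 4
  enc_eq_nil _ _ hr := if_neg (by omega)

/-- A configuration of a simulated machine.  The input tape (with a dummy symbol in cell `0`) and
the work tapes are cut at the head; the parts to the left of the head are reversed, and the scanned
symbol belongs to the right part.  The output is reversed. -/
structure SimCfg (M : Machine) where
  run : Bool
  state : M.State
  inL : List Bool
  inR : List Bool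
  out : List Bool
  left : M.Work → List (Option M.Sym)
  right : M.Work → List (Option M.Sym)

/-- Symbols for the simulation of a machine: codes of its states and of the contents of its work
cells, and a numbering of its work tapes. -/
structure Coding (Θ : Type) (M : Machine) where
  st : M.State ↪ Sy Θ
  sym : Option M.Sym ↪ Sy Θ
  w : ℕ
  tp : M.Work ≃ Fin w

section sim

variable {M : Machine} (C : Coding Θ M)

/-- The register contents that present a configuration. -/
def SimCfg.regs (c : SimCfg M) : ℕ → List (Sy Θ)
  | 0 => (if c.run then [true] else []).map Sum.inl
  | 1 => [C.st c.state]
  | 2 => c.inL.map Sum.inl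
  | 3 => c.inR.map Sum.inl
  | 4 => c.out.map Sum.inl
  | r + 5 => if h : r / 2 < C.w then
      (if r % 2 = 0 then c.left (C.tp.symm ⟨r / 2, h⟩) else c.right (C.tp.symm ⟨r / 2, h⟩)).map
        C.sym else []

theorem SimCfg.regs_left (c : SimCfg M) (i : M.Work) :
    c.regs C (2 * (C.tp i).val + 5) = (c.left i).map C.sym := by
  have h : 2 * (C.tp i).val / 2 = (C.tp i).val := by omega
  simp [SimCfg.regs, h]

theorem SimCfg.regs_right (c : SimCfg M) (i : M.Work) :
    c.regs C (2 * (C.tp i).val + 1 + 5) = (c.right i).map C.sym := by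
  have h : (2 * (C.tp i).val + 1) / 2 = (C.tp i).val := by omega
  have h' : (2 * (C.tp i).val + 1) % 2 = 1 := by omega
  simp [SimCfg.regs, h, h']

/-- Presentation of the configurations of a simulated machine. -/
@[reducible] def simData : Data Θ (SimCfg M) where
  enc c := c.regs C
  width := 2 * C.w + 5
  enc_eq_nil c r hr := by
    obtain ⟨k, rfl⟩ : ∃ k, r = k + 5 := ⟨r - 5, by omega⟩
    exact dif_neg (by omega)

/-- The new top symbols of the left part of a tape after `a` is written and the head moves. -/
def newLeft {γ : Type} (m : Move) (a : γ) (l : Option γ) : List γ :=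
  match m with
  | .stay => l.toList
  | .left => []
  | .right => a :: l.toList

/-- The new top symbols of the right part of a tape after `a` is written and the head moves. -/
def newRight {γ : Type} (m : Move) (a : γ) (l : Option γ) : List γ :=
  match m with
  | .stay => [a]
  | .left => match l with
    | none => [a]
    | some l => [l, a]
  | .right => []

/-- The new top symbols of the left part of the input tape. -/
def newInL {γ : Type} (m : Move) (l r : Option γ) : List γ :=
  match m with
  | .stay => l.toList
  | .left => []
  | .right => r.toList ++ l.toList

/-- The new top symbols of the right part of the input tape. -/
def newInR {γ : Type} (m : Move) (l r : Option γ) : List γ :=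
  match m with
  | .stay => r.toList
  | .left => l.toList ++ r.toList
  | .right => []

theorem newLeft_map {γ δ : Type} (f : γ → δ) (m : Move) (a : γ) (l : Option γ) :
    newLeft m (f a) (l.map f) = (newLeft m a l).map f := by
  cases m <;> cases l <;> rfl

theorem newRight_map {γ δ : Type} (f : γ → δ) (m : Move) (a : γ) (l : Option γ) :
    newRight m (f a) (l.map f) = (newRight m a l).map f := by
  cases m <;> cases l <;> rfl

theorem newInL_map {γ δ : Type} (f : γ → δ) (m : Move) (l r : Option γ) :
    newInL m (l.map f) (r.map f) = (newInL m l r).map f := by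
  cases m <;> cases l <;> cases r <;> rfl

theorem newInR_map {γ δ : Type} (f : γ → δ) (m : Move) (l r : Option γ) :
    newInR m (l.map f) (r.map f) = (newInR m l r).map f := by
  cases m <;> cases l <;> cases r <;> rfl

/-- The scanned input symbol. -/
def simSym (l r : Option Bool) : InSym :=
  match l, r with
  | none, _ => .leftEnd
  | some _, none => .rightEnd
  | some _, some b => .bit b

/-- One step of the simulation. -/
def simStep (c : SimCfg M) : SimCfg M :=
  match M.δ c.state (simSym c.inL.head? c.inR.head?) (fun i => (c.right i).head?.join) with
  | none => { c with run := false }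
  | some r =>
    { run := c.run
      state := r.1
      inL := newInL r.2.1 c.inL.head? c.inR.head? ++ c.inL.tail
      inR := newInR r.2.1 c.inL.head? c.inR.head? ++ c.inR.tail
      out := r.2.2.2.toList ++ c.out
      left := fun i => newLeft (r.2.2.1 i).2 (r.2.2.1 i).1 (c.left i).head? ++ (c.left i).tail
      right := fun i => newRight (r.2.2.1 i).2 (r.2.2.1 i).1 (c.left i).head? ++ (c.right i).tail }

/-- The bit coded by a symbol. -/
def bitOf (o : Option (Sy Θ)) : Option Bool := o.bind Sum.getLeft?

/-- The cell content coded by a symbol. -/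
noncomputable def cellOf (o : Option (Sy Θ)) : Option M.Sym :=
  (o.map (Function.invFun C.sym)).join

/-- The new top symbols of all registers in a simulation step. -/
noncomputable def simTops (g : ℕ → Option (Sy Θ)) (r : ℕ) : List (Sy Θ) :=
  haveI : Nonempty M.State := ⟨M.start⟩
  match M.δ ((g 1).elim M.start (Function.invFun C.st)) (simSym (bitOf (g 2)) (bitOf (g 3)))
    (fun i => cellOf C (g (2 * (C.tp i).val + 1 + 5))) with
  | none => if r = 0 then [] else (g r).toList
  | some q => match r with
    | 0 => (g 0).toList
    | 1 => [C.st q.1]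
    | 2 => newInL q.2.1 (g 2) (g 3)
    | 3 => newInR q.2.1 (g 2) (g 3)
    | 4 => (q.2.2.2.map Sum.inl).toList ++ (g 4).toList
    | r + 5 => if h : r / 2 < C.w then
        (if r % 2 = 0 then
          newLeft (q.2.2.1 (C.tp.symm ⟨r / 2, h⟩)).2 (C.sym (q.2.2.1 (C.tp.symm ⟨r / 2, h⟩)).1)
            (g (2 * (r / 2) + 5))
        else
          newRight (q.2.2.1 (C.tp.symm ⟨r / 2, h⟩)).2 (C.sym (q.2.2.1 (C.tp.symm ⟨r / 2, h⟩)).1)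
            (g (2 * (r / 2) + 5))) else []

theorem length_simTops (g : ℕ → Option (Sy Θ)) (r : ℕ) : (simTops C g r).length ≤ 2 := by
  have h1 : ∀ {γ : Type} (o : Option γ), o.toList.length ≤ 1 := fun o => by cases o <;> simp
  have hL : ∀ {γ : Type} (m : Move) (a : γ) l, (newLeft m a l).length ≤ 2 := fun m a l => by
    cases m <;> cases l <;> simp [newLeft]
  have hR : ∀ {γ : Type} (m : Move) (a : γ) l, (newRight m a l).length ≤ 2 := fun m a l => by
    cases m <;> cases l <;> simp [newRight]
  have hIL : ∀ {γ : Type} (m : Move) (r : Option γ) l, (newInL m l r).length ≤ 2 := fun m a l => by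
    cases m <;> cases l <;> cases a <;> simp [newInL]
  have hIR : ∀ {γ : Type} (m : Move) (r : Option γ) l, (newInR m l r).length ≤ 2 := fun m a l => by
    cases m <;> cases l <;> cases a <;> simp [newInR]
  unfold simTops
  split
  · split_ifs
    · simp
    · exact (h1 _).trans one_le_two
  · split
    · exact (h1 _).trans one_le_two
    · simp
    · exact hIL _ _ _
    · exact hIR _ _ _
    · rw [List.length_append]; exact Nat.add_le_add (h1 _) (h1 _)
    · split_ifs
      · exact hL _ _ _
      · exact hR _ _ _
      · simp

/-- Since the tapes are cut at the heads, one machine step alters only the tops of the stacks, and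
the new tops depend only on the old ones. This is the form required by `Cx.of_atom`. -/
theorem regs_simStep (c : SimCfg M) (r : ℕ) :
    (simStep c).regs C r = simTops C (fun r => (c.regs C r).head?) r ++ (c.regs C r).tail := by
  have hh : ∀ {γ : Type} (l : List γ), l = l.head?.toList ++ l.tail := fun l => by
    cases l <;> rfl
  have hbit : ∀ l : List Bool, bitOf (Θ := Θ) (l.map Sum.inl).head? = l.head? := fun l => by
    cases l <;> rfl
  have hst : haveI : Nonempty M.State := ⟨M.start⟩
      ((c.regs C 1).head?).elim M.start (Function.invFun C.st) = c.state :=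
    haveI : Nonempty M.State := ⟨M.start⟩
    Function.leftInverse_invFun C.st.injective _
  have hcell : (fun i => cellOf C ((c.regs C (2 * (C.tp i).val + 1 + 5)).head?)) =
      fun i => (c.right i).head?.join := by
    funext i
    rw [SimCfg.regs_right]
    cases c.right i with
    | nil => rfl
    | cons o l =>
      simp [cellOf, Function.leftInverse_invFun C.sym.injective o]
  have h2 : c.regs C 2 = c.inL.map Sum.inl := rfl
  have h3 : c.regs C 3 = c.inR.map Sum.inl := rfl
  unfold simStep simTops
  rw [hst, hcell]
  simp only [h2, h3, hbit]
  generalize M.δ c.state (simSym c.inL.head? c.inR.head?) (fun i => (c.right i).head?.join) = o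
  rcases o with _ | q
  · rcases r with _ | r
    · simp [SimCfg.regs]; split_ifs <;> rfl
    · have e : ({ c with run := false } : SimCfg M).regs C (r + 1) = c.regs C (r + 1) := by
        match r with
        | 0 => rfl
        | 1 => rfl
        | 2 => rfl
        | 3 => rfl
        | r + 4 => rfl
      simp only [Nat.succ_ne_zero, if_false, e]
      exact hh _
  · match r with
    | 0 => exact hh _
    | 1 => rfl
    | 2 =>
      simp only [SimCfg.regs, List.map_append, List.head?_map, newInL_map, List.map_tail]
    | 3 =>
      simp only [SimCfg.regs, List.map_append, List.head?_map, newInR_map, List.map_tail]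
    | 4 =>
      simp only [SimCfg.regs, List.map_append]
      rw [List.append_assoc, ← hh]
      cases q.2.2.2 <;> rfl
    | r + 5 =>
      by_cases h : r / 2 < C.w
      · have hl : (c.regs C (2 * (r / 2) + 5)).head? =
            ((c.left (C.tp.symm ⟨r / 2, h⟩)).head?).map C.sym := by
          have := c.regs_left C (C.tp.symm ⟨r / 2, h⟩)
          simp only [Equiv.apply_symm_apply] at this
          rw [this, List.head?_map]
        simp only [hl]
        simp only [SimCfg.regs, dif_pos h]
        by_cases hr : r % 2 = 0
        · simp only [if_pos hr, List.map_append, newLeft_map, List.map_tail]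
        · simp only [if_neg hr, List.map_append, newRight_map, List.map_tail]
      · simp [SimCfg.regs, dif_neg h]

end sim

end BPS

/-! ### Correctness and space bound of the simulation -/

namespace BPS

theorem take_succ_eq {γ : Type} {Y : List γ} {p : ℕ} (h : p < Y.length) :
    Y.take (p + 1) = Y.take p ++ [Y[p]] := by
  rw [List.take_add_one, List.getElem?_eq_getElem h]; rfl

section sim

variable {M : Machine} {x : List Bool} {m : ℕ}

/-- The configuration `c` of the simulation represents the configuration `d` of the machine on
input `x`, and the work tapes are represented by at most `m` cells. -/
structure Represents (x : List Bool) (m : ℕ) (c : SimCfg M) (d : M.Cfg) : Prop where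
  run : c.run = true
  state : c.state = d.state
  inPos : d.inPos ≤ x.length + 1
  inL : c.inL = ((true :: x).take d.inPos).reverse
  inR : c.inR = (true :: x).drop d.inPos
  out : c.out = d.out.reverse
  head : ∀ i, (c.left i).length = d.head i
  tape : ∀ i p, d.tape i p = (((c.left i).reverse ++ c.right i)[p]?).join
  space : ∀ i, (c.left i).length + (c.right i).length ≤ m

/-- Owing to the dummy symbol in cell `0`, the left part is empty exactly on the left end marker and
the right part exactly on the right end marker. -/
theorem Represents.inputSym {c : SimCfg M} {d : M.Cfg} (h : Represents x m c d) :
    simSym c.inL.head? c.inR.head? = inputSym x d.inPos := by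
  rw [h.inL, h.inR]
  rcases hp : d.inPos with _ | p
  · rfl
  · have hpx : p < (true :: x).length := by have := h.inPos; simp; omega
    have e : (((true :: x).take (p + 1)).reverse).head? = some (true :: x)[p] := by
      rw [List.head?_reverse, take_succ_eq hpx, List.getLast?_concat]
    rw [e, List.drop_succ_cons, BPS.inputSym, List.head?_drop]
    cases x[p]? <;> rfl

theorem Represents.scan {c : SimCfg M} {d : M.Cfg} (h : Represents x m c d) (i : M.Work) :
    (c.right i).head?.join = d.tape i (d.head i) := by
  rw [h.tape, ← h.head, List.getElem?_append_right (by simp), List.head?_eq_getElem?]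
  simp

/-- A head move only shifts the cut; apart from the written symbol the tape contents do not change.
A left move with empty left part is the idle move in cell `0`. -/
theorem newLeft_append_newRight {γ : Type} (mv : Move) (a : γ) (L R : List γ) :
    (newLeft mv a L.head? ++ L.tail).reverse ++ (newRight mv a L.head? ++ R) =
      L.reverse ++ a :: R := by
  cases mv <;> cases L <;> simp [newLeft, newRight]

theorem length_newLeft {γ : Type} (mv : Move) (a : γ) (L : List γ) :
    (newLeft mv a L.head? ++ L.tail).length = mv.apply L.length := by
  cases mv <;> cases L <;> simp [newLeft, Move.apply]

/-- With `Y = true :: x` the minimum with `Y.length` is the rule that the input head stops at the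
right end marker. -/
theorem newInL_eq {γ : Type} (mv : Move) (Y : List γ) (p : ℕ) (hp : p ≤ Y.length) :
    newInL mv ((Y.take p).reverse).head? (Y.drop p).head? ++ ((Y.take p).reverse).tail =
      (Y.take (min (mv.apply p) Y.length)).reverse := by
  have hh : ∀ l : List γ, l.head?.toList ++ l.tail = l := fun l => by cases l <;> rfl
  cases mv with
  | stay => simp only [newInL, Move.apply, min_eq_left hp, hh]
  | left =>
    rw [Move.apply, min_eq_left (by omega)]
    simp only [newInL, List.nil_append, List.tail_reverse]
    rcases p with _ | p
    · simp
    · rw [take_succ_eq hp, List.dropLast_concat]; rfl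
  | right =>
    simp only [newInL, Move.apply, List.append_assoc, hh, List.head?_drop]
    rcases lt_or_ge p Y.length with h | h
    · rw [min_eq_left h, take_succ_eq h, List.getElem?_eq_getElem h, List.reverse_append]; rfl
    · rw [min_eq_right (by omega), List.getElem?_eq_none h,
        List.take_of_length_le h, List.take_of_length_le le_rfl]; simp

theorem newInR_eq {γ : Type} (mv : Move) (Y : List γ) (p : ℕ) (hp : p ≤ Y.length) :
    newInR mv ((Y.take p).reverse).head? (Y.drop p).head? ++ (Y.drop p).tail =
      Y.drop (min (mv.apply p) Y.length) := by
  have hh : ∀ l : List γ, l.head?.toList ++ l.tail = l := fun l => by cases l <;> rfl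
  cases mv with
  | stay => simp only [newInR, Move.apply, min_eq_left hp, hh]
  | left =>
    rw [Move.apply, min_eq_left (by omega)]
    simp only [newInR, List.append_assoc, hh]
    rcases p with _ | p
    · simp
    · rw [List.head?_reverse, take_succ_eq hp, List.getLast?_concat]
      exact (List.drop_eq_getElem_cons hp).symm
  | right =>
    simp only [newInR, Move.apply, List.nil_append, List.tail_drop]
    rcases lt_or_ge p Y.length with h | h
    · rw [min_eq_left h]
    · rw [min_eq_right (by omega), List.drop_eq_nil_of_le (by omega), List.drop_length]

theorem Represents.step {c : SimCfg M} {d d' : M.Cfg} (h : Represents x m c d)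
    (hd : M.next x d = some d') (hm : ∀ i, d.head i < m) : Represents x m (simStep c) d' := by
  have hδ : M.δ c.state (simSym c.inL.head? c.inR.head?) (fun i => (c.right i).head?.join) =
      M.δ d.state (BPS.inputSym x d.inPos) (fun i => d.tape i (d.head i)) := by
    rw [h.state, h.inputSym]
    congr 1
    funext i
    exact h.scan i
  unfold simStep
  rw [hδ]
  unfold Machine.next at hd
  generalize M.δ d.state (BPS.inputSym x d.inPos) (fun i => d.tape i (d.head i)) = o at hd
  rcases o with _ | r
  · simp at hd
  · simp only [Option.map_some, Option.some.injEq] at hd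
    subst hd
    refine ⟨h.run, rfl, min_le_right _ _, ?_, ?_, ?_, fun i => ?_, fun i p => ?_, fun i => ?_⟩
    · simp only [h.inL, h.inR]
      exact newInL_eq _ _ _ (by simpa using h.inPos)
    · simp only [h.inL, h.inR]
      exact newInR_eq _ _ _ (by simpa using h.inPos)
    · simp only [h.out, List.reverse_append]
      congr 1
      cases r.2.2.2 <;> rfl
    · simp only [length_newLeft, h.head]
    · simp only [newLeft_append_newRight]
      by_cases hp : p = d.head i
      · subst hp
        rw [Function.update_self, ← h.head, List.getElem?_append_right (by simp)]
        simp
      · rw [Function.update_of_ne hp, h.tape]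
        rcases lt_or_ge p (c.left i).length with hlt | hge
        · rw [List.getElem?_append_left (by simpa using hlt),
            List.getElem?_append_left (by simpa using hlt)]
        · rw [List.getElem?_append_right (by simpa using hge),
            List.getElem?_append_right (by simpa using hge)]
          have := h.head i
          obtain ⟨q, hq⟩ : ∃ q, p - (c.left i).reverse.length = q + 1 :=
            ⟨p - (c.left i).length - 1, by simp; omega⟩
          rw [hq]
          cases c.right i <;> simp
    -- The representation grows only if the right part was empty. Then the left part has as many
    -- cells as the head position, which is less than `m`.
    · have e := congrArg List.length (newLeft_append_newRight (r.2.2.1 i).2 (r.2.2.1 i).1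
        (c.left i) (c.right i).tail)
      simp only [List.length_append, List.length_reverse, List.length_cons,
        List.length_tail] at e ⊢
      have := h.space i
      have := hm i
      have := h.head i
      omega

theorem Represents.halt {c : SimCfg M} {d : M.Cfg} (h : Represents x m c d)
    (hd : M.next x d = none) : simStep c = { c with run := false } := by
  have hδ : M.δ c.state (simSym c.inL.head? c.inR.head?) (fun i => (c.right i).head?.join) =
      M.δ d.state (BPS.inputSym x d.inPos) (fun i => d.tape i (d.head i)) := by
    rw [h.state, h.inputSym]
    congr 1
    funext i
    exact h.scan i
  unfold simStep
  rw [hδ]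
  unfold Machine.next at hd
  rw [Option.map_eq_none_iff] at hd
  rw [hd]

theorem SimCfg.length_regs_run {Θ : Type} (C : Coding Θ M) (c : SimCfg M) (r : ℕ) :
    (({ c with run := false } : SimCfg M).regs C r).length ≤ (c.regs C r).length := by
  match r with
  | 0 => exact Nat.zero_le _
  | 1 => exact le_rfl
  | 2 => exact le_rfl
  | 3 => exact le_rfl
  | 4 => exact le_rfl
  | r + 5 => exact le_rfl

theorem Represents.length_regs_le {Θ : Type} (C : Coding Θ M) {c : SimCfg M} {d : M.Cfg}
    (h : Represents x m c d) {B : ℕ} (hx : x.length + 1 ≤ B) (ho : d.out.length ≤ B)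
    (hm : m ≤ B) (r : ℕ) : (c.regs C r).length ≤ B := by
  match r with
  | 0 => simp only [SimCfg.regs]; split_ifs <;> simp; omega
  | 1 => simp only [SimCfg.regs, List.length_singleton]; omega
  | 2 => simp only [SimCfg.regs, h.inL]; simp; omega
  | 3 => simp only [SimCfg.regs, h.inR]; simp; omega
  | 4 => simp only [SimCfg.regs, h.out]; simpa using ho
  | r + 5 =>
    simp only [SimCfg.regs]
    split_ifs with hw ho
    · have := h.space (C.tp.symm ⟨r / 2, hw⟩)
      simp; omega
    · have := h.space (C.tp.symm ⟨r / 2, hw⟩)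
      simp; omega
    · simp

variable (M) in
/-- The initial configuration of the simulation. -/
def simInit (x : List Bool) : SimCfg M where
  run := true
  state := M.start
  inL := [true]
  inR := x
  out := []
  left := fun _ => []
  right := fun _ => []

theorem represents_init : Represents x m (simInit M x) M.init :=
  ⟨rfl, rfl, by simp [Machine.init], by simp [simInit, Machine.init],
    by simp [simInit, Machine.init], rfl, fun _ => rfl, fun _ _ => by simp [simInit, Machine.init],
    fun _ => Nat.zero_le _⟩

theorem cfgAt_succ (t : ℕ) : M.cfgAt x (t + 1) = M.stepD x (M.cfgAt x t) :=
  Function.iterate_succ_apply' _ _ _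

theorem cfgAt_of_halted {t t' : ℕ} (h : M.next x (M.cfgAt x t) = none) (ht : t ≤ t') :
    M.cfgAt x t' = M.cfgAt x t := by
  induction t', ht using Nat.le_induction with
  | base => rfl
  | succ k _ ih => rw [cfgAt_succ, ih, Machine.stepD, h]; rfl

/-- The first half bounds the output at intermediate times by the final output, the second bounds
the output by the running time. -/
theorem length_out_cfgAt_mono {t t' : ℕ} (ht : t ≤ t') :
    (M.cfgAt x t).out.length ≤ (M.cfgAt x t').out.length ∧
      (M.cfgAt x t').out.length ≤ (M.cfgAt x t).out.length + (t' - t) := by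
  induction t', ht using Nat.le_induction with
  | base => simp
  | succ k hk ih =>
    rw [cfgAt_succ, Machine.stepD]
    rcases hn : M.next x (M.cfgAt x k) with _ | d
    · simp only [Option.getD_none]; omega
    · simp only [Option.getD_some]
      rw [Machine.next, Option.map_eq_some_iff] at hn
      obtain ⟨r, -, rfl⟩ := hn
      have : r.2.2.2.toList.length ≤ 1 := by cases r.2.2.2 <;> simp
      simp only [List.length_append]
      omega

theorem head_cfgAt_le (t : ℕ) (i : M.Work) : (M.cfgAt x t).head i ≤ t := by
  induction t with
  | zero => exact le_rfl
  | succ k ih =>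
    rw [cfgAt_succ, Machine.stepD]
    rcases hn : M.next x (M.cfgAt x k) with _ | d
    · simp only [Option.getD_none]; omega
    · simp only [Option.getD_some]
      rw [Machine.next, Option.map_eq_some_iff] at hn
      obtain ⟨r, -, rfl⟩ := hn
      have : ∀ (mv : Move) p, mv.apply p ≤ p + 1 := fun mv p => by
        cases mv <;> simp [Move.apply]; omega
      have := this (r.2.2.1 i).2 ((M.cfgAt x k).head i)
      simp only
      omega

end sim

/-! ### Calling a Turing machine from a program -/

namespace Cx

variable {Θ : Type} {α : Type} [Data Θ α] {tm : Prop} {M : Machine}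

/-- Two stages are needed: rewiring can move the input to register `3` but cannot create symbols,
and an atom can write the constant registers but cannot move a stack. `Shifted` is the type in
between. -/
theorem simInit (C : Coding Θ M) :
    letI := simData C
    Cx Θ tm (simInit M) := by
  let _ := simData C
  have h1 : Cx Θ tm fun l : List Bool => (⟨l⟩ : Shifted (2 * C.w + 1)) :=
    of_rewire (fun r => if r = 3 then some 0 else none) fun l r => by
      change (if r = 3 then l.map Sum.inl else []) = _
      by_cases hr : r = 3
      · subst hr; simp; rfl
      · simp [hr]
  have h2 : Cx Θ tm fun c : Shifted (2 * C.w + 1) => BPS.simInit M c.val := by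
    refine of_atom (2 * C.w + 5) (fun g r => match r with
      | 0 => [Sum.inl true]
      | 1 => [C.st M.start]
      | 2 => [Sum.inl true]
      | r + 3 => (g (r + 3)).toList) (fun g r => ?_) (by simp [Data.width]) fun c r => ?_
    · have h1 : ∀ {γ : Type} (o : Option γ), o.toList.length ≤ 2 := fun o => by cases o <;> simp
      split
      · simp
      · simp
      · simp
      · exact h1 _
    · change (BPS.simInit M c.val).regs C r = if r < 2 * C.w + 5 then _ ++
        (if r = 3 then c.val.map Sum.inl else []).tail else []
      match r with
      | 0 => rw [if_pos (by omega)]; rfl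
      | 1 => rw [if_pos (by omega)]; rfl
      | 2 => rw [if_pos (by omega)]; rfl
      | 3 =>
        rw [if_pos (by omega)]
        change c.val.map Sum.inl = ((c.val.map Sum.inl).head?).toList ++ (c.val.map Sum.inl).tail
        cases c.val <;> rfl
      | 4 => rw [if_pos (by omega)]; rfl
      | r + 5 =>
        have : (BPS.simInit M c.val).regs C (r + 5) = [] := by
          simp [SimCfg.regs, BPS.simInit]
        rw [this, if_neg (show r + 5 ≠ 3 by omega)]
        split_ifs
        · change [] = ((if r + 5 = 3 then c.val.map (Sum.inl (β := Θ)) else []).head?).toList ++ []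
          rw [if_neg (by omega)]; rfl
        · rfl
  exact h2.comp h1

/-- A function that is computed by a Turing machine is computed by a program. -/
theorem of_machine (C : Coding Θ M) {e f : α → List Bool} {p : Polynomial ℕ}
    (h : ∀ a, (∃ t, M.HaltsWith (e a) t (f a) ∧ (tm → t ≤ p.eval (e a).length)) ∧
      M.UsesSpaceLE (e a) (p.eval (e a).length) ∧ (f a).length ≤ p.eval (e a).length)
    (he : Cx Θ tm e) : Cx Θ tm f := by
  let _ := simData C
  have hrun : Cx Θ tm (SimCfg.run : SimCfg M → Bool) :=
    of_rewire (fun r => if r = 0 then some 0 else none) fun c r => by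
      by_cases hr : r = 0
      · subst hr; rfl
      · simp [hr, Data.enc, single]
  have hout : Cx Θ tm (SimCfg.out : SimCfg M → List Bool) :=
    of_rewire (fun r => if r = 0 then some 4 else none) fun c r => by
      by_cases hr : r = 0
      · subst hr; rfl
      · simp [hr, Data.enc, single]
  have hstep : Cx Θ tm (simStep : SimCfg M → SimCfg M) := by
    refine of_atom (2 * C.w + 5) (simTops C) (length_simTops C) le_rfl fun c r => ?_
    split_ifs with hr
    · exact regs_simStep C c r
    · exact Data.enc_eq_nil (Θ := Θ) (simStep c) r (not_lt.1 hr)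
  have hinit : Cx Θ tm fun a => BPS.simInit M (e a) := (simInit C).comp he
  choose T hT using fun a => (h a).1
  have hex : ∀ a, ∃ t, M.next (e a) (M.cfgAt (e a) t) = none := fun a => ⟨T a, (hT a).1.1⟩
  classical
  -- At the least halting time every earlier configuration still has a successor, so the simulation
  -- runs in step with the machine up to `N a`.
  set N : α → ℕ := fun a => Nat.find (hex a) with hN
  have hNT : ∀ a, N a ≤ T a := fun a => Nat.find_min' _ (hT a).1.1
  have hNout : ∀ a, (M.cfgAt (e a) (N a)).out = f a := fun a => by
    rw [← cfgAt_of_halted (Nat.find_spec (hex a)) (hNT a)]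
    exact (hT a).1.2
  have key : ∀ a, ∀ j ≤ N a, Represents (e a) (p.eval (e a).length)
      (simStep^[j] (BPS.simInit M (e a))) (M.cfgAt (e a) j) := fun a j => by
    induction j with
    | zero => exact fun _ => represents_init
    | succ j ih =>
      intro hj
      rw [Function.iterate_succ_apply', cfgAt_succ]
      rcases hn : M.next (e a) (M.cfgAt (e a) j) with _ | d
      · exact absurd hn (Nat.find_min (hex a) (show j < N a by omega))
      · rw [Machine.stepD, hn]
        exact (ih (by omega)).step hn ((h a).2.1 j)
  -- One additional step detects the halt and clears the run flag, which ends the loop.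
  have last : ∀ a, simStep^[N a + 1] (BPS.simInit M (e a)) =
      { simStep^[N a] (BPS.simInit M (e a)) with run := false } := fun a => by
    rw [Function.iterate_succ_apply']
    exact (key a _ le_rfl).halt (Nat.find_spec (hex a))
  obtain ⟨q, hq⟩ := he.bdd
  suffices hsuff : Cx Θ tm fun a => simStep^[N a + 1] (BPS.simInit M (e a)) from
    (reverse.comp (hout.comp hsuff)).congr fun a => by
      rw [last, (key a _ le_rfl).out, List.reverse_reverse, hNout]
  refine while_loop hrun hstep hinit (q + p.comp q + 2) fun a n hn => ⟨N a + 1, rfl, ?_,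
    fun j hj => ?_, fun j hj => ?_, fun htm => ?_⟩
  · rw [last]
  · exact (key a j (Nat.lt_succ_iff.1 hj)).run
  · have hqa := bdd_list.1 (hq a n hn)
    have hp := eval_mono p hqa
    have ev : (q + p.comp q + 2).eval n = q.eval n + p.eval (q.eval n) + 2 := by
      simp [Polynomial.eval_comp]
    have main : ∀ j ≤ N a, Bdd Θ (simStep^[j] (BPS.simInit M (e a)))
        (q.eval n + p.eval (q.eval n) + 2) := fun j hj => by
      have hr := key a j hj
      have h1 := (length_out_cfgAt_mono (M := M) (x := e a) hj).1
      rw [hNout] at h1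
      have h2 := (h a).2.2
      exact hr.length_regs_le C (by omega) (by omega) (by omega)
    rw [ev]
    rcases Nat.lt_or_ge (N a) j with hlt | hge
    · obtain rfl : j = N a + 1 := by omega
      rw [last]
      exact fun r => (SimCfg.length_regs_run C _ r).trans (main (N a) le_rfl r)
    · exact main j hge
  · have hqa := bdd_list.1 (hq a n hn)
    have hp := eval_mono p hqa
    have ev : (q + p.comp q + 2).eval n = q.eval n + p.eval (q.eval n) + 2 := by
      simp [Polynomial.eval_comp]
    have := (hT a).2 htm
    have := hNT a
    omega

end Cx

end BPS

namespace BPS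

/-! ### Programs and the classes PTIME and FPSPACE -/

/-- A coding given by an embedding of the states and cell contents. -/
noncomputable def Coding.ofEmbedding {Θ : Type} (M : Machine)
    (e : M.State ⊕ Option M.Sym ↪ Θ) : Coding Θ M where
  st := (Function.Embedding.inl.trans e).trans .inr
  sym := (Function.Embedding.inr.trans e).trans .inr
  w := @Nat.card M.Work
  tp := haveI := M.finite_work
    Finite.equivFin M.Work

theorem Machine.HaltsWith.mono {M : Machine} {x y : List Bool} {t t' : ℕ}
    (h : M.HaltsWith x t y) (ht : t ≤ t') : M.HaltsWith x t' y := by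
  rw [Machine.HaltsWith, cfgAt_of_halted h.1 ht]
  exact h

theorem Machine.HaltsWith.length_le {M : Machine} {x y : List Bool} {t : ℕ}
    (h : M.HaltsWith x t y) : y.length ≤ t := by
  have := (length_out_cfgAt_mono (M := M) (x := x) (Nat.zero_le t)).2
  rw [h.2] at this
  simpa [Machine.cfgAt, Machine.init] using this

theorem Machine.HaltsWith.usesSpaceLE {M : Machine} {x y : List Bool} {t : ℕ}
    (h : M.HaltsWith x t y) : M.UsesSpaceLE x (t + 1) := by
  intro j i
  rcases le_total j t with hj | hj
  · have := head_cfgAt_le (M := M) (x := x) j i; omega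
  · rw [cfgAt_of_halted h.1 hj]
    have := head_cfgAt_le (M := M) (x := x) t i; omega

/-- There is an alphabet for which programs can call a given PTIME function and a given FPSPACE
function. -/
theorem exists_alphabet {ι κ : Type} {e₁ f₁ : ι → List Bool} {e₂ f₂ : κ → List Bool}
    (h₁ : IsPTIME e₁ f₁) (h₂ : IsFPSPACE e₂ f₂) : ∃ Θ : Type, Finite Θ ∧
      (∀ {α : Type} [Data Θ α] {tm : Prop} {k : α → ι}, (Cx Θ tm fun a => e₁ (k a)) →
        Cx Θ tm fun a => f₁ (k a)) ∧
      ∀ {α : Type} [Data Θ α] {k : α → κ}, (Cx Θ False fun a => e₂ (k a)) →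
        Cx Θ False fun a => f₂ (k a) := by
  obtain ⟨M₁, p₁, h₁⟩ := h₁
  obtain ⟨M₂, p₂, h₂⟩ := h₂
  have := M₁.finite_state; have := M₁.finite_sym
  have := M₂.finite_state; have := M₂.finite_sym
  -- The auxiliary symbols have to name the states and cell contents of both machines, so that one
  -- program can call both.
  refine ⟨(M₁.State ⊕ Option M₁.Sym) ⊕ (M₂.State ⊕ Option M₂.Sym), inferInstance,
    fun {α _ tm k} h => ?_, fun {α _ k} h => ?_⟩
  · refine Cx.of_machine (Coding.ofEmbedding M₁ .inl) (p := p₁ + 1) (fun a => ?_) h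
    have := h₁ (k a)
    rw [Polynomial.eval_add, Polynomial.eval_one]
    exact ⟨⟨_, this, fun _ => by omega⟩, this.usesSpaceLE, this.length_le.trans (by omega)⟩
  · refine Cx.of_machine (Coding.ofEmbedding M₂ .inr) (p := p₂) (fun a => ?_) h
    obtain ⟨⟨t, ht⟩, h2, h3⟩ := h₂ (k a)
    exact ⟨⟨t, ht, False.elim⟩, h2, h3⟩

theorem Cx.isUnaryPTIME {Θ : Type} [Finite Θ] {f : ℕ → ℕ} (hf : Cx Θ True f) :
    IsUnaryPTIME f := by
  obtain ⟨M, p, h⟩ := (Cx.unary.comp (hf.comp (Cx.id.length))).exists_machine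
  refine ⟨M, p, fun n => ?_⟩
  obtain ⟨⟨t, ht, h1⟩, -⟩ := h (BPS.unary n)
  have e : (BPS.unary n).length = n := by simp [BPS.unary]
  rw [e] at ht
  exact ht.mono (h1 trivial)

theorem Cx.isFPSPACE_id {Θ : Type} [Finite Θ] {f : List Bool → List Bool} (hf : Cx Θ False f) :
    IsFPSPACE _root_.id f := by
  obtain ⟨M, p, h⟩ := hf.exists_machine
  refine ⟨M, p, fun x => ?_⟩
  obtain ⟨⟨t, ht, -⟩, h2, h3⟩ := h x
  exact ⟨⟨t, ht⟩, h2, h3⟩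

/-- The number of leading ones, with a flag for the end of the initial block of ones. -/
def leadingOnes (x : List Bool) : Bool × ℕ :=
  x.foldl (fun s b => if s.1 then s else if b then (false, s.2 + 1) else (true, s.2)) (false, 0)

theorem leadingOnes_pairCode (n : ℕ) (τ : List Bool) :
    (leadingOnes (pairCode (n, τ))).2 = n := by
  have h2 : ∀ (l : List Bool) m, l.foldl
      (fun (s : Bool × ℕ) b => if s.1 then s else if b then (false, s.2 + 1) else (true, s.2))
      (true, m) = (true, m) := fun l => by
    induction l with
    | nil => simp
    | cons b l ih => intro m; simpa using ih m
  have h1 : ∀ n m, (unary n ++ false :: τ).foldl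
      (fun (s : Bool × ℕ) b => if s.1 then s else if b then (false, s.2 + 1) else (true, s.2))
      (false, m) = (true, m + n) := fun n => by
    induction n with
    | zero => intro m; simpa [unary] using h2 τ m
    | succ n ih =>
      intro m
      have := ih (m + 1)
      simp only [unary, List.replicate_succ, List.cons_append, List.foldl_cons] at this ⊢
      simp only [Bool.false_eq_true, if_false, if_true, this]
      congr 1; omega
  rw [leadingOnes, pairCode, h1]; simp

theorem Cx.leadingOnes {Θ : Type} {tm : Prop} : Cx Θ tm leadingOnes := by
  refine foldl (l := fun l : List Bool => l) (init := fun _ => (false, 0))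
    (S := fun x => if x.2.1.1 then x.2.1 else
      if x.2.2 then (false, x.2.1.2 + 1) else (true, x.2.1.2)) id
    ((bool_const false).pair (nat_const 0))
    (cond (fst.comp (fst.comp snd)) (fst.comp snd) (cond (snd.comp snd)
      ((bool_const false).pair (succ.comp (snd.comp (fst.comp snd))))
      ((bool_const true).pair (snd.comp (fst.comp snd))))) (Polynomial.X + 1)
    fun l n hn j hj => ?_
  have key : ∀ (l : List Bool) (s : Bool × ℕ), (l.foldl (fun (s : Bool × ℕ) b =>
      if s.1 then s else if b then (false, s.2 + 1) else (true, s.2)) s).2 ≤ s.2 + l.length :=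
    fun l => by
    induction l with
    | nil => intro s; simp
    | cons b l ih =>
      intro s
      rw [List.foldl_cons]
      refine (ih _).trans ?_
      rw [List.length_cons]
      split_ifs <;> simp <;> omega
  have := key (l.take j) (false, 0)
  simp only [bdd_prod, bdd_list, bdd_nat, bdd_bool, Polynomial.eval_add, Polynomial.eval_X,
    Polynomial.eval_one] at hn ⊢
  refine ⟨fun _ => by omega, this.trans ?_⟩
  simp; omega

/-- A pair is decoded by counting the leading ones and dropping them together with the separating
zero, hence the `succ`. -/
theorem Cx.isFPSPACE_pairCode {Θ : Type} [Finite Θ] {G : ℕ × List Bool → Bool}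
    (hG : Cx Θ False G) : IsFPSPACE pairCode fun a => [G a] := by
  have hn : Cx Θ False fun x : List Bool => (BPS.leadingOnes x).2 := snd.comp Cx.leadingOnes
  obtain ⟨M, p, h⟩ := (cons (hG.comp (hn.pair ((succ.comp hn).drop Cx.id))) nil).exists_machine
  refine ⟨M, p, fun a => ?_⟩
  obtain ⟨⟨t, ht, -⟩, h2, h3⟩ := h (pairCode a)
  have e : ((BPS.leadingOnes (pairCode a)).2,
      (pairCode a).drop ((BPS.leadingOnes (pairCode a)).2 + 1)) = a := by
    rw [leadingOnes_pairCode]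
    refine Prod.ext rfl ?_
    simp [BPS.pairCode, BPS.unary, List.drop_append]
  rw [e] at ht h3
  exact ⟨⟨t, ht⟩, h2, h3⟩

theorem Cx.pairCode {Θ : Type} {tm : Prop} : Cx Θ tm pairCode :=
  (unary.comp fst).append ((cons_const false).comp snd)

theorem IsUnaryPTIME.exists_le {f : ℕ → ℕ} (hf : IsUnaryPTIME f) :
    ∃ p : Polynomial ℕ, ∀ n, f n ≤ p.eval n := by
  obtain ⟨M, p, h⟩ := hf
  refine ⟨p, fun n => ?_⟩
  simpa [unary] using (h n).length_le

/-- Bounded search for a string. -/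
theorem Cx.exists_length_le {Θ α : Type} [Data Θ α] {P : α × List Bool → Bool} {m : α → ℕ}
    [∀ a, Decidable (∃ σ, σ.length ≤ m a ∧ P (a, σ) = true)]
    (hP : Cx Θ False P) (hm : Cx Θ False m) :
    Cx Θ False fun a => decide (∃ σ, σ.length ≤ m a ∧ P (a, σ) = true) := by
  classical
  have h := Cx.scan (σ := Bool) (u := fun _ => []) (m := m) (init := fun _ => false)
    (S := fun x => x.2.1 || P (x.1, x.2.2)) nil hm (bool_const false)
    ((fst.comp snd).or (hP.comp (fst.pair (snd.comp snd)))) (fun _ => by simp) 1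
    fun a n hn j hj => by simp
  refine h.congr fun a => ?_
  have key : ∀ j, ((fun s : Bool × List Bool => (s.1 || P (a, s.2), BPS.inc s.2))^[j]
      (false, [])) = (decide (∃ i < j, P (a, BPS.inc^[i] []) = true), BPS.inc^[j] []) := fun j => by
    induction j with
    | zero => simp
    | succ j ih =>
      rw [Function.iterate_succ_apply', ih, Function.iterate_succ_apply']
      simp only [Nat.lt_succ_iff_lt_or_eq, or_and_right, exists_or, exists_eq_left,
        Bool.decide_or, Bool.decide_eq_true]
  rw [key]
  rw [decide_eq_decide]
  constructor
  · rintro ⟨i, hi, h⟩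
    refine ⟨_, ?_, h⟩
    rw [length_le_iff_val, val_iterate]
    simp only [val] at hi ⊢; omega
  · rintro ⟨σ, hσ, h⟩
    rw [length_le_iff_val] at hσ
    refine ⟨val σ, by simp only [val]; omega, ?_⟩
    rwa [iterate_inc_eq (v := σ) (by simp [val])]

/-! ### Measures of sets of strings -/

theorem length_initSeg (X : ℕ → Bool) (n : ℕ) : (initSeg X n).length = n := by simp [initSeg]

theorem initSeg_prefix (X : ℕ → Bool) {m n : ℕ} (h : m ≤ n) : initSeg X m <+: initSeg X n := by
  obtain ⟨k, rfl⟩ := Nat.exists_eq_add_of_le h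
  rw [initSeg, initSeg, List.range_add, List.map_append]
  exact List.prefix_append _ _

theorem coinMeasure_cylinder (w : List Bool) :
    coinMeasure {X | initSeg X w.length = w} = 2⁻¹ ^ w.length ∧
      MeasurableSet {X : ℕ → Bool | initSeg X w.length = w} := by
  have e : {X : ℕ → Bool | initSeg X w.length = w} =
      Set.pi (Finset.range w.length) fun i => {w.getD i false} := by
    ext X
    simp only [Set.mem_ofPred_eq, Set.mem_pi, Finset.coe_range, Set.mem_Iio,
      Set.mem_singleton_iff]
    constructor
    · intro h i hi
      conv_rhs => rw [← h]
      simp [initSeg, hi]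
    · intro h
      refine List.ext_getElem (by simp [initSeg]) fun i h1 h2 => ?_
      simp [initSeg, h i h2, h2]
  have hm : ∀ b : Bool, (PMF.uniformOfFintype Bool).toMeasure {b} = 2⁻¹ := fun b => by
    rw [PMF.toMeasure_apply_singleton _ _ (measurableSet_singleton b)]
    simp
  rw [e]
  constructor
  · rw [coinMeasure, Measure.infinitePi_pi _ fun _ _ => measurableSet_singleton _]
    simp [hm]
  · exact MeasurableSet.pi (Finset.countable_toSet _) fun _ _ => measurableSet_singleton _

theorem coinMeasure_openSet_le {S : Finset (List Bool)} {L : ℕ} (hS : ∀ w ∈ S, w.length = L) :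
    coinMeasure (openSet S) ≤ S.card * 2⁻¹ ^ L := by
  have e : openSet (S : Set (List Bool)) ⊆ ⋃ w ∈ S, {X | initSeg X w.length = w} := by
    rintro X ⟨w, hw, h⟩
    exact Set.mem_biUnion hw h
  refine (measure_mono e).trans ((measure_biUnion_finset_le _ _).trans ?_)
  rw [Finset.sum_congr rfl fun w hw => (coinMeasure_cylinder w).1.trans (by rw [hS w hw])]
  simp

/-- Distinct strings of equal length have disjoint cylinders, so their measures add up. -/
theorem card_mul_le_coinMeasure {S : Finset (List Bool)} {L : ℕ} (hS : ∀ w ∈ S, w.length = L)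
    {U : Set (ℕ → Bool)} (hU : ∀ w ∈ S, {X | initSeg X w.length = w} ⊆ U) :
    S.card * 2⁻¹ ^ L ≤ coinMeasure U := by
  have : coinMeasure (⋃ w ∈ S, {X | initSeg X w.length = w}) = S.card * 2⁻¹ ^ L := by
    rw [measure_biUnion_finset _ fun w _ => (coinMeasure_cylinder w).2]
    · rw [Finset.sum_congr rfl fun w hw => (coinMeasure_cylinder w).1.trans (by rw [hS w hw])]
      simp
    · intro w hw w' hw' hne
      refine Set.disjoint_left.2 fun X h h' => hne ?_
      have h1 : initSeg X w.length = w := h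
      have h2 : initSeg X w'.length = w' := h'
      rw [← h1, ← h2, hS w hw, hS w' hw']
  rw [← this]
  exact measure_mono (Set.iUnion₂_subset hU)

/-! ### Martin-Löf randomness implies Kolmogorov randomness -/

/-- An infimum of natural numbers in `ℕ∞` that is finite is attained; if every description were too
long, the infimum would be at least `m + 1 - n`. -/
theorem exists_of_complexity {M : List Bool → List Bool} {τ : List Bool} {n m : ℕ}
    (h : complexity M τ + n ≤ m) : ∃ σ, M σ = τ ∧ σ.length + n ≤ m := by
  by_contra! hc
  have : ((m + 1 : ℕ) : ℕ∞) ≤ complexity M τ + n := by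
    rw [complexity, ENat.iInf_add]
    refine le_iInf fun σ => ?_
    by_cases hσ : M σ = τ
    · simp only [hσ, iInf_pos]
      exact_mod_cast hc σ hσ
    · simp [hσ]
  have := this.trans h
  rw [Nat.cast_le] at this
  omega

theorem complexity_le {M : List Bool → List Bool} {τ σ : List Bool} (h : M σ = τ) :
    complexity M τ ≤ σ.length := iInf₂_le σ h

/-- The strings of length less than `k`. -/
theorem card_strings_lt (k : ℕ) :
    ∃ S : Finset (List Bool), S.card < 2 ^ k ∧ ∀ σ, σ.length < k → σ ∈ S := by
  refine ⟨(Finset.range (2 ^ k - 1)).image fun i => inc^[i] [], ?_, fun σ hσ => ?_⟩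
  · refine Finset.card_image_le.trans_lt ?_
    have : 0 < 2 ^ k := by positivity
    simp
  · rcases k with _ | k
    · omega
    · have := length_le_iff_val.1 (Nat.lt_succ_iff.1 hσ)
      exact Finset.mem_image.2 ⟨val σ, by simp; omega, iterate_inc_eq (by simp [val])⟩

theorem MartinLofRandom.kolmogorovRandom {X : ℕ → Bool} (hX : MartinLofRandom X) :
    KolmogorovRandom X := by
  classical
  rintro ⟨M, f, hM, hf, hc⟩
  obtain ⟨Θ, hΘ, hf', hM'⟩ := exists_alphabet hf hM
  obtain ⟨p, hp⟩ := hf.exists_le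
  -- The outer bound on `σ` follows from the inner one; it brings the search into the form of
  -- `Cx.exists_length_le`.
  set G : ℕ → List Bool → Bool := fun n τ => decide (τ.length = f (n + 1)) &&
    decide (∃ σ : List Bool, σ.length ≤ τ.length ∧
      (decide (σ.length + (n + 1) ≤ τ.length) && decide (M σ = τ)) = true) with hG
  -- A test needs a strictly increasing length bound, and `f` need not be increasing. Any larger
  -- bound will do, because `G` prescribes the length itself.
  set g : ℕ → ℕ := fun n => p.eval (n + 1) + n with hg
  have hspec : ∀ n τ, G n τ = true ↔ τ.length = f (n + 1) ∧
      ∃ σ : List Bool, σ.length + (n + 1) ≤ τ.length ∧ M σ = τ := fun n τ => by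
    simp only [hG, Bool.and_eq_true, decide_eq_true_eq]
    refine and_congr_right fun _ => exists_congr fun σ => ?_
    constructor
    · exact fun h => h.2
    · exact fun h => ⟨by omega, h⟩
  have htest : IsPSPACETest G g := by
    refine ⟨?_, ?_, ?_, fun n => ?_⟩
    · refine Cx.isFPSPACE_pairCode (Θ := Θ) (G := fun a => G a.1 a.2) (Cx.and ?_ ?_)
      · refine (Cx.id.length.comp Cx.snd).eq_nat ?_
        have := hf' (α := ℕ × List Bool) (tm := False) (k := fun a => a.1 + 1)
          (Cx.unary.comp (Cx.succ.comp Cx.fst))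
        exact this.length.congr fun a => by simp [unary]
      · refine Cx.exists_length_le (P := fun x : (ℕ × List Bool) × List Bool =>
          decide (x.2.length + (x.1.1 + 1) ≤ x.1.2.length) && decide (M x.2 = x.1.2))
          (Cx.and ?_ ?_) (Cx.id.length.comp Cx.snd)
        · exact ((Cx.id.length.comp Cx.snd).add (Cx.succ.comp (Cx.fst.comp Cx.fst))).le
            (Cx.id.length.comp (Cx.snd.comp Cx.fst))
        · exact (hM' (k := fun x : (ℕ × List Bool) × List Bool => x.2) Cx.snd).eq_list
            (Cx.snd.comp Cx.fst)
    · refine Cx.isUnaryPTIME (Θ := Empty) ?_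
      exact (Cx.succ.eval p).add Cx.id
    · refine strictMono_nat_of_lt_succ fun n => ?_
      have := eval_mono p (show n + 1 ≤ n + 1 + 1 by omega)
      simp only [hg]; omega
    · rcases lt_or_ge (f (n + 1)) (n + 1) with hlt | hge
      · have : openSet (testStrings G g n) = ∅ := by
          refine Set.eq_empty_of_forall_notMem ?_
          rintro Y ⟨τ, ⟨-, hτ⟩, -⟩
          obtain ⟨h1, σ, h2, -⟩ := (hspec _ _).1 hτ
          omega
        rw [this]; simp
      · obtain ⟨k, hk⟩ := Nat.exists_eq_add_of_le hge
        -- As `f (n + 1) = n + 1 + k`, the admissible descriptions have length at most `k`. There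
        -- are fewer than `2 ^ (k + 1)` of them, and the extra factor two is paid by the shift from
        -- `n` to `n + 1`.
        obtain ⟨S, hS, hS'⟩ := card_strings_lt (k + 1)
        have hsub : openSet (testStrings G g n) ⊆
            openSet ((S.image M).filter fun τ => τ.length = f (n + 1) : Finset (List Bool)) := by
          rintro Y ⟨τ, ⟨-, hτ⟩, hY⟩
          obtain ⟨h1, σ, h2, h3⟩ := (hspec _ _).1 hτ
          refine ⟨τ, ?_, hY⟩
          rw [Finset.mem_coe, Finset.mem_filter, Finset.mem_image]
          exact ⟨⟨σ, hS' σ (by omega), h3⟩, h1⟩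
        refine (measure_mono hsub).trans ((coinMeasure_openSet_le (L := f (n + 1))
          fun w hw => (Finset.mem_filter.1 hw).2).trans ?_)
        have hcard : ((S.image M).filter fun τ => τ.length = f (n + 1)).card ≤ 2 ^ (k + 1) :=
          ((Finset.card_filter_le _ _).trans Finset.card_image_le).trans hS.le
        calc _ ≤ ((2 ^ (k + 1) : ℕ) : ENNReal) * 2⁻¹ ^ (f (n + 1)) := by gcongr
          _ = (2 * 2⁻¹) ^ (k + 1) * 2⁻¹ ^ n := by
            rw [hk, mul_pow, Nat.cast_pow, Nat.cast_ofNat, show n + 1 + k = (k + 1) + n by ring,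
              pow_add 2⁻¹, mul_assoc]
          _ = _ := by rw [ENNReal.mul_inv_cancel (by simp) (by simp)]; simp
  obtain ⟨n, hn⟩ := hX G g htest
  refine hn ⟨initSeg X (f (n + 1)), ⟨?_, ?_⟩, by rw [length_initSeg]⟩
  · rw [length_initSeg]
    have := hp (n + 1)
    simp only [hg]; omega
  · obtain ⟨σ, h1, h2⟩ := exists_of_complexity (hc (n + 1))
    rw [hspec, length_initSeg]
    exact ⟨rfl, σ, h2, h1⟩

end BPS

namespace BPS

/-! ### The members of a set of strings, by rank -/

theorem length_iterate_inc_replicate {d i : ℕ} (h : i < 2 ^ d) :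
    (inc^[i] (List.replicate d false)).length = d := by
  have h1 := val_replicate_false d
  have h2 := val_iterate (List.replicate d false) i
  refine le_antisymm (length_le_iff_val.2 (by rw [pow_succ]; omega)) ?_
  rcases d with _ | d
  · exact Nat.zero_le _
  · by_contra! hc
    have := (length_le_iff_val (m := d)).1 (Nat.lt_succ_iff.1 hc)
    omega

/-- One step of the search through the strings of a fixed length: the state consists of the result,
the rank of the next member, and the current string. -/
def selectStep (P : List Bool → Bool) (idx : List Bool) (s : (List Bool × List Bool) × List Bool) :
    (List Bool × List Bool) × List Bool :=
  (if P s.2 then (if decide (s.1.2 = idx) then s.2 else s.1.1, inc s.1.2) else s.1, inc s.2)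

/-- The state of the search after `k` steps. -/
def selectState (P : List Bool → Bool) (d : ℕ) (idx : List Bool) (k : ℕ) :
    (List Bool × List Bool) × List Bool :=
  (selectStep P idx)^[k]
    ((List.replicate d false, List.replicate idx.length false), List.replicate d false)

/-- The string of length `d` that satisfies `P` and whose rank among these strings is coded by
`idx`. -/
def select (P : List Bool → Bool) (d : ℕ) (idx : List Bool) : List Bool :=
  (selectState P d idx (2 ^ d)).1.1

section
variable (P : List Bool → Bool) (d : ℕ) (idx : List Bool)

theorem selectState_succ (k : ℕ) :
    selectState P d idx (k + 1) = selectStep P idx (selectState P d idx k) :=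
  Function.iterate_succ_apply' _ _ _

theorem selectState_string (k : ℕ) :
    (selectState P d idx k).2 = inc^[k] (List.replicate d false) := by
  induction k with
  | zero => rfl
  | succ k ih => rw [selectState_succ, selectStep, ih, Function.iterate_succ_apply']

theorem selectState_rank (k : ℕ) : (selectState P d idx k).1.2 =
    inc^[Nat.count (fun i => P (inc^[i] (List.replicate d false)) = true) k]
      (List.replicate idx.length false) := by
  induction k with
  | zero => rfl
  | succ k ih =>
    rw [selectState_succ, selectStep, selectState_string, Nat.count_succ]
    split_ifs with h
    · simp only [ih, Function.iterate_succ_apply']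
    · simp only [ih, Function.iterate_succ_apply']
    · exact ih

theorem length_selectState {k : ℕ} (hk : k ≤ 2 ^ d) : (selectState P d idx k).1.1.length = d := by
  induction k with
  | zero => simp [selectState]
  | succ k ih =>
    rw [selectState_succ, selectStep, selectState_string]
    split_ifs
    · exact length_iterate_inc_replicate (by omega)
    · exact ih (by omega)
    · exact ih (by omega)

theorem length_select : (select P d idx).length = d := length_selectState P d idx le_rfl

/-- The rank counter may outgrow the length of `idx`, but it is increased at most `2 ^ d` times;
this keeps the search in polynomial space. -/
theorem length_selectState_rank {k : ℕ} (hk : k ≤ 2 ^ d) :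
    (selectState P d idx k).1.2.length ≤ idx.length + d + 1 := by
  rw [selectState_rank, length_le_iff_val, val_iterate]
  have h1 := val_replicate_false idx.length
  have h2 := Nat.count_le (p := fun i => P (inc^[i] (List.replicate d false)) = true) (n := k)
  have h3 : 2 ^ idx.length ≤ 2 ^ (idx.length + d) := Nat.pow_le_pow_right two_pos (by omega)
  have h4 : 2 ^ d ≤ 2 ^ (idx.length + d) := Nat.pow_le_pow_right two_pos (by omega)
  have h5 := Nat.two_pow_pos (idx.length + d)
  rw [pow_succ, pow_succ]
  omega

end

/-- The rank of `u` is less than `2 ^ e`, and counting from the all-`false` string of length `e`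
codes such ranks by strings of length exactly `e`. -/
theorem exists_select {P : List Bool → Bool} {d e : ℕ} {u : List Bool} (hu : u.length = d)
    (hP : P u = true)
    (hc : Nat.count (fun i => P (inc^[i] (List.replicate d false)) = true) (2 ^ d) ≤ 2 ^ e) :
    ∃ idx : List Bool, idx.length = e ∧ select P d idx = u := by
  have hd := val_replicate_false d
  have hu1 := two_pow_le_val u
  have hu2 := val_lt_two_pow u
  rw [hu] at hu1 hu2
  rw [pow_succ] at hu2
  obtain ⟨k, hk⟩ := Nat.exists_eq_add_of_le (show val (List.replicate d false) ≤ val u by omega)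
  have hku : inc^[k] (List.replicate d false) = u := iterate_inc_eq hk.symm
  have hk2 : k < 2 ^ d := by omega
  set p : ℕ → Prop := fun i => P (inc^[i] (List.replicate d false)) = true with hp
  have hpk : p k := by simp only [hp]; rw [hku]; exact hP
  have hcount : ∀ j, k < j → Nat.count p k < Nat.count p j := fun j hj =>
    Nat.count_strict_mono hpk hj
  refine ⟨inc^[Nat.count p k] (List.replicate e false),
    length_iterate_inc_replicate ((hcount _ hk2).trans_le hc), ?_⟩
  set idx := inc^[Nat.count p k] (List.replicate e false) with hidx
  have hle : idx.length = e := length_iterate_inc_replicate ((hcount _ hk2).trans_le hc)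
  -- After `u` has been passed the rank stays strictly above the target, so the result is never
  -- overwritten.
  have key : ∀ j, (selectState P d idx (k + 1 + j)).1.1 = u := fun j => by
    induction j with
    | zero =>
      rw [Nat.add_zero, selectState_succ, selectStep, selectState_string, selectState_rank, hku,
        hle]
      rw [if_pos hP]
      exact if_pos (decide_eq_true rfl)
    | succ j ih =>
      rw [← Nat.add_assoc, selectState_succ, selectStep]
      split_ifs with h1 h2
      · exfalso
        rw [decide_eq_true_eq, selectState_rank, hle] at h2
        have h3 := congrArg val h2
        rw [hidx, val_iterate, val_iterate] at h3
        have := hcount (k + 1 + j) (by omega)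
        simp only [hp] at this h3
        omega
      · exact ih
      · exact ih
  obtain ⟨j, hj⟩ := Nat.exists_eq_add_of_le (Nat.succ_le_of_lt hk2)
  rw [select, hj]
  exact key j

theorem Cx.select {Θ α : Type} [Data Θ α] {P : α × List Bool → Bool} {d : α → ℕ}
    {idx : α → List Bool} (hP : Cx Θ False P) (hd : Cx Θ False d) (hi : Cx Θ False idx) :
    Cx Θ False fun a => select (fun u => P (a, u)) (d a) (idx a) := by
  obtain ⟨q₁, hq₁⟩ := hd.bdd
  obtain ⟨q₂, hq₂⟩ := hi.bdd
  have hS : Cx Θ False fun x : α × ((List Bool × List Bool) × List Bool) =>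
      if P (x.1, x.2.2) then
        (if decide (x.2.1.2 = idx x.1) then x.2.2 else x.2.1.1, BPS.inc x.2.1.2)
      else x.2.1 :=
    cond (hP.comp (fst.pair (snd.comp snd)))
      ((cond ((snd.comp (fst.comp snd)).eq_list (hi.comp fst)) (snd.comp snd)
        (fst.comp (fst.comp snd))).pair (inc.comp (snd.comp (fst.comp snd))))
      (fst.comp snd)
  have e : ∀ a, 2 ^ (d a + 1) - 1 - val (List.replicate (d a) false) = 2 ^ d a := fun a => by
    have := val_replicate_false (d a)
    rw [pow_succ]; omega
  have h := scan (u := fun a => List.replicate (d a) false) (m := d)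
    (init := fun a => (List.replicate (d a) false, List.replicate (idx a).length false))
    (hd.replicate false) hd ((hd.replicate false).pair (hi.length.replicate false)) hS
    (fun a => by simp) (q₁ + q₂ + 1) fun a n hn j hj => ?_
  · exact (fst.comp h).congr fun a => by rw [e]; rfl
  · rw [e] at hj
    have h1 := length_selectState (fun u => P (a, u)) (d a) (idx a) hj
    have h2 := length_selectState_rank (fun u => P (a, u)) (d a) (idx a) hj
    have h3 := bdd_nat.1 (hq₁ a n hn)
    have h4 := bdd_list.1 (hq₂ a n hn)
    have h5 : Bdd Θ (selectState (fun u => P (a, u)) (d a) (idx a) j).1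
        ((q₁ + q₂ + 1).eval n) := by
      simp only [bdd_prod, bdd_list, Polynomial.eval_add, Polynomial.eval_one]
      omega
    exact h5

/-! ### Codes for a sequence of extensions -/

/-- The length of the code of an extension from length `a` to length `Q a`. -/
def codeLength (Q : ℕ → ℕ) (a : ℕ) : ℕ := Q a - (2 * a + 1)

/-- Read the next code and extend the current string accordingly. -/
def extendStep (Q : ℕ → ℕ) (E : List Bool × List Bool → List Bool) (s : List Bool × List Bool) :
    List Bool × List Bool :=
  if decide (codeLength Q s.1.length ≤ s.2.length) then
    (s.1 ++ E (s.1, s.2.take (codeLength Q s.1.length)), s.2.drop (codeLength Q s.1.length))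
  else s

/-- The string with the given sequence of codes. -/
def extendAll (Q : ℕ → ℕ) (E : List Bool × List Bool → List Bool) (σ : List Bool) : List Bool :=
  ((extendStep Q E)^[σ.length] ([], σ)).1

/-- The largest of the numbers `0, Q 0, Q (Q 0), …` that is at most `n`. -/
def floorOrbit (Q : ℕ → ℕ) (n : ℕ) : ℕ := (fun a => if decide (Q a ≤ n) then Q a else a)^[n] 0

section
variable {Q : ℕ → ℕ} {E : List Bool × List Bool → List Bool}

theorem orbit_strictMono (hQ : ∀ a, 4 * a + 2 ≤ Q a) : StrictMono fun k => Q^[k] 0 :=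
  strictMono_nat_of_lt_succ fun k => by
    rw [Function.iterate_succ_apply']
    have := hQ (Q^[k] 0)
    omega

/-- Each round either increases the value or leaves it at the last orbit point up to `n`, so `n`
rounds are enough. -/
theorem floorOrbit_spec (hQ : ∀ a, 4 * a + 2 ≤ Q a) (n : ℕ) :
    ∃ k, floorOrbit Q n = Q^[k] 0 ∧ Q^[k] 0 ≤ n ∧ n < Q^[k + 1] 0 := by
  set S : ℕ → ℕ := fun a => if decide (Q a ≤ n) then Q a else a with hS
  have h1 : ∀ j, (∃ k, S^[j] 0 = Q^[k] 0) ∧ S^[j] 0 ≤ n ∧ (j ≤ S^[j] 0 ∨ n < Q (S^[j] 0)) :=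
    fun j => by
    induction j with
    | zero => exact ⟨⟨0, rfl⟩, Nat.zero_le _, .inl le_rfl⟩
    | succ j ih =>
      obtain ⟨⟨k, hk⟩, h2, h3⟩ := ih
      rw [Function.iterate_succ_apply']
      have := hQ (S^[j] 0)
      by_cases h : Q (S^[j] 0) ≤ n
      · have e : S (S^[j] 0) = Q (S^[j] 0) := if_pos (decide_eq_true h)
        rw [e]
        exact ⟨⟨k + 1, by rw [hk, Function.iterate_succ_apply']⟩, h, .inl (by omega)⟩
      · have e : S (S^[j] 0) = S^[j] 0 := if_neg (by simpa using h)
        rw [e]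
        exact ⟨⟨k, hk⟩, h2, .inr (by omega)⟩
  obtain ⟨⟨k, hk⟩, h2, h3⟩ := h1 n
  refine ⟨k, hk, hk ▸ h2, ?_⟩
  rw [Function.iterate_succ_apply', ← hk]
  have := hQ (S^[n] 0)
  omega

theorem isOrderFunction_floorOrbit (hQ : ∀ a, 4 * a + 2 ≤ Q a) :
    IsOrderFunction (floorOrbit Q) := by
  have hm := orbit_strictMono hQ
  have hmono : Monotone (floorOrbit Q) := fun n m hnm => by
    obtain ⟨k, h1, h2, h3⟩ := floorOrbit_spec hQ n
    obtain ⟨l, h4, h5, h6⟩ := floorOrbit_spec hQ m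
    rw [h1, h4]
    have := hm.lt_iff_lt.1 (show Q^[k] 0 < Q^[l + 1] 0 by omega)
    exact hm.monotone (Nat.lt_succ_iff.1 this)
  refine ⟨hmono, tendsto_atTop_atTop_of_monotone hmono fun b => ⟨Q^[b] 0, ?_⟩⟩
  obtain ⟨k, h1, h2, h3⟩ := floorOrbit_spec hQ (Q^[b] 0)
  have := hm.lt_iff_lt.1 h3
  rw [h1]
  exact (hm.id_le b).trans (hm.monotone (Nat.lt_succ_iff.1 this))

/-- Both runs agree until `σ` no longer contains a complete code. From then on the run on `σ` is
frozen, while the run on `σ'` only extends its output. -/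
theorem extendAll_prefix {σ σ' : List Bool} (h : σ <+: σ') :
    extendAll Q E σ <+: extendAll Q E σ' := by
  have h1 : ∀ j,
      (((extendStep Q E)^[j] ([], σ)).1 = ((extendStep Q E)^[j] ([], σ')).1 ∧
        ((extendStep Q E)^[j] ([], σ)).2 <+: ((extendStep Q E)^[j] ([], σ')).2) ∨
      (((extendStep Q E)^[j] ([], σ)).1 <+: ((extendStep Q E)^[j] ([], σ')).1 ∧
        ((extendStep Q E)^[j] ([], σ)).2.length <
          codeLength Q ((extendStep Q E)^[j] ([], σ)).1.length) := fun j => by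
    induction j with
    | zero => exact .inl ⟨rfl, h⟩
    | succ j ih =>
      rw [Function.iterate_succ_apply', Function.iterate_succ_apply']
      generalize (extendStep Q E)^[j] ([], σ) = s at ih ⊢
      generalize (extendStep Q E)^[j] ([], σ') = s' at ih ⊢
      have hpre : s'.1 <+: (extendStep Q E s').1 := by
        rw [extendStep]
        split_ifs
        · exact List.prefix_append _ _
        · exact List.prefix_rfl
      rcases lt_or_ge s.2.length (codeLength Q s.1.length) with hlt | hge
      · have e : extendStep Q E s = s := if_neg (by simpa using hlt)
        rw [e]
        refine .inr ⟨?_, hlt⟩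
        rcases ih with ih | ih
        · rw [ih.1]; exact hpre
        · exact ih.1.trans hpre
      · rcases ih with ⟨ih1, ih2⟩ | ih
        · left
          obtain ⟨τ, c⟩ := s
          obtain ⟨τ', c'⟩ := s'
          simp only at ih1 ih2 hge
          subst ih1
          obtain ⟨t, rfl⟩ := ih2
          have hge' : codeLength Q τ.length ≤ (c ++ t).length := by
            rw [List.length_append]; omega
          simp only [extendStep, hge, hge', decide_true, if_true]
          rw [List.take_append_of_le_length hge, List.drop_append_of_le_length hge]
          exact ⟨rfl, List.prefix_append _ _⟩
        · exact absurd ih.2 (by omega)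
  have h2 : ∀ i j, ((extendStep Q E)^[j] ([], σ')).1 <+:
      ((extendStep Q E)^[j + i] ([], σ')).1 := fun i j => by
    induction i with
    | zero => exact List.prefix_rfl
    | succ i ih =>
      refine ih.trans ?_
      rw [← Nat.add_assoc, Function.iterate_succ_apply', extendStep]
      split_ifs
      · exact List.prefix_append _ _
      · exact List.prefix_rfl
  have h3 : ((extendStep Q E)^[σ.length] ([], σ)).1 <+:
      ((extendStep Q E)^[σ.length] ([], σ')).1 := by
    rcases h1 σ.length with h | h
    · rw [h.1]
    · exact h.1
  obtain ⟨i, hi⟩ := Nat.exists_eq_add_of_le h.length_le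
  rw [extendAll, extendAll, hi]
  exact h3.trans (h2 i _)

/-- By `4 * a + 2 ≤ Q a` a code is at least half as long as the extension it produces, which bounds
the output by `2 * σ.length`. It is also shorter than the extension or equally long, so the output
never falls behind the bits read. Finally it is nonempty, so `σ.length` steps exhaust all complete
codes. -/
theorem extendStep_invariant (hQ : ∀ a, 4 * a + 2 ≤ Q a)
    (hE : ∀ s, (E s).length = Q s.1.length - s.1.length) (σ : List Bool) (j : ℕ) :
    (∃ k, ((extendStep Q E)^[j] ([], σ)).1.length = Q^[k] 0) ∧
    ((extendStep Q E)^[j] ([], σ)).1.length + 2 * ((extendStep Q E)^[j] ([], σ)).2.length ≤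
      2 * σ.length ∧
    σ.length ≤
      ((extendStep Q E)^[j] ([], σ)).1.length + ((extendStep Q E)^[j] ([], σ)).2.length ∧
    (((extendStep Q E)^[j] ([], σ)).2.length + j ≤ σ.length ∨
      ((extendStep Q E)^[j] ([], σ)).2.length <
        codeLength Q ((extendStep Q E)^[j] ([], σ)).1.length) := by
  induction j with
  | zero => exact ⟨⟨0, rfl⟩, by simp, by simp, by simp⟩
  | succ j ih =>
    rw [Function.iterate_succ_apply']
    generalize (extendStep Q E)^[j] ([], σ) = s at ih ⊢
    obtain ⟨⟨k, hk⟩, h1, h2, h3⟩ := ih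
    by_cases h : codeLength Q s.1.length ≤ s.2.length
    · have e : extendStep Q E s = (s.1 ++ E (s.1, s.2.take (codeLength Q s.1.length)),
          s.2.drop (codeLength Q s.1.length)) := if_pos (decide_eq_true h)
      have hq := hQ s.1.length
      have hl : (s.1 ++ E (s.1, s.2.take (codeLength Q s.1.length))).length = Q s.1.length := by
        rw [List.length_append, hE]
        simp only
        omega
      rw [e]
      simp only [hl, List.length_drop]
      refine ⟨⟨k + 1, by rw [hk, Function.iterate_succ_apply']⟩, ?_⟩
      simp only [codeLength] at h h3 ⊢
      omega
    · have e : extendStep Q E s = s := if_neg (by simpa using h)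
      rw [e]
      exact ⟨⟨k, hk⟩, h1, h2, .inr (not_le.1 h)⟩

theorem isQuickProcessMachine_extendAll (hQ : ∀ a, 4 * a + 2 ≤ Q a)
    (hE : ∀ s, (E s).length = Q s.1.length - s.1.length) :
    IsQuickProcessMachine (extendAll Q E) (floorOrbit Q) := by
  refine ⟨fun _ _ => extendAll_prefix, isOrderFunction_floorOrbit hQ, fun σ => ?_⟩
  obtain ⟨⟨k, hk⟩, -, h1, h2⟩ := extendStep_invariant hQ hE σ σ.length
  rw [extendAll]
  obtain ⟨l, h3, h4, -⟩ := floorOrbit_spec hQ σ.length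
  have hq := hQ ((extendStep Q E)^[σ.length] ([], σ)).1.length
  simp only [codeLength] at h2
  -- The unread rest is shorter than a code, hence shorter than `Q a - a`, where `a` is the length
  -- of the output.
  have hlt : σ.length < Q^[k + 1] 0 := by
    rw [Function.iterate_succ_apply', ← hk]
    omega
  have hm := orbit_strictMono hQ
  have := hm.lt_iff_lt.1 (h4.trans_lt hlt)
  rw [h3, hk]
  exact hm.monotone (Nat.lt_succ_iff.1 this)

/-- Only the last code has to be economical. Reaching length `a = Q^[k] 0` costs at most `a` bits,
and the last code has `Q a - (2 * a + 1)` bits, which gives a total below `Q a - a`. -/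
theorem exists_codes (hQ : ∀ a, 4 * a + 2 ≤ Q a) {X : ℕ → Bool}
    (hX : ∀ a, ∃ idx : List Bool, idx.length = codeLength Q a ∧
      initSeg X a ++ E (initSeg X a, idx) = initSeg X (Q a)) (k : ℕ) :
    ∃ σ, extendAll Q E σ = initSeg X (Q^[k + 1] 0) ∧
      σ.length + Q^[k] 0 ≤ Q^[k + 1] 0 := by
  have hstep : ∀ k, (∃ σ : List Bool, k ≤ σ.length ∧ σ.length ≤ Q^[k] 0 ∧
      ∀ l, (extendStep Q E)^[k] ([], σ ++ l) = (initSeg X (Q^[k] 0), l)) →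
      ∃ σ : List Bool, k + 1 ≤ σ.length ∧ σ.length + Q^[k] 0 ≤ Q^[k + 1] 0 ∧
      ∀ l, (extendStep Q E)^[k + 1] ([], σ ++ l) = (initSeg X (Q^[k + 1] 0), l) := fun k => by
    rintro ⟨σ, h1, h2, h3⟩
    obtain ⟨idx, hi, hE⟩ := hX (Q^[k] 0)
    have hq := hQ (Q^[k] 0)
    refine ⟨σ ++ idx, ?_, ?_, fun l => ?_⟩
    · rw [List.length_append, hi, codeLength]; omega
    · rw [List.length_append, hi, codeLength, Function.iterate_succ_apply']; omega
    · rw [Function.iterate_succ_apply', List.append_assoc, h3, Function.iterate_succ_apply']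
      have hle : codeLength Q (initSeg X (Q^[k] 0)).length ≤ (idx ++ l).length := by
        rw [length_initSeg, List.length_append, hi]; omega
      refine (if_pos (decide_eq_true hle)).trans ?_
      rw [length_initSeg, ← hi]
      simp [hE]
  have hall : ∀ k, ∃ σ : List Bool, k ≤ σ.length ∧ σ.length ≤ Q^[k] 0 ∧
      ∀ l, (extendStep Q E)^[k] ([], σ ++ l) = (initSeg X (Q^[k] 0), l) := fun k => by
    induction k with
    | zero => exact ⟨[], le_rfl, le_rfl, fun _ => rfl⟩
    | succ k ih =>
      obtain ⟨σ, h1, h2, h3⟩ := hstep k ih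
      exact ⟨σ, h1, by omega, h3⟩
  obtain ⟨σ, h1, h2, h3⟩ := hstep k (hall k)
  refine ⟨σ, ?_, h2⟩
  obtain ⟨i, hi⟩ := Nat.exists_eq_add_of_le h1
  -- `extendAll` makes `σ.length` steps, possibly more than there are codes; the surplus steps are
  -- idle because codes are nonempty.
  have h4 : ∀ i, (extendStep Q E)^[k + 1 + i] ([], σ) = (initSeg X (Q^[k + 1] 0), []) :=
    fun i => by
    induction i with
    | zero => simpa using h3 []
    | succ i ih =>
      rw [← Nat.add_assoc, Function.iterate_succ_apply', ih]
      have := hQ (initSeg X (Q^[k + 1] 0)).length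
      have hc : ¬ codeLength Q (initSeg X (Q^[k + 1] 0)).length ≤ ([] : List Bool).length := by
        rw [codeLength, List.length_nil]; omega
      exact if_neg (by simpa using hc)
  rw [extendAll, hi, h4]

/-- If `floorOrbit Q n = Q^[k] 0`, then at length `Q^[k + 2] 0` at least `Q^[k + 1] 0` bits are
saved, and this number exceeds `n`. That is why `Q` is applied twice. -/
theorem compresses_extendAll (hQ : ∀ a, 4 * a + 2 ≤ Q a) {X : ℕ → Bool}
    (hX : ∀ a, ∃ idx : List Bool, idx.length = codeLength Q a ∧
      initSeg X a ++ E (initSeg X a, idx) = initSeg X (Q a)) :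
    Compresses (extendAll Q E) (fun n => Q (Q (floorOrbit Q n))) X := by
  intro n
  obtain ⟨k, h1, -, h2⟩ := floorOrbit_spec hQ n
  obtain ⟨σ, h3, h4⟩ := exists_codes hQ hX (k + 1)
  beta_reduce
  rw [h1, ← Function.iterate_succ_apply' Q, ← Function.iterate_succ_apply' Q]
  calc _ ≤ ((σ.length : ℕ) : ℕ∞) + (n : ℕ) := by gcongr; exact complexity_le h3
    _ ≤ _ := by exact_mod_cast (by omega : σ.length + n ≤ Q^[k + 1 + 1] 0)

end

theorem Cx.floorOrbit {Θ : Type} {tm : Prop} {Q : ℕ → ℕ} (hQ : Cx Θ tm Q) :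
    Cx Θ tm (floorOrbit Q) := by
  refine iterate (m := fun n : ℕ => n) (init := fun _ => 0)
    (S := fun x => if decide (Q x.2 ≤ x.1) then Q x.2 else x.2) id (nat_const 0)
    (cond ((hQ.comp snd).le fst) (hQ.comp snd) snd) Polynomial.X fun n N hN j hj => ?_
  rw [bdd_nat] at hN ⊢
  rw [Polynomial.eval_X]
  refine le_trans ?_ hN
  clear hj
  induction j with
  | zero => exact Nat.zero_le _
  | succ j ih =>
    rw [Function.iterate_succ_apply']
    split_ifs with h
    · exact of_decide_eq_true h
    · exact ih

theorem Cx.extendAll {Θ : Type} {Q : ℕ → ℕ} {E : List Bool × List Bool → List Bool}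
    (hQ : ∀ a, 4 * a + 2 ≤ Q a) (hE : ∀ s, (E s).length = Q s.1.length - s.1.length)
    (cQ : Cx Θ False Q) (cE : Cx Θ False E) : Cx Θ False (extendAll Q E) := by
  have cl : Cx Θ False fun x : List Bool × (List Bool × List Bool) =>
      codeLength Q x.2.1.length := by
    have h : Cx Θ False fun x : List Bool × (List Bool × List Bool) => x.2.1.length :=
      (fst.comp snd).length
    exact (cQ.comp h).sub (((nat_const 2).mul h).add (nat_const 1))
  have h := iterate (m := fun σ : List Bool => σ.length) (init := fun σ => ([], σ))
    (S := fun x => extendStep Q E x.2) id.length (nil.pair id)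
    (cond (cl.le (snd.comp snd).length)
      (((fst.comp snd).append (cE.comp ((fst.comp snd).pair (cl.take (snd.comp snd))))).pair
        (cl.drop (snd.comp snd))) snd) (2 * Polynomial.X) fun σ n hn j _ => ?_
  · exact fst.comp h
  · obtain ⟨-, h, -⟩ := extendStep_invariant hQ hE σ j
    have hn' := bdd_list.1 hn
    simp only [bdd_prod, bdd_list, Polynomial.eval_mul, Polynomial.eval_X, Polynomial.eval_ofNat]
    change ((extendStep Q E)^[j] ([], σ)).1.length ≤ 2 * n ∧
      ((extendStep Q E)^[j] ([], σ)).2.length ≤ 2 * n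
    omega

end BPS

namespace BPS

/-! ### The equivalences -/

theorem KolmogorovRandom.quickProcessRandom {X : ℕ → Bool} (hX : KolmogorovRandom X) :
    QuickProcessRandom X := fun ⟨M, f, hM, hf, hc⟩ => hX ⟨M, f, hM.1, hf, hc⟩

/-- `w` has a prefix in the `n`-th set of strings of the pair `(G, f)`. -/
def hasTestPrefix (G : ℕ → List Bool → Bool) (f : ℕ → ℕ) (n : ℕ) (w : List Bool) : Bool :=
  w.reverse.tails.any fun t => decide (t.length ≤ f n) && G n t.reverse

theorem hasTestPrefix_iff {G : ℕ → List Bool → Bool} {f : ℕ → ℕ} {n : ℕ} {w : List Bool} :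
    hasTestPrefix G f n w = true ↔ ∃ t ∈ testStrings G f n, t <+: w := by
  simp only [hasTestPrefix, List.any_eq_true, List.mem_tails, Bool.and_eq_true,
    decide_eq_true_eq, testStrings, Set.mem_ofPred_eq]
  constructor
  · rintro ⟨t, h1, h2, h3⟩
    refine ⟨t.reverse, ⟨by simpa using h2, h3⟩, ?_⟩
    rw [← List.reverse_suffix]
    simpa using h1
  · rintro ⟨t, ⟨h1, h2⟩, h3⟩
    exact ⟨t.reverse, List.reverse_suffix.2 h3, by simpa using h1, by simpa using h2⟩

/-- A test set contains at most a `2⁻ⁿ` fraction of the extensions of a string. -/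
theorem IsPSPACETest.count_le {G : ℕ → List Bool → Bool} {f : ℕ → ℕ} (h : IsPSPACETest G f)
    {n d : ℕ} {τ : List Bool} (hn : n ≤ τ.length + d) :
    Nat.count (fun i => hasTestPrefix G f n (τ ++ inc^[i] (List.replicate d false)) = true)
      (2 ^ d) ≤ 2 ^ (τ.length + d - n) := by
  classical
  rw [Nat.count_eq_card_filter_range]
  set I := (Finset.range (2 ^ d)).filter fun i =>
    hasTestPrefix G f n (τ ++ inc^[i] (List.replicate d false)) = true with hI
  have hinj : Function.Injective fun i => τ ++ inc^[i] (List.replicate d false) := fun i j hij => by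
    have := congrArg val (List.append_cancel_left hij)
    rw [val_iterate, val_iterate] at this
    omega
  rw [← Finset.card_image_of_injective I hinj]
  set S := I.image fun i => τ ++ inc^[i] (List.replicate d false) with hS
  have h1 : ∀ w ∈ S, w.length = τ.length + d := fun w hw => by
    obtain ⟨i, hi, rfl⟩ := Finset.mem_image.1 hw
    rw [List.length_append, length_iterate_inc_replicate]
    exact Finset.mem_range.1 (Finset.mem_filter.1 hi).1
  have h2 : ∀ w ∈ S, {X | initSeg X w.length = w} ⊆ openSet (testStrings G f n) := by
    rintro w hw X (hX : initSeg X w.length = w)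
    obtain ⟨i, hi, rfl⟩ := Finset.mem_image.1 hw
    obtain ⟨t, ht, htw⟩ := hasTestPrefix_iff.1 (Finset.mem_filter.1 hi).2
    refine ⟨t, ht, ?_⟩
    have h3 := initSeg_prefix X htw.length_le
    rw [hX] at h3
    exact (List.prefix_of_prefix_length_le h3 htw (by rw [length_initSeg])).eq_of_length
      (by rw [length_initSeg])
  -- The whole measure of `U_n` is charged to the extensions of `τ`. The resulting bound on their
  -- number is absolute, not relative to the cylinder of `τ`.
  have h3 := (card_mul_le_coinMeasure h1 h2).trans (h.measure_le n)
  obtain ⟨e, he⟩ := Nat.exists_eq_add_of_le hn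
  rw [he, Nat.add_sub_cancel_left]
  rw [he, pow_add] at h3
  have h4 : (2⁻¹ : ENNReal) ^ n ≠ 0 := by simp
  have h5 : (2⁻¹ : ENNReal) ^ n ≠ ⊤ := by simp
  have h6 : (S.card : ENNReal) * 2⁻¹ ^ e ≤ 1 := by
    rw [← ENNReal.mul_le_mul_iff_right h4 h5]
    calc _ = (S.card : ENNReal) * (2⁻¹ ^ n * 2⁻¹ ^ e) := by ring
      _ ≤ _ := by simpa using h3
  have h7 : (S.card : ENNReal) ≤ 2 ^ e := by
    calc (S.card : ENNReal) = S.card * (2⁻¹ * 2) ^ e := by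
          rw [ENNReal.inv_mul_cancel (by simp) (by simp)]; simp
      _ = S.card * 2⁻¹ ^ e * 2 ^ e := by rw [mul_pow]; ring
      _ ≤ 1 * 2 ^ e := by gcongr
      _ = _ := one_mul _
  exact_mod_cast h7

/-- A test that captures `X` at all levels yields short codes for the passage from `X ↾ a` to `X ↾ Q
a`. Level `2 * a + 1` is used because `a` levels are lost by conditioning on a string of length `a`
in `IsPSPACETest.count_le`. -/
theorem QuickProcessRandom.martinLofRandom {X : ℕ → Bool} (hX : QuickProcessRandom X) :
    MartinLofRandom X := by
  intro G f hGf
  by_contra! hmem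
  obtain ⟨Θ, hΘ, hf, hG⟩ := exists_alphabet hGf.ptime hGf.fpspace
  obtain ⟨p, hp⟩ := hGf.ptime.exists_le
  -- The first summand bounds the length of the strings of level `2 * a + 1`; the second makes every
  -- code at least half as long as `Q a`.
  set Q : ℕ → ℕ := fun a => p.eval (2 * a + 1) + (4 * a + 2) with hQdef
  have hQ : ∀ a, 4 * a + 2 ≤ Q a := fun a => Nat.le_add_left _ _
  set E : List Bool × List Bool → List Bool := fun s =>
    select (fun u => hasTestPrefix G f (2 * s.1.length + 1) (s.1 ++ u))
      (Q s.1.length - s.1.length) s.2 with hEdef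
  have hE : ∀ s, (E s).length = Q s.1.length - s.1.length := fun s => length_select _ _ _
  have cQ : ∀ {Θ : Type} {tm : Prop}, Cx Θ tm Q := fun {Θ tm} =>
    ((((Cx.nat_const 2).mul Cx.id).add (Cx.nat_const 1)).eval p).add
      (((Cx.nat_const 4).mul Cx.id).add (Cx.nat_const 2))
  have cP : Cx Θ False fun x : ℕ × List Bool => hasTestPrefix G f x.1 x.2 := by
    refine Cx.any_tails (P := fun x : (ℕ × List Bool) × List Bool =>
      decide (x.2.length ≤ f x.1.1) && G x.1.1 x.2.reverse) (Cx.and (Cx.le Cx.snd.length ?_) ?_)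
      (Cx.reverse.comp Cx.snd)
    · have := hf (α := (ℕ × List Bool) × List Bool) (tm := False) (k := fun x => x.1.1)
        (Cx.unary.comp (Cx.fst.comp Cx.fst))
      exact this.length.congr fun a => by simp [unary]
    · have := hG (α := (ℕ × List Bool) × List Bool) (k := fun x => (x.1.1, x.2.reverse))
        (Cx.pairCode.comp ((Cx.fst.comp Cx.fst).pair (Cx.reverse.comp Cx.snd)))
      exact (Cx.head.comp this).congr fun a => rfl
  have cE : Cx Θ False E := by
    refine Cx.select (P := fun x : (List Bool × List Bool) × List Bool =>
      hasTestPrefix G f (2 * x.1.1.length + 1) (x.1.1 ++ x.2)) (cP.comp (Cx.pair ?_ ?_))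
      ((cQ.comp Cx.fst.length).sub Cx.fst.length) Cx.snd
    · exact ((Cx.nat_const 2).mul (Cx.fst.comp Cx.fst).length).add (Cx.nat_const 1)
    · exact (Cx.fst.comp Cx.fst).append Cx.snd
  refine hX ⟨extendAll Q E, fun n => Q (Q (floorOrbit Q n)), ⟨Cx.isFPSPACE_id
    (Cx.extendAll hQ hE cQ cE), floorOrbit Q, isQuickProcessMachine_extendAll hQ hE,
    -- `Q` is a polynomial and involves no call of the machine for `f`, so no auxiliary symbols are
    -- needed here.
    Cx.isUnaryPTIME (Θ := Empty) (Cx.floorOrbit cQ)⟩,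
    Cx.isUnaryPTIME (Θ := Empty) (cQ.comp (cQ.comp (Cx.floorOrbit cQ))),
    compresses_extendAll hQ fun a => ?_⟩
  have hq := hQ a
  obtain ⟨v, hv⟩ := initSeg_prefix X (show a ≤ Q a by omega)
  have hlen := congrArg List.length hv
  rw [List.length_append, length_initSeg, length_initSeg] at hlen
  have hmemb : hasTestPrefix G f (2 * a + 1) (initSeg X a ++ v) = true := by
    obtain ⟨t, ht, htX⟩ := hmem (2 * a + 1)
    refine hasTestPrefix_iff.2 ⟨t, ht, ?_⟩
    rw [hv, ← htX]
    have h1 : t.length ≤ f (2 * a + 1) := ht.1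
    have h2 := hp (2 * a + 1)
    exact initSeg_prefix X (by simp only [hQdef]; omega)
  -- With `a + v.length = Q a` the exponent in this bound is exactly `codeLength Q a`.
  have hcount := hGf.count_le (n := 2 * a + 1) (d := v.length) (τ := initSeg X a)
    (by rw [length_initSeg]; omega)
  rw [length_initSeg, hlen] at hcount
  obtain ⟨idx, h1, h2⟩ := exists_select
    (P := fun u => hasTestPrefix G f (2 * a + 1) (initSeg X a ++ u)) rfl hmemb hcount
  refine ⟨idx, h1, ?_⟩
  rw [← hv, ← h2]
  simp only [hEdef, length_initSeg, show Q a - a = v.length by omega]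

end BPS

theorem theorem3p10 (X : ℕ → Bool) :
    [BPS.MartinLofRandom X, BPS.KolmogorovRandom X, BPS.QuickProcessRandom X].TFAE := by
  tfae_have 1 → 2 := BPS.MartinLofRandom.kolmogorovRandom
  tfae_have 2 → 3 := BPS.KolmogorovRandom.quickProcessRandom
  tfae_have 3 → 1 := BPS.QuickProcessRandom.martinLofRandom
  tfae_finish
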